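/- Let $\omega,\varepsilon,\mu,\sigma>0$ and $L\ge 0$ be constants, $\tilde\omega=\omega\sqrt{\varepsilon\mu}$, $Z=\sqrt{\mu/\varepsilon}$, and consider the time-harmonic Maxwell system $$-i\omega\varepsilon E+\operatorname{curl}H-\sigma E=J,\qquad i\omega\mu H+\operatorname{curl}E=0 \qquad(\ast)$$ for complex fields, with source $J\in L^2(\mathbb R^3)^3$, in the sense of distributions. Let $\Omega_1=(-\infty,L)\times\mathbb R^2$ and $\Omega_2=(0,\infty)\times\mathbb R^2$, with outward unit normals $n_1=(1,0,0)$ on $\Gamma_{12}=\{L\}\times\mathbb R^2$ and $n_2=(-1,0,0)$ on $\Gamma_{21}=\{0\}\times\mathbb R^2$, and let $$\mathcal B_n(E,H)=n\times\tfrac{E}{Z}-n\times(H\times n)$$ (up to a factor $-2$, the incoming characteristic variables for the outward normal $n$). Given an initial guess $u^{1,0}=(E^{1,0},H^{1,0})\in L^2(\Omega_1)^6$, $u^{2,0}=(E^{2,0},H^{2,0})\in L^2(\Omega_2)^6$, the classical Schwarz algorithm seeks, for $n=1,2,\dots$, fields $u^{j,n}\in L^2(\Omega_j)^6$ that solve $(\ast)$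 in $\Omega_j$, $j=1,2$, with $$\mathcal B_{n_1}(u^{1,n})=\mathcal B_{n_1}(u^{2,n-1})\ \text{on }\Gamma_{12},\qquad \mathcal B_{n_2}(u^{2,n})=\mathcal B_{n_2}(u^{1,n-1})\ \text{on }\Gamma_{21}.$$ Here the trace on $\{x=a\}$ of a field of $\Omega_1$ is taken from the side $x<a$, that of a field of $\Omega_2$ from the side $x>a$, each as the limit of averages over slabs of thickness $h\to0^+$ next to $\{x=a\}$; the conditions mean that the difference of the two averages tends to $0$ in the sense of distributions on $\mathbb R^2$. 1. For every $J\in L^2(\mathbb R^3)^3$ the system $(\ast)$ has exactly one solution $u\in L^2(\mathbb R^3)^6$ on $\mathbb R^3$. For every initial guess in $L^2(\Omega_1)^6\times L^2(\Omega_2)^6$ there is at most one sequence of iterates, and every sequence of iterates satisfies $u^{1,n}\to u|_{\Omega_1}$ in $L^2(\Omega_1)^6$ and $u^{2,n}\to u|_{\Omega_2}$ in $L^2(\Omega_2)^6$ as $n\to\infty$. The iterates exist whenever, for some $\delta>0$, the distributional curls of $E^{1,0},H^{1,0}$ are square integrable in $\{-\delta<x<0\}$ and those of $E^{2,0},H^{2,0}$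 are square integrable in $\{L<x<L+\delta\}$ (so that the traces of the guess are defined). 2. For $k=(k_y,k_z)\in\mathbb R^2$ consider the algorithm with $J=0$ on fields $e^{i(k_yy+k_zz)}f_j(x)$, $j=1,2$, that solve $(\ast)$ classically in $\Omega_j$, are continuous up to the boundary, and satisfy $f_1(x)\to0$ as $x\to-\infty$, $f_2(x)\to0$ as $x\to\infty$. These pairs $(f_1,f_2)$ form a finite-dimensional space, on which one step of the algorithm is a well-defined linear map $T_k$. The convergence factor of the mode $k$, that is, the square root of the spectral radius of the double step $T_k^2$, is $$\rho_{cla}(k)=\left|\frac{\lambda-i\tilde\omega}{\lambda+i\tilde\omega}\,e^{-\lambda L}\right|,\qquad \lambda=\sqrt{|k|^2-\tilde\omega^2+i\tilde\omega\sigma Z},$$ with the principal square root. -/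

import Mathlib

open MeasureTheory Filter Topology
open scoped Matrix

noncomputable section

namespace MaxwellSchwarz

/-- Points of the plane of the tangential variables `(y, z)`, and wave vectors `k = (k_y, k_z)`. -/
abbrev Plane := EuclideanSpace ℝ (Fin 2)

/-- Physical space `ℝ³ = ℝ × ℝ²`; a point is written `(x, (y, z))`. Only its differentiable
structure and Lebesgue measure matter, not the norm of the product. -/
abbrev Space := ℝ × Plane

/-- Complex three-dimensional vectors. (All norms on them are equivalent.) -/
abbrev CVec := Fin 3 → ℂ

/-- Values `(E, H)` of an electromagnetic field. -/
abbrev EH := CVec × CVec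

/-- The pulsation, the permittivity, the permeability and the conductivity. -/
structure Params where
  ω : ℝ
  ε : ℝ
  μ : ℝ
  σ : ℝ

namespace Params

/-- The impedance `Z`. -/
def Z (P : Params) : ℝ := √(P.μ / P.ε)

/-- The scaled pulsation `ω √(ε μ)`. -/
def ωt (P : Params) : ℝ := P.ω * √(P.ε * P.μ)

/-- `λ(k)`, the principal square root of `|k|² - ω̃² + i ω̃ σ Z`. -/
def lam (P : Params) (k : Plane) : ℂ :=
  (((‖k‖ ^ 2 - P.ωt ^ 2 : ℝ) : ℂ) + Complex.I * (P.ωt * P.σ * P.Z : ℝ)) ^ (1 / 2 : ℂ)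

/-- The closed formula for the convergence factor of the mode `k` with overlap `L`. -/
def rho (P : Params) (L : ℝ) (k : Plane) : ℝ :=
  ‖(P.lam k - Complex.I * (P.ωt : ℂ)) / (P.lam k + Complex.I * (P.ωt : ℂ))
      * Complex.exp (-(P.lam k * (L : ℂ)))‖

end Params

/-! ### Geometry -/

/-- The coordinate directions of `x`, `y`, `z`. -/
def dir : Fin 3 → Space :=
  ![(1, 0), (0, EuclideanSpace.single 0 1), (0, EuclideanSpace.single 1 1)]

/-- The unit vector in the direction of `x`, as a vector that acts on field values. -/
def ex : CVec := ![1, 0, 0]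

/-- The open slab `a < x < b`. -/
def slab (a b : ℝ) : Set Space := {p | a < p.1 ∧ p.1 < b}

/-- The left subdomain `(-∞, L) × ℝ²`. -/
def Ω₁ (L : ℝ) : Set Space := {p | p.1 < L}

/-- The right subdomain `(0, ∞) × ℝ²`. -/
def Ω₂ : Set Space := {p | 0 < p.1}

/-! ### The curl, classically and in the sense of distributions -/

/-- `∂_j F_i` at `p`. -/
def pderiv (F : Space → CVec) (j i : Fin 3) (p : Space) : ℂ := fderiv ℝ F p (dir j) i

/-- The classical curl. -/
def curl (F : Space → CVec) (p : Space) : CVec :=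
  ![pderiv F 1 2 p - pderiv F 2 1 p,
    pderiv F 2 0 p - pderiv F 0 2 p,
    pderiv F 0 1 p - pderiv F 1 0 p]

/-- Smooth vector fields with compact support in `S`. -/
def IsTestField (S : Set Space) (φ : Space → CVec) : Prop :=
  ContDiff ℝ (⊤ : ℕ∞) φ ∧ HasCompactSupport φ ∧ tsupport φ ⊆ S

/-- `curl F = G` in the open set `S` in the sense of distributions. -/
def HasWeakCurl (S : Set Space) (F G : Space → CVec) : Prop :=
  ∀ φ : Space → CVec, IsTestField S φ →
    ∫ p in S, F p ⬝ᵥ curl φ p = ∫ p in S, G p ⬝ᵥ φ p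

/-- Both components of the field have weak curls in `L²(S)`. -/
def HasSqIntegrableCurl (S : Set Space) (U : Space → EH) : Prop :=
  ∃ C : Space → EH, MemLp C 2 (volume.restrict S) ∧
    HasWeakCurl S (fun p => (U p).1) (fun p => (C p).1) ∧
    HasWeakCurl S (fun p => (U p).2) (fun p => (C p).2)

/-! ### The time-harmonic Maxwell system -/

/-- `U = (E, H)` is a distributional solution in `S` of
`-iωε E + curl H - σ E = J`, `iωμ H + curl E = 0`. -/
def IsWeakMaxwell (P : Params) (S : Set Space) (J : Space → CVec) (U : Space → EH) : Prop :=
  HasWeakCurl S (fun p => (U p).2)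
    (fun p => J p + (Complex.I * P.ω * P.ε) • (U p).1 + (P.σ : ℂ) • (U p).1) ∧
  HasWeakCurl S (fun p => (U p).1) (fun p => -((Complex.I * P.ω * P.μ) • (U p).2))

/-- `U = (E, H)` is a classical solution in `S` of the homogeneous system
`-iωε E + curl H - σ E = 0`, `iωμ H + curl E = 0`. -/
def IsClassicalMaxwell (P : Params) (S : Set Space) (U : Space → EH) : Prop :=
  ∀ p ∈ S, DifferentiableAt ℝ U p ∧
    -((Complex.I * P.ω * P.ε) • (U p).1) + curl (fun q => (U q).2) p - (P.σ : ℂ) • (U p).1 = 0 ∧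
    (Complex.I * P.ω * P.μ) • (U p).2 + curl (fun q => (U q).1) p = 0

/-! ### Transmission conditions -/

/-- The impedance operator `n × E / Z - n × (H × n)`. For the outward normal `n` these are, up to
the factor `-2`, the characteristic variables that enter the domain: for `n = (1, 0, 0)` it is
`(0, -(E₃ / Z + H₂), E₂ / Z - H₃)`. -/
def impedance (P : Params) (n : CVec) : EH →ₗ[ℂ] CVec where
  toFun u := ((P.Z : ℂ)⁻¹) • (n ⨯₃ u.1) - n ⨯₃ (u.2 ⨯₃ n)
  map_add' u v := by
    simp only [Prod.fst_add, Prod.snd_add, map_add, LinearMap.add_apply, smul_add]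
    abel
  map_smul' c u := by
    simp only [Prod.smul_fst, Prod.smul_snd, map_smul, LinearMap.smul_apply, RingHom.id_apply,
      smul_sub, smul_comm c]

/-- The impedance traces with respect to `n` on the plane `x = a`, of the field `U` from the side
`x < a` and of the field `V` from the side `x > a`, are equal as distributions on the plane; the
traces are the limits of the averages over thin slabs. -/
def TracesAgree (P : Params) (n : CVec) (a : ℝ) (U V : Space → EH) : Prop :=
  ∀ ψ : Plane → ℂ, ContDiff ℝ (⊤ : ℕ∞) ψ → HasCompactSupport ψ →
    Tendsto (fun h : ℝ =>
      h⁻¹ • (∫ p in slab (a - h) a, ψ p.2 • impedance P n (U p))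
        - h⁻¹ • (∫ p in slab a (a + h), ψ p.2 • impedance P n (V p)))
      (𝓝[>] 0) (𝓝 0)

/-! ### The classical Schwarz algorithm -/

/-- `(U₁ n, U₂ n)`, `n = 0, 1, 2, …`, are square integrable iterates of the classical Schwarz
algorithm with source `J` and initial guess `(U₁ 0, U₂ 0)`. -/
structure IsSchwarz (P : Params) (L : ℝ) (J : Space → CVec) (U₁ U₂ : ℕ → Space → EH) : Prop where
  memLp₁ : ∀ n, MemLp (U₁ n) 2 (volume.restrict (Ω₁ L))
  memLp₂ : ∀ n, MemLp (U₂ n) 2 (volume.restrict Ω₂)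
  maxwell₁ : ∀ n, IsWeakMaxwell P (Ω₁ L) J (U₁ (n + 1))
  maxwell₂ : ∀ n, IsWeakMaxwell P Ω₂ J (U₂ (n + 1))
  transmission₁ : ∀ n, TracesAgree P ex L (U₁ (n + 1)) (U₂ n)
  transmission₂ : ∀ n, TracesAgree P (-ex) 0 (U₁ n) (U₂ (n + 1))

/-! ### The algorithm on a single Fourier mode -/

/-- The Fourier mode `e^{i (k_y y + k_z z)} f(x)`. -/
def modeField (k : Plane) (f : ℝ → EH) (p : Space) : EH :=
  Complex.exp (Complex.I * (inner ℝ k p.2 : ℝ)) • f p.1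


lemma curl_add {F G : Space → CVec} {p : Space} (hF : DifferentiableAt ℝ F p)
    (hG : DifferentiableAt ℝ G p) :
    curl (fun q => F q + G q) p = curl F p + curl G p := by
  have h : fderiv ℝ (fun q => F q + G q) p = fderiv ℝ F p + fderiv ℝ G p := fderiv_add hF hG
  funext i
  fin_cases i <;> simp [curl, pderiv, h] <;> ring

lemma curl_smul {F : Space → CVec} {p : Space} (c : ℂ) (hF : DifferentiableAt ℝ F p) :
    curl (fun q => c • F q) p = c • curl F p := by
  have h : fderiv ℝ (fun q => c • F q) p = c • fderiv ℝ F p := fderiv_const_smul hF c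
  funext i
  fin_cases i <;> simp [curl, pderiv, h] <;> ring

lemma isClassicalMaxwell_zero (P : Params) (S : Set Space) :
    IsClassicalMaxwell P S (fun _ => 0) := by
  have h : ∀ p, curl (fun _ => (0 : CVec)) p = 0 := by
    intro p
    funext i
    fin_cases i <;> simp [curl, pderiv]
  intro p _
  exact ⟨differentiableAt_const _, by simp [h], by simp [h]⟩

lemma IsClassicalMaxwell.add {P : Params} {S : Set Space} {U V : Space → EH}
    (hU : IsClassicalMaxwell P S U) (hV : IsClassicalMaxwell P S V) :
    IsClassicalMaxwell P S (fun p => U p + V p) := by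
  intro p hp
  obtain ⟨dU, U1, U2⟩ := hU p hp
  obtain ⟨dV, V1, V2⟩ := hV p hp
  refine ⟨dU.add dV, ?_, ?_⟩
  · simp only [Prod.fst_add, Prod.snd_add]
    rw [curl_add dU.snd dV.snd]
    have h := congrArg₂ (· + ·) U1 V1
    simp only [add_zero] at h
    rw [← h, smul_add, smul_add]
    abel
  · simp only [Prod.fst_add, Prod.snd_add]
    rw [curl_add dU.fst dV.fst]
    have h := congrArg₂ (· + ·) U2 V2
    simp only [add_zero] at h
    rw [← h, smul_add]
    abel

lemma IsClassicalMaxwell.smul {P : Params} {S : Set Space} {U : Space → EH} (c : ℂ)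
    (hU : IsClassicalMaxwell P S U) : IsClassicalMaxwell P S (fun p => c • U p) := by
  intro p hp
  obtain ⟨dU, U1, U2⟩ := hU p hp
  refine ⟨dU.const_smul c, ?_, ?_⟩
  · simp only [Prod.smul_fst, Prod.smul_snd]
    rw [curl_smul c dU.snd]
    have := congrArg (fun v => c • v) U1
    simp only [smul_sub, smul_add, smul_neg, smul_zero] at this
    rw [← this, smul_comm c, smul_comm c (P.σ : ℂ)]
  · simp only [Prod.smul_fst, Prod.smul_snd]
    rw [curl_smul c dU.fst]
    have := congrArg (fun v => c • v) U2
    simp only [smul_add, smul_zero] at this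
    rw [← this, smul_comm c]

lemma modeField_add (k : Plane) (f g : ℝ → EH) :
    modeField k (f + g) = fun p => modeField k f p + modeField k g p := by
  funext p
  simp [modeField]

lemma modeField_smul (k : Plane) (c : ℂ) (f : ℝ → EH) :
    modeField k (c • f) = fun p => c • modeField k f p := by
  funext p
  simp only [modeField, Pi.smul_apply]
  rw [smul_comm]

/-- The space of the profiles `f` on the closed interval `I`, extended by zero, for which
`e^{i (k_y y + k_z z)} f(x)` solves the homogeneous Maxwell system classically in `S`, is
continuous up to the boundary, and vanishes at infinity (along `l`). -/
def modeSpace (P : Params) (k : Plane) (I : Set ℝ) (S : Set Space) (l : Filter ℝ) :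
    Submodule ℂ (ℝ → EH) where
  carrier := {f | (∀ x, x ∉ I → f x = 0) ∧ ContinuousOn f I ∧
    IsClassicalMaxwell P S (modeField k f) ∧ Tendsto f l (𝓝 0)}
  add_mem' := by
    rintro f g ⟨f1, f2, f3, f4⟩ ⟨g1, g2, g3, g4⟩
    refine ⟨fun x hx => by simp [f1 x hx, g1 x hx], f2.add g2, ?_, ?_⟩
    · rw [modeField_add]
      exact f3.add g3
    · have h := f4.add g4
      rw [add_zero] at h
      exact h
  zero_mem' := by
    refine ⟨fun _ _ => rfl, continuousOn_const, ?_, tendsto_const_nhds⟩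
    have : modeField k 0 = fun _ => 0 := by
      funext p
      simp [modeField]
    rw [this]
    exact isClassicalMaxwell_zero P S
  smul_mem' := by
    rintro c f ⟨f1, f2, f3, f4⟩
    refine ⟨fun x hx => by simp [f1 x hx], f2.const_smul c, ?_, ?_⟩
    · rw [modeField_smul]
      exact f3.smul c
    · have h := f4.const_smul c
      rw [smul_zero] at h
      exact h

/-- Modes in the left subdomain, decaying as `x → -∞`. -/
abbrev Mode₁ (P : Params) (L : ℝ) (k : Plane) : Submodule ℂ (ℝ → EH) :=
  modeSpace P k (Set.Iic L) (Ω₁ L) atBot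

/-- Modes in the right subdomain, decaying as `x → ∞`. -/
abbrev Mode₂ (P : Params) (k : Plane) : Submodule ℂ (ℝ → EH) :=
  modeSpace P k (Set.Ici 0) Ω₂ atTop

/-- `w = (w₁, w₂)` is obtained from `u = (u₁, u₂)` by one step of the Schwarz algorithm on the
mode `k`, with vanishing source: `w₁` takes its incoming data at `x = L` from `u₂`, and `w₂` takes
its incoming data at `x = 0` from `u₁`. (The factor `e^{i (k_y y + k_z z)}` cancels.) -/
def ModeStep (P : Params) (L : ℝ) (k : Plane) (u w : Mode₁ P L k × Mode₂ P k) : Prop :=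
  impedance P ex (w.1.1 L) = impedance P ex (u.2.1 L) ∧
  impedance P (-ex) (w.2.1 0) = impedance P (-ex) (u.1.1 0)

/-- `r` is the convergence factor of the algorithm on the mode `k`: one step of the algorithm is a
linear map `T` on a finite-dimensional space, and `r` is the square root of the spectral radius of
the iteration `T²` over two steps. -/
def IsModeConvergenceFactor (P : Params) (L : ℝ) (k : Plane) (r : ℝ) : Prop :=
  FiniteDimensional ℂ (Mode₁ P L k × Mode₂ P k) ∧
  ∃ T : Module.End ℂ (Mode₁ P L k × Mode₂ P k),
    (∀ u w, T u = w ↔ ModeStep P L k u w) ∧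
    IsGreatest ((fun z : ℂ => √‖z‖) '' spectrum ℂ (T ^ 2)) r

end MaxwellSchwarz

end

open MaxwellSchwarz

/-!
The Fourier transform in the tangential variables `(y, z)` diagonalizes the algorithm.

On one tangential frequency `k` the homogeneous Maxwell system is a system of ordinary differential
equations whose components all satisfy `u'' = λ² u`, with `Re λ > 0` because of the conductivity. The
solutions which decay (or are square integrable) on a half-line are therefore exponentials times a
constant amplitude (`ModeSystem.exists_amplitude`). The normal components of the electric and of the
magnetic amplitude separate the two polarizations: the incoming impedance trace of an outgoing
exponential is matched by multiplying them with the reflection coefficients `rTM` and `rTE`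
(`IsAmplitude.longitudinal`, `IsAmplitude.transverse`), where `|rTM| ≤ |rTE| < 1`
(`Params.norm_rTM_le`, `Params.norm_rTE_lt_one`). Together with the decay `e^{-λL}` across the
overlap this gives the two eigenvalues of the double step on a classical mode, and the larger one is
the square of the convergence factor (`isModeConvergenceFactor_rho`).

For square integrable weak solutions the same analysis applies on almost every frequency.
`HasWeakCurl.ae_ft` turns the weak equations into the mode system with weak derivatives in `x`, so
that the errors of the iterates are exponentials there (`IsWeakMaxwell.exists_amplitude`), and
`TracesAgree.ae_eq` turns the transmission conditions, which are limits of averages over slabs, into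
the mode by mode conditions; dominated convergence applies since traces cost only a factor
`√(Re λ)`, which test functions absorb. Hence the energy of the error on a frequency contracts by
`|rTE|²` in every step (`ae_errorEnergy_le`). The factor is less than one but not uniformly in `k`,
so that the errors tend to zero by dominated convergence in `k` and Plancherel's theorem, without a
rate (`IsSchwarz.tendsto`). If the guesses coincide the energy of the difference is zero, whence the
uniqueness of the iterates (`IsSchwarz.ae_eq`); on the whole line no exponential is square
integrable, whence the uniqueness of the solution on the whole space (`IsWeakMaxwell.ae_eq`).

Existence rests on a coercivity estimate for the conductive Maxwell system (`maxwell_coercive`) and a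
duality argument (`exists_weak_solution`), applied on the whole space (`exists_wholeSpace`) and, with
test fields that satisfy the adjoint impedance condition, on a half space with vanishing incoming
trace (`exists_halfSpace_solution`). Incoming data are lifted by the mirror image of the old field,
cut off near the interface (`exists_step_left`); the right subdomain is reduced to the left one by
reflection.
-/

noncomputable section

namespace MaxwellSchwarz

/-! ### The constants -/

namespace Params

/-- All four physical constants are positive. -/
structure Pos (P : Params) : Prop where
  ω : 0 < P.ω
  ε : 0 < P.ε
  μ : 0 < P.μ
  σ : 0 < P.σ

/-- The complex admittivity `iωε + σ`, so that Ampère's law reads `curl H = J + admittivity • E`. -/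
def adm (P : Params) : ℂ := Complex.I * P.ω * P.ε + P.σ

/-- The complex impedivity `iωμ`, so that Faraday's law reads `curl E = -(impedivity • H)`. -/
def imp (P : Params) : ℂ := Complex.I * P.ω * P.μ

variable {P : Params}

lemma Pos.Z (hP : P.Pos) : 0 < P.Z := Real.sqrt_pos.2 (div_pos hP.μ hP.ε)

lemma Pos.ωt (hP : P.Pos) : 0 < P.ωt := mul_pos hP.ω (Real.sqrt_pos.2 (mul_pos hP.ε hP.μ))

lemma Pos.adm_ne (hP : P.Pos) : P.adm ≠ 0 := by
  intro h
  have := congrArg Complex.re h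
  simp [adm] at this
  exact hP.σ.ne' this

lemma Pos.imp_ne (hP : P.Pos) : P.imp ≠ 0 := by
  simp [imp, hP.ω.ne', hP.μ.ne']

lemma Pos.ωt_mul_Z (hP : P.Pos) : P.ωt * P.Z = P.ω * P.μ := by
  have h : √(P.ε * P.μ) * √(P.μ / P.ε) = P.μ := by
    rw [← Real.sqrt_mul (mul_pos hP.ε hP.μ).le]
    have : P.ε * P.μ * (P.μ / P.ε) = P.μ ^ 2 := by
      field_simp [hP.ε.ne']
    rw [this, Real.sqrt_sq hP.μ.le]
  rw [Params.ωt, Params.Z, mul_assoc, h]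

lemma Pos.ωt_eq (hP : P.Pos) : P.ωt = P.ω * P.ε * P.Z := by
  have h : √(P.ε * P.μ) = P.ε * √(P.μ / P.ε) := by
    rw [show P.ε * P.μ = P.ε ^ 2 * (P.μ / P.ε) by field_simp [hP.ε.ne'],
      Real.sqrt_mul (sq_nonneg _), Real.sqrt_sq hP.ε.le]
  rw [Params.ωt, Params.Z, h, mul_assoc]

lemma Pos.imp_eq (hP : P.Pos) : P.imp = Complex.I * P.ωt * P.Z := by
  rw [imp, mul_assoc, mul_assoc, ← Complex.ofReal_mul, ← Complex.ofReal_mul, hP.ωt_mul_Z]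

lemma Pos.adm_mul_Z (hP : P.Pos) :
    P.adm * P.Z = Complex.I * P.ωt + (P.σ * P.Z : ℝ) := by
  rw [adm, hP.ωt_eq]
  push_cast
  ring

lemma Pos.sq_arg (hP : P.Pos) (k : Plane) :
    (((‖k‖ ^ 2 - P.ωt ^ 2 : ℝ) : ℂ) + Complex.I * (P.ωt * P.σ * P.Z : ℝ)) =
      (‖k‖ ^ 2 : ℝ) + P.adm * P.imp := by
  have h := hP.adm_mul_Z
  rw [hP.imp_eq,
    show P.adm * (Complex.I * P.ωt * P.Z) = Complex.I * P.ωt * (P.adm * P.Z) by ring, h]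
  push_cast
  linear_combination (- (P.ωt : ℂ) ^ 2) * Complex.I_sq

lemma Pos.arg_im (hP : P.Pos) (k : Plane) :
    0 < (((‖k‖ ^ 2 - P.ωt ^ 2 : ℝ) : ℂ) + Complex.I * (P.ωt * P.σ * P.Z : ℝ)).im := by
  rw [Complex.add_im, Complex.ofReal_im, Complex.I_mul_im, Complex.ofReal_re, zero_add]
  exact mul_pos (mul_pos hP.ωt hP.σ) hP.Z

lemma lam_sq (hP : P.Pos) (k : Plane) : P.lam k ^ 2 = (‖k‖ ^ 2 : ℝ) + P.adm * P.imp := by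
  rw [← hP.sq_arg, Params.lam, one_div]
  exact_mod_cast Complex.cpow_nat_inv_pow _ two_ne_zero

lemma lam_re_im_pos (hP : P.Pos) (k : Plane) : 0 < (P.lam k).re ∧ 0 < (P.lam k).im := by
  have him := hP.arg_im k
  rw [Params.lam]
  set z := (((‖k‖ ^ 2 - P.ωt ^ 2 : ℝ) : ℂ) + Complex.I * (P.ωt * P.σ * P.Z : ℝ)) with hz
  have hz0 : z ≠ 0 := fun h => by simp [h] at him
  have harg : 0 < z.arg := lt_of_le_of_ne (Complex.arg_nonneg_iff.2 him.le) fun h => by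
    have := (Complex.arg_eq_zero_iff.1 h.symm).2
    exact him.ne' this
  have harg' : z.arg < Real.pi := lt_of_le_of_ne (Complex.arg_le_pi z) fun h => by
    have := (Complex.arg_eq_pi_iff.1 h).2
    exact him.ne' this
  rw [Complex.cpow_def_of_ne_zero hz0, Complex.exp_re, Complex.exp_im]
  have h1 : (Complex.log z * (1 / 2)).im = z.arg / 2 := by
    rw [show Complex.log z * (1 / 2) = Complex.log z / (2 : ℝ) by push_cast; ring,
      Complex.div_ofReal_im, Complex.log_im]
  rw [h1]
  exact ⟨mul_pos (Real.exp_pos _) (Real.cos_pos_of_mem_Ioo ⟨by linarith, by linarith⟩),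
    mul_pos (Real.exp_pos _) (Real.sin_pos_of_pos_of_lt_pi (by linarith) (by linarith))⟩

lemma lam_re_pos (hP : P.Pos) (k : Plane) : 0 < (P.lam k).re := (lam_re_im_pos hP k).1

lemma lam_ne (hP : P.Pos) (k : Plane) : P.lam k ≠ 0 := fun h => by
  have := lam_re_pos hP k
  simp [h] at this

lemma norm_lam_le (hP : P.Pos) : ∃ C : ℝ, 0 < C ∧ ∀ k : Plane, ‖P.lam k‖ ≤ C * (1 + ‖k‖) := by
  refine ⟨1 + ‖P.adm * P.imp‖, by positivity, fun k => ?_⟩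
  refine le_of_sq_le_sq ?_ (by positivity)
  rw [← norm_pow, lam_sq hP]
  refine (norm_add_le _ _).trans ?_
  rw [Complex.norm_real, Real.norm_of_nonneg (by positivity)]
  have h1 := norm_nonneg (P.adm * P.imp)
  have h2 := norm_nonneg k
  nlinarith [mul_nonneg h1 h2, mul_nonneg (mul_nonneg h1 h1) h2, sq_nonneg ‖k‖,
    mul_nonneg (mul_nonneg h1 h1) (sq_nonneg ‖k‖), mul_nonneg h1 (sq_nonneg ‖k‖)]

/-! ### Reflection coefficients of the two polarizations -/

/-- The reflection coefficient of the transverse electric modes. -/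
def rTE (P : Params) (k : Plane) : ℂ :=
  (P.imp / P.Z - P.lam k) / (P.imp / P.Z + P.lam k)

/-- The reflection coefficient of the transverse magnetic modes. -/
def rTM (P : Params) (k : Plane) : ℂ :=
  (P.adm * P.Z - P.lam k) / (P.adm * P.Z + P.lam k)

lemma Pos.imp_div_Z (hP : P.Pos) : P.imp / P.Z = Complex.I * P.ωt := by
  rw [hP.imp_eq, mul_div_assoc, div_self (by exact_mod_cast hP.Z.ne'), mul_one]

lemma imp_add_lam_ne (hP : P.Pos) (k : Plane) : P.imp / P.Z + P.lam k ≠ 0 := fun h => by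
  have := congrArg Complex.re h
  rw [hP.imp_div_Z] at this
  simp at this
  exact (lam_re_pos hP k).ne' this

lemma adm_add_lam_ne (hP : P.Pos) (k : Plane) : P.adm * P.Z + P.lam k ≠ 0 := fun h => by
  have := congrArg Complex.re h
  rw [hP.adm_mul_Z] at this
  simp at this
  nlinarith [lam_re_pos hP k, mul_pos hP.σ hP.Z]

/-- For `s` in the closed first quadrant, `|(s - λ) / (s + λ)|²` is `(1 - q) / (1 + q)` with
`q = 2 Re (s λ̄) / (|s|² + |λ|²)`; the transverse electric factor has the smaller `q`. -/
lemma norm_rTM_le (hP : P.Pos) (k : Plane) : ‖P.rTM k‖ ≤ ‖P.rTE k‖ := by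
  obtain ⟨hp, hq⟩ := lam_re_im_pos hP k
  have h1 := imp_add_lam_ne hP k
  have h2 := adm_add_lam_ne hP k
  have hsq := lam_sq hP k
  rw [← hP.sq_arg k] at hsq
  rw [rTM, rTE, norm_div, norm_div, div_le_div_iff₀ (norm_pos_iff.2 h2) (norm_pos_iff.2 h1)]
  rw [hP.imp_div_Z, hP.adm_mul_Z] at *
  set p := (P.lam k).re with hpd
  set q := (P.lam k).im with hqd
  set w := P.ωt with hw
  set s := P.σ * P.Z with hs
  have hw0 : 0 < w := hP.ωt
  have hs0 : 0 < s := mul_pos hP.σ hP.Z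
  have e1 : p ^ 2 - q ^ 2 = ‖k‖ ^ 2 - w ^ 2 := by
    have := congrArg Complex.re hsq
    simp [pow_two, hpd, hqd, -Complex.ofReal_mul] at this ⊢
    linarith
  have e2 : 2 * p * q = w * s := by
    have := congrArg Complex.im hsq
    simp only [pow_two, Complex.mul_im, Complex.add_im, Complex.ofReal_im, Complex.I_re,
      Complex.I_im, Complex.ofReal_re] at this
    rw [← hpd, ← hqd] at this
    linarith
  refine le_of_sq_le_sq ?_ (by positivity)
  rw [mul_pow, mul_pow, ← Complex.normSq_eq_norm_sq, ← Complex.normSq_eq_norm_sq,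
    ← Complex.normSq_eq_norm_sq, ← Complex.normSq_eq_norm_sq]
  simp only [Complex.normSq_apply, Complex.add_re, Complex.add_im, Complex.sub_re, Complex.sub_im,
    Complex.mul_re, Complex.mul_im, Complex.ofReal_re, Complex.ofReal_im, Complex.I_re,
    Complex.I_im, ← hpd, ← hqd]
  ring_nf
  have key : w * q * (p ^ 2 + q ^ 2 + w ^ 2 + s ^ 2) ≤
      (w * q + s * p) * (p ^ 2 + q ^ 2 + w ^ 2) := by
    have : (w * q + s * p) * (p ^ 2 + q ^ 2 + w ^ 2) -
        w * q * (p ^ 2 + q ^ 2 + w ^ 2 + s ^ 2) = s * p * ‖k‖ ^ 2 := by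
      linear_combination s * p * e1 + s * q * e2
    linarith [mul_nonneg (mul_pos hs0 hp).le (sq_nonneg ‖k‖)]
  nlinarith [key]

lemma norm_rTE_lt_one (hP : P.Pos) (k : Plane) : ‖P.rTE k‖ < 1 := by
  obtain ⟨hp, hq⟩ := lam_re_im_pos hP k
  have h1 := imp_add_lam_ne hP k
  rw [rTE, norm_div, div_lt_one (norm_pos_iff.2 h1)]
  rw [hP.imp_div_Z]
  refine lt_of_pow_lt_pow_left₀ 2 (norm_nonneg _) ?_
  rw [← Complex.normSq_eq_norm_sq, ← Complex.normSq_eq_norm_sq]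
  simp only [Complex.normSq_apply, Complex.add_re, Complex.add_im, Complex.sub_re, Complex.sub_im,
    Complex.mul_re, Complex.mul_im, Complex.ofReal_re, Complex.ofReal_im, Complex.I_re,
    Complex.I_im]
  nlinarith [mul_pos hP.ωt hq]

lemma rho_eq (hP : P.Pos) (L : ℝ) (k : Plane) :
    P.rho L k = ‖P.rTE k * Complex.exp (-(P.lam k * L))‖ := by
  rw [Params.rho, rTE, hP.imp_div_Z, norm_mul, norm_mul, norm_div, norm_div, ← norm_sub_rev,
    add_comm (P.lam k)]

end Params

/-! ### Impedance traces in coordinates -/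

lemma impedance_ex (P : Params) (u : EH) :
    impedance P ex u = ![0, -(u.1 2 / P.Z + u.2 1), u.1 1 / P.Z - u.2 2] := by
  funext i
  fin_cases i <;> simp [impedance, ex, crossProduct, div_eq_inv_mul]
  ring

lemma impedance_neg_ex (P : Params) (u : EH) :
    impedance P (-ex) u = ![0, u.1 2 / P.Z - u.2 1, -(u.1 1 / P.Z) - u.2 2] := by
  funext i
  fin_cases i <;> simp [impedance, ex, crossProduct, div_eq_inv_mul]

/-! ### The Maxwell system on a single tangential frequency -/

/-- The homogeneous Maxwell system `curl h = a e`, `curl e = -b h` on one tangential frequency.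
The components lie in a vector space `M` of profiles in `x`; the tangential derivatives are the
multiplications by `p = i k_y` and `q = i k_z`, and `(u, v) ∈ D` means that `v` is the derivative of
`u`. As `D` is a relation, weak and classical derivatives are both covered. -/
structure ModeSystem {M : Type*} [AddCommGroup M] [Module ℂ M] (D : Submodule ℂ (M × M))
    (a b p q : ℂ) (e h : Fin 3 → M) : Prop where
  h_x : p • h 2 - q • h 1 = a • e 0
  h_y : (h 2, q • h 0 - a • e 1) ∈ D
  h_z : (h 1, p • h 0 + a • e 2) ∈ D
  e_x : p • e 2 - q • e 1 = -(b • h 0)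
  e_y : (e 2, q • e 0 + b • h 1) ∈ D
  e_z : (e 1, p • e 0 - b • h 2) ∈ D

namespace ModeSystem

variable {M : Type*} [AddCommGroup M] [Module ℂ M] {D : Submodule ℂ (M × M)}
  {a b p q : ℂ} {e h : Fin 3 → M}

lemma mem_congr {u v v' : M} (hv : (u, v) ∈ D) (h : v = v') : (u, v') ∈ D := h ▸ hv

/-- The system is invariant under `(e, h, a, b) ↦ (h, e, -b, -a)`. -/
lemma swap (s : ModeSystem D a b p q e h) : ModeSystem D (-b) (-a) p q h e where
  h_x := by rw [s.e_x, neg_smul]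
  h_y := mem_congr s.e_y (by module)
  h_z := mem_congr s.e_z (by module)
  e_x := by rw [s.h_x]; module
  e_y := mem_congr s.h_y (by module)
  e_z := mem_congr s.h_z (by module)

/-- The divergence of `h` vanishes. -/
lemma div_h (s : ModeSystem D a b p q e h) (hb : b ≠ 0) :
    (h 0, -(p • h 1 + q • h 2)) ∈ D := by
  have h1 := D.smul_mem b⁻¹ (D.sub_mem (D.smul_mem q s.e_z) (D.smul_mem p s.e_y))
  have h2 : q • e 1 - p • e 2 = b • h 0 := by
    rw [← neg_sub, s.e_x, neg_neg]
  simp only [Prod.smul_mk, Prod.mk_sub_mk] at h1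
  rw [h2, inv_smul_smul₀ hb] at h1
  refine mem_congr h1 ?_
  rw [inv_smul_eq_iff₀ hb]
  module

lemma h_two (s : ModeSystem D a b p q e h) (hb : b ≠ 0) (i : Fin 3) :
    ∃ v, (h i, v) ∈ D ∧ (v, (a * b - p ^ 2 - q ^ 2) • h i) ∈ D := by
  have hx : a • e 0 = p • h 2 - q • h 1 := s.h_x.symm
  match i with
  | 0 =>
    refine ⟨_, s.div_h hb, ?_⟩
    refine mem_congr (D.neg_mem (D.add_mem (D.smul_mem p s.h_z) (D.smul_mem q s.h_y))) ?_
    have h3 : a • (p • e 2 - q • e 1) = a • -(b • h 0) := by rw [s.e_x]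
    change -(p • (p • h 0 + a • e 2) + q • (q • h 0 - a • e 1)) = _
    linear_combination (norm := module) -h3
  | 1 =>
    refine ⟨_, s.h_z, ?_⟩
    refine mem_congr (D.add_mem (D.smul_mem p (s.div_h hb)) (D.smul_mem a s.e_y)) ?_
    simp only [Prod.smul_mk]
    have h3 : q • a • e 0 = q • (p • h 2 - q • h 1) := by rw [hx]
    linear_combination (norm := module) h3
  | 2 =>
    refine ⟨_, s.h_y, ?_⟩
    refine mem_congr (D.sub_mem (D.smul_mem q (s.div_h hb)) (D.smul_mem a s.e_z)) ?_
    simp only [Prod.smul_mk]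
    have h3 : p • a • e 0 = p • (p • h 2 - q • h 1) := by rw [hx]
    linear_combination (norm := module) -h3

/-- If the first-order equation `w' = m w` has only the solutions `C ε`, and `w' = -m w` has none
(in the space `M` at hand), then every solution of the system is a vector multiple of `ε`, where
`m² = ab - p² - q²`. Indeed every component `u` satisfies `u'' = m² u`, so that `u' + m u` and
`u' - m u` solve the two first-order equations. -/
lemma exists_amplitude (s : ModeSystem D a b p q e h) (ha : a ≠ 0) (hb : b ≠ 0) {m : ℂ}
    (hm2 : m ^ 2 = a * b - p ^ 2 - q ^ 2) {ε : M}
    (h_grow : ∀ w, (w, m • w) ∈ D → ∃ C : ℂ, w = C • ε)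
    (h_zero : ∀ w, (w, -m • w) ∈ D → w = 0) :
    ∃ c d : Fin 3 → ℂ, (∀ i, e i = c i • ε) ∧ ∀ i, h i = d i • ε := by
  have key : ∀ u v : M, (u, v) ∈ D → (v, (a * b - p ^ 2 - q ^ 2) • u) ∈ D → ∃ C : ℂ, u = C • ε := by
    intro u v huv hvu
    have h1 : (v - m • u, -m • (v - m • u)) ∈ D := by
      refine mem_congr (D.sub_mem hvu (D.smul_mem m huv)) ?_
      rw [← hm2]
      simp only [Prod.smul_mk]
      module
    have h2 : v = m • u := sub_eq_zero.1 (h_zero _ h1)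
    exact h_grow u (h2 ▸ huv)
  have hh : ∀ i, ∃ C : ℂ, h i = C • ε := fun i => by
    obtain ⟨v, h1, h2⟩ := s.h_two hb i
    exact key _ v h1 h2
  have he : ∀ i, ∃ C : ℂ, e i = C • ε := fun i => by
    obtain ⟨v, h1, h2⟩ := s.swap.h_two (neg_ne_zero.2 ha) i
    refine key _ v h1 (mem_congr h2 ?_)
    congr 1
    ring
  choose c hc using he
  choose d hd using hh
  exact ⟨c, d, hc, hd⟩

end ModeSystem

/-- `(c, d)` is the amplitude of an exponential solution `(c, d) e^{mx}` of the Maxwell system on a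
tangential frequency: the derivative is the multiplication by `m`. -/
def IsAmplitude (a b m p q : ℂ) (c d : Fin 3 → ℂ) : Prop :=
  (p * d 2 - q * d 1 = a * c 0 ∧ m * d 2 = q * d 0 - a * c 1 ∧ m * d 1 = p * d 0 + a * c 2) ∧
  (p * c 2 - q * c 1 = -(b * d 0) ∧ m * c 2 = q * c 0 + b * d 1 ∧ m * c 1 = p * c 0 - b * d 2)

lemma ModeSystem.isAmplitude {M : Type*} [AddCommGroup M] [Module ℂ M] {D : Submodule ℂ (M × M)}
    {a b p q m : ℂ} {c d : Fin 3 → ℂ} {ε : M} (hε : ε ≠ 0) (hD : (ε, m • ε) ∈ D)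
    (h0 : ∀ v, (0, v) ∈ D → v = 0)
    (s : ModeSystem D a b p q (fun i => c i • ε) (fun i => d i • ε)) :
    IsAmplitude a b m p q c d := by
  have inj : ∀ x y : ℂ, x • ε = y • ε → x = y := fun x y h => smul_left_injective ℂ hε h
  have key : ∀ x y : ℂ, (x • ε, y • ε) ∈ D → m * x = y := by
    intro x y h
    have h1 := D.sub_mem h (D.smul_mem x hD)
    rw [Prod.smul_mk, Prod.mk_sub_mk, sub_self] at h1
    have h2 := sub_eq_zero.1 (h0 _ h1)
    rw [smul_smul] at h2
    rw [mul_comm]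
    exact (inj _ _ h2).symm
  refine ⟨⟨inj _ _ ?_, key _ _ ?_, key _ _ ?_⟩, ⟨inj _ _ ?_, key _ _ ?_, key _ _ ?_⟩⟩
  · have := s.h_x; simp only [smul_smul] at this; rw [← this]; module
  · exact ModeSystem.mem_congr s.h_y (by module)
  · exact ModeSystem.mem_congr s.h_z (by module)
  · have := s.e_x; simp only [smul_smul] at this; rw [neg_smul, ← this]; module
  · exact ModeSystem.mem_congr s.e_y (by module)
  · exact ModeSystem.mem_congr s.e_z (by module)

namespace IsAmplitude

variable {a b m p q : ℂ} {c d : Fin 3 → ℂ}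

lemma swap (h : IsAmplitude a b m p q c d) : IsAmplitude (-b) (-a) m p q d c := by
  obtain ⟨⟨h1, h2, h3⟩, h4, h5, h6⟩ := h
  refine ⟨⟨?_, ?_, ?_⟩, ?_, ?_, ?_⟩
  · linear_combination h4
  · linear_combination h5
  · linear_combination h6
  · linear_combination h1
  · linear_combination h2
  · linear_combination h3

lemma div_c (h : IsAmplitude a b m p q c d) (ha : a ≠ 0) : m * c 0 + p * c 1 + q * c 2 = 0 := by
  obtain ⟨⟨h1, h2, h3⟩, -⟩ := h
  have : a * (m * c 0 + p * c 1 + q * c 2) = 0 := by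
    linear_combination -m * h1 + p * h2 - q * h3
  exact (mul_eq_zero.1 this).resolve_left ha

lemma div_d (h : IsAmplitude a b m p q c d) (hb : b ≠ 0) : m * d 0 + p * d 1 + q * d 2 = 0 :=
  h.swap.div_c (neg_ne_zero.2 hb)

/-- The longitudinal part of the impedance trace sees only the transverse magnetic amplitude `c 0`.
-/
lemma longitudinal (h : IsAmplitude a b m p q c d) (ha : a ≠ 0) (z : ℂ) :
    p * (c 1 * z - d 2) + q * (c 2 * z + d 1) = -(m * z + a) * c 0 := by
  linear_combination z * h.div_c ha - h.1.1

/-- The transverse part of the impedance trace sees only the transverse electric amplitude `d 0`. -/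
lemma transverse (h : IsAmplitude a b m p q c d) (hb : b ≠ 0) (z : ℂ) :
    p * (c 2 * z + d 1) - q * (c 1 * z - d 2) = -(b * z + m) * d 0 := by
  linear_combination h.div_d hb + z * h.2.1

end IsAmplitude

/-- The squared Euclidean norm of an amplitude. -/
def ampSq (c d : Fin 3 → ℂ) : ℝ := ∑ i, (‖c i‖ ^ 2 + ‖d i‖ ^ 2)

lemma norm_sq_cross_add_norm_sq_dot (x y : ℝ) (u v : ℂ) :
    ‖x * u + y * v‖ ^ 2 + ‖x * v - y * u‖ ^ 2 = (x ^ 2 + y ^ 2) * (‖u‖ ^ 2 + ‖v‖ ^ 2) := by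
  simp only [← Complex.normSq_eq_norm_sq, Complex.normSq_apply, Complex.add_re, Complex.add_im,
    Complex.sub_re, Complex.sub_im, Complex.re_ofReal_mul, Complex.im_ofReal_mul]
  ring

/-- In terms of the normal components `c 0` and `d 0` the norm of an amplitude is diagonal, because
the two polarizations are orthogonal. -/
lemma IsAmplitude.mul_ampSq {a b m : ℂ} {c d : Fin 3 → ℂ} {x y : ℝ}
    (h : IsAmplitude a b m (Complex.I * x) (Complex.I * y) c d) (ha : a ≠ 0) (hb : b ≠ 0) :
    (x ^ 2 + y ^ 2) * ampSq c d =
      (x ^ 2 + y ^ 2 + ‖m‖ ^ 2 + ‖a‖ ^ 2) * ‖c 0‖ ^ 2 +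
      (x ^ 2 + y ^ 2 + ‖m‖ ^ 2 + ‖b‖ ^ 2) * ‖d 0‖ ^ 2 := by
  have hI : ∀ z : ℂ, ‖Complex.I * z‖ = ‖z‖ := fun z => by simp
  have hc := norm_sq_cross_add_norm_sq_dot x y (c 1) (c 2)
  have hd := norm_sq_cross_add_norm_sq_dot x y (d 1) (d 2)
  have h1 : ‖x * c 1 + y * c 2‖ = ‖m‖ * ‖c 0‖ := by
    rw [← hI, ← norm_mul, ← norm_neg (m * c 0)]
    congr 1
    linear_combination h.div_c ha
  have h2 : ‖x * d 1 + y * d 2‖ = ‖m‖ * ‖d 0‖ := by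
    rw [← hI, ← norm_mul, ← norm_neg (m * d 0)]
    congr 1
    linear_combination h.div_d hb
  have h3 : ‖x * c 2 - y * c 1‖ = ‖b‖ * ‖d 0‖ := by
    rw [← hI, ← norm_mul, ← norm_neg (b * d 0)]
    congr 1
    linear_combination h.2.1
  have h4 : ‖x * d 2 - y * d 1‖ = ‖a‖ * ‖c 0‖ := by
    rw [← hI, ← norm_mul]
    congr 1
    linear_combination h.1.1
  rw [h1, h3] at hc
  rw [h2, h4] at hd
  rw [ampSq, Fin.sum_univ_three]
  linear_combination -hc - hd

/-- An amplitude is controlled by its normal components. -/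
lemma IsAmplitude.ampSq_le {a b m m' : ℂ} {c d c' d' : Fin 3 → ℂ} {x y r : ℝ}
    (h : IsAmplitude a b m (Complex.I * x) (Complex.I * y) c d)
    (h' : IsAmplitude a b m' (Complex.I * x) (Complex.I * y) c' d') (ha : a ≠ 0) (hb : b ≠ 0)
    (hm : ‖m'‖ = ‖m‖) (hk : 0 < x ^ 2 + y ^ 2)
    (h1 : ‖c' 0‖ ≤ r * ‖c 0‖) (h2 : ‖d' 0‖ ≤ r * ‖d 0‖) :
    ampSq c' d' ≤ r ^ 2 * ampSq c d := by
  refine le_of_mul_le_mul_left ?_ hk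
  rw [mul_left_comm, h'.mul_ampSq ha hb, h.mul_ampSq ha hb, hm]
  have h3 := pow_le_pow_left₀ (norm_nonneg _) h1 2
  have h4 := pow_le_pow_left₀ (norm_nonneg _) h2 2
  rw [mul_pow] at h3 h4
  calc _ ≤ (x ^ 2 + y ^ 2 + ‖m‖ ^ 2 + ‖a‖ ^ 2) * (r ^ 2 * ‖c 0‖ ^ 2) +
      (x ^ 2 + y ^ 2 + ‖m‖ ^ 2 + ‖b‖ ^ 2) * (r ^ 2 * ‖d 0‖ ^ 2) := by gcongr
    _ = _ := by ring

/-! ### Classical solutions on a single Fourier mode -/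

/-- The curl of `e^{i (k_y y + k_z z)} g(x)` divided by the exponential, where `p = i k_y`,
`q = i k_z`, and `g'` is the derivative of `g`. -/
def curlSymbol (p q : ℂ) (g g' : CVec) : CVec :=
  ![p * g 2 - q * g 1, q * g 0 - g' 2, g' 1 - p * g 0]

/-- The multipliers `i k_y` and `i k_z` of the tangential derivatives. -/
def tang (k : Plane) (i : Fin 2) : ℂ := Complex.I * (k i : ℝ)

lemma isAmplitude_iff {a b m p q : ℂ} {c d : CVec} :
    IsAmplitude a b m p q c d ↔
      curlSymbol p q d (m • d) = a • c ∧ curlSymbol p q c (m • c) = -(b • d) := by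
  simp only [IsAmplitude, curlSymbol, funext_iff, Fin.forall_fin_succ, Fin.isValue]
  simp
  constructor
  · rintro ⟨⟨h1, h2, h3⟩, h4, h5, h6⟩
    exact ⟨⟨h1, by linear_combination -h2, by linear_combination h3⟩, h4,
      by linear_combination -h5, by linear_combination h6⟩
  · rintro ⟨⟨h1, h2, h3⟩, h4, h5, h6⟩
    exact ⟨⟨h1, by linear_combination -h2, by linear_combination h3⟩, h4,
      by linear_combination -h5, by linear_combination h6⟩

lemma hasFDerivAt_mode (k : Plane) {g : ℝ → CVec} {g' : CVec} {p : Space}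
    (hg : HasDerivAt g g' p.1) :
    HasFDerivAt (fun q : Space => Complex.exp (Complex.I * (inner ℝ k q.2 : ℝ)) • g q.1)
      (Complex.exp (Complex.I * (inner ℝ k p.2 : ℝ)) •
          ((ContinuousLinearMap.fst ℝ ℝ Plane).smulRight g') +
        ((Complex.exp (Complex.I * (inner ℝ k p.2 : ℝ))) • (Complex.I •
          (Complex.ofRealCLM.comp ((innerSL ℝ k).comp
            (ContinuousLinearMap.snd ℝ ℝ Plane))))).smulRight (g p.1)) p := by
  have h1 : HasFDerivAt (fun q : Space => Complex.I * ((inner ℝ k q.2 : ℝ) : ℂ))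
      (Complex.I • (Complex.ofRealCLM.comp ((innerSL ℝ k).comp
            (ContinuousLinearMap.snd ℝ ℝ Plane)))) p :=
    ((Complex.ofRealCLM.comp ((innerSL ℝ k).comp
      (ContinuousLinearMap.snd ℝ ℝ Plane))).hasFDerivAt).const_mul Complex.I
  have h2 : HasFDerivAt (fun q : Space => g q.1)
      ((ContinuousLinearMap.fst ℝ ℝ Plane).smulRight g') p :=
    by
    refine (hg.hasFDerivAt.comp p hasFDerivAt_fst).congr_fderiv ?_
    ext <;> simp
  exact h1.cexp.smul h2

lemma curl_mode (k : Plane) {g : ℝ → CVec} {g' : CVec} {p : Space} (hg : HasDerivAt g g' p.1) :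
    curl (fun q : Space => Complex.exp (Complex.I * (inner ℝ k q.2 : ℝ)) • g q.1) p =
      Complex.exp (Complex.I * (inner ℝ k p.2 : ℝ)) •
        curlSymbol (tang k 0) (tang k 1) (g p.1) g' := by
  have h := (hasFDerivAt_mode k hg).fderiv
  have hk : ∀ i : Fin 2, inner ℝ k (EuclideanSpace.single i (1 : ℝ)) = k i := fun i => by
    simp [EuclideanSpace.inner_single_right]
  funext i
  fin_cases i <;>
    simp [curl, pderiv, h, dir, hk, curlSymbol, tang] <;> ring

/-- On a mode the classical Maxwell system is a system of ordinary differential equations. -/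
lemma isClassicalMaxwell_mode_iff {P : Params} {k : Plane} {I : Set ℝ} {f : ℝ → EH} :
    IsClassicalMaxwell P {p | p.1 ∈ I} (modeField k f) ↔
      ∀ x ∈ I, ∃ f' : EH, HasDerivAt f f' x ∧
        curlSymbol (tang k 0) (tang k 1) (f x).2 f'.2 = P.adm • (f x).1 ∧
        curlSymbol (tang k 0) (tang k 1) (f x).1 f'.1 = -(P.imp • (f x).2) := by
  have hexp : ∀ y : Plane, Complex.exp (Complex.I * (inner ℝ k y : ℝ)) ≠ 0 :=
    fun y => Complex.exp_ne_zero _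
  have key : ∀ (p : Space) (f' : EH), HasDerivAt f f' p.1 →
      ((-((Complex.I * P.ω * P.ε) • (modeField k f p).1) + curl (fun q => (modeField k f q).2) p
          - (P.σ : ℂ) • (modeField k f p).1 = 0 ∧
        (Complex.I * P.ω * P.μ) • (modeField k f p).2 + curl (fun q => (modeField k f q).1) p = 0) ↔
      curlSymbol (tang k 0) (tang k 1) (f p.1).2 f'.2 = P.adm • (f p.1).1 ∧
        curlSymbol (tang k 0) (tang k 1) (f p.1).1 f'.1 = -(P.imp • (f p.1).2)) := by
    intro p f' hf
    have h1 : HasDerivAt (fun x => (f x).1) f'.1 p.1 := hf.fst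
    have h2 : HasDerivAt (fun x => (f x).2) f'.2 p.1 := hf.snd
    have c1 : curl (fun q => (modeField k f q).1) p = _ := curl_mode k h1
    have c2 : curl (fun q => (modeField k f q).2) p = _ := curl_mode k h2
    rw [c1, c2]
    simp only [modeField, Prod.smul_fst, Prod.smul_snd]
    refine and_congr ?_ ?_
    · rw [show
          -((Complex.I * P.ω * P.ε) • Complex.exp (Complex.I * (inner ℝ k p.2 : ℝ)) • (f p.1).1)
        + Complex.exp (Complex.I * (inner ℝ k p.2 : ℝ)) •
          curlSymbol (tang k 0) (tang k 1) (f p.1).2 f'.2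
        - (P.σ : ℂ) • Complex.exp (Complex.I * (inner ℝ k p.2 : ℝ)) • (f p.1).1 =
        Complex.exp (Complex.I * (inner ℝ k p.2 : ℝ)) •
          (curlSymbol (tang k 0) (tang k 1) (f p.1).2 f'.2 - P.adm • (f p.1).1) by
            rw [Params.adm]; module]
      rw [smul_eq_zero_iff_right (hexp _), sub_eq_zero]
    · rw [show (Complex.I * P.ω * P.μ) • Complex.exp (Complex.I * (inner ℝ k p.2 : ℝ)) • (f p.1).2
        + Complex.exp (Complex.I * (inner ℝ k p.2 : ℝ)) •
          curlSymbol (tang k 0) (tang k 1) (f p.1).1 f'.1 =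
        Complex.exp (Complex.I * (inner ℝ k p.2 : ℝ)) •
          (curlSymbol (tang k 0) (tang k 1) (f p.1).1 f'.1 - -(P.imp • (f p.1).2)) by
            rw [Params.imp]; module]
      rw [smul_eq_zero_iff_right (hexp _), sub_eq_zero]
  constructor
  · intro H x hx
    obtain ⟨h1, h2⟩ := H (x, 0) hx
    have hfe : f = fun t => modeField k f (t, 0) := by
      funext t
      simp [modeField]
    have hd : DifferentiableAt ℝ f x := by
      rw [hfe]
      exact DifferentiableAt.comp x (f := fun t : ℝ => ((t, 0) : Space)) h1
        (differentiableAt_id.prodMk (differentiableAt_const _))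
    exact ⟨_, hd.hasDerivAt, (key (x, 0) _ hd.hasDerivAt).1 h2⟩
  · intro H p hp
    obtain ⟨f', hf, h⟩ := H p.1 hp
    refine ⟨?_, (key p f' hf).2 h⟩
    exact ((hasFDerivAt_mode k (p := p) hf.fst).prodMk
      (hasFDerivAt_mode k (p := p) hf.snd)).differentiableAt

/-- The pairs `(u, v)` with `u' = v` on `I` that vanish outside `I` and along `l`. -/
def classicalDeriv (I : Set ℝ) (l : Filter ℝ) : Submodule ℂ ((ℝ → ℂ) × (ℝ → ℂ)) where
  carrier := {w | (∀ x ∈ I, HasDerivAt w.1 (w.2 x) x) ∧ (∀ x ∉ I, w.1 x = 0) ∧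
    (∀ x ∉ I, w.2 x = 0) ∧ Tendsto w.1 l (𝓝 0)}
  add_mem' := by
    rintro u v ⟨h1, h2, h3, h4⟩ ⟨h1', h2', h3', h4'⟩
    refine ⟨fun x hx => (h1 x hx).add (h1' x hx), fun x hx => by simp [h2 x hx, h2' x hx],
      fun x hx => by simp [h3 x hx, h3' x hx], ?_⟩
    have h := h4.add h4'
    rw [add_zero] at h
    exact h
  zero_mem' := ⟨fun x _ => hasDerivAt_const x (0 : ℂ), fun _ _ => rfl, fun _ _ => rfl,
    tendsto_const_nhds⟩
  smul_mem' := by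
    rintro c u ⟨h1, h2, h3, h4⟩
    refine ⟨fun x hx => (h1 x hx).const_smul c, fun x hx => by simp [h2 x hx],
      fun x hx => by simp [h3 x hx], ?_⟩
    have h := h4.const_smul c
    rw [smul_zero] at h
    exact h

lemma hasDerivAt_exp_mul (m : ℂ) (x : ℝ) :
    HasDerivAt (fun t : ℝ => Complex.exp (m * t)) (m * Complex.exp (m * x)) x := by
  have h := ((hasDerivAt_id (x : ℂ)).const_mul m).cexp.comp_ofReal
  simpa [mul_comm] using h

lemma exists_eq_exp_of_hasDerivAt {I : Set ℝ} (hI : IsOpen I) (hI' : IsPreconnected I) {m : ℂ}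
    {w : ℝ → ℂ} (hw : ∀ x ∈ I, HasDerivAt w (m * w x) x) :
    ∃ C : ℂ, ∀ x ∈ I, w x = C * Complex.exp (m * x) := by
  rcases I.eq_empty_or_nonempty with rfl | ⟨x₀, hx₀⟩
  · exact ⟨0, by simp⟩
  have hd : ∀ x ∈ I, HasDerivAt (fun t : ℝ => w t * Complex.exp (-m * t)) 0 x := by
    intro x hx
    exact ((hw x hx).mul (hasDerivAt_exp_mul (-m) x)).congr_deriv (by ring)
  refine ⟨w x₀ * Complex.exp (-m * x₀), fun x hx => ?_⟩
  have h := hI.is_const_of_deriv_eq_zero hI'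
    (fun y hy => (hd y hy).differentiableAt.differentiableWithinAt)
    (fun y hy => (hd y hy).deriv) hx hx₀
  rw [← h, mul_assoc, ← Complex.exp_add]
  simp

lemma norm_sq_plane (k : Plane) : ‖k‖ ^ 2 = k 0 ^ 2 + k 1 ^ 2 := by
  simp [EuclideanSpace.real_norm_sq_eq, Fin.sum_univ_two]

lemma tang_sq (k : Plane) (i : Fin 2) : tang k i ^ 2 = -((k i : ℝ) : ℂ) ^ 2 := by
  rw [tang, mul_pow, Complex.I_sq]
  ring

lemma lam_sq_eq {P : Params} (hP : P.Pos) (k : Plane) :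
    P.lam k ^ 2 = P.adm * P.imp - tang k 0 ^ 2 - tang k 1 ^ 2 := by
  rw [Params.lam_sq hP, norm_sq_plane, tang_sq, tang_sq]
  push_cast
  ring

lemma exists_isAmplitude_of_mode {P : Params} (hP : P.Pos) {k : Plane} {I : Set ℝ} {l : Filter ℝ}
    [l.NeBot] {m : ℂ} (hI : IsOpen I) (hI' : IsPreconnected I) (hl : I ∈ l)
    (hm2 : m ^ 2 = P.adm * P.imp - tang k 0 ^ 2 - tang k 1 ^ 2)
    (hm : Tendsto (fun x : ℝ => (m * x).re) l atBot) {f : ℝ → EH}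
    (hf : IsClassicalMaxwell P {p | p.1 ∈ I} (modeField k f)) (hf0 : Tendsto f l (𝓝 0)) :
    ∃ c : EH, IsAmplitude P.adm P.imp m (tang k 0) (tang k 1) c.1 c.2 ∧
      ∀ x ∈ I, f x = Complex.exp (m * x) • c := by
  rw [isClassicalMaxwell_mode_iff] at hf
  set p := tang k 0
  set q := tang k 1
  set D := classicalDeriv I l with hD
  have lim1 : ∀ i, Tendsto (fun x => (f x).1 i) l (𝓝 0) := fun i =>
    (((continuous_apply i).comp continuous_fst).tendsto (0 : EH)).comp hf0
  have lim2 : ∀ i, Tendsto (fun x => (f x).2 i) l (𝓝 0) := fun i =>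
    (((continuous_apply i).comp continuous_snd).tendsto (0 : EH)).comp hf0
  have ind : ∀ {u v : ℝ → ℂ}, (∀ x ∈ I, HasDerivAt u (v x) x) → Tendsto u l (𝓝 0) →
      (I.indicator u, I.indicator v) ∈ D := by
    intro u v h1 h2
    refine ⟨fun x hx => ?_, fun x hx => Set.indicator_of_notMem hx _,
      fun x hx => Set.indicator_of_notMem hx _, h2.congr' ?_⟩
    · simp only [Set.indicator_of_mem hx]
      refine (h1 x hx).congr_of_eventuallyEq ?_
      filter_upwards [hI.mem_nhds hx] with y hy
      exact Set.indicator_of_mem hy _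
    · filter_upwards [hl] with y hy
      exact (Set.indicator_of_mem hy _).symm
  let e : Fin 3 → ℝ → ℂ := fun i => I.indicator fun x => (f x).1 i
  let h : Fin 3 → ℝ → ℂ := fun i => I.indicator fun x => (f x).2 i
  have sys : ModeSystem D P.adm P.imp p q e h := by
    have alg : ∀ {u v : ℝ → ℂ}, (∀ x ∈ I, u x = v x) → (∀ x ∉ I, u x = 0) → (∀ x ∉ I, v x = 0) →
        u = v := by
      intro u v h1 h2 h3
      funext x
      by_cases hx : x ∈ I
      · exact h1 x hx
      · rw [h2 x hx, h3 x hx]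
    have lin : ∀ (α β : ℂ) (u v : ℝ → ℂ), α • I.indicator u + β • I.indicator v =
        I.indicator (fun x => α * u x + β * v x) := by
      intro α β u v
      funext x
      by_cases hx : x ∈ I <;> simp [hx]
    refine ⟨?_, ?_, ?_, ?_, ?_, ?_⟩
    · refine alg (fun x hx => ?_) (fun x hx => by simp [h, hx]) (fun x hx => by simp [e, hx])
      obtain ⟨f', h1, h2, h3⟩ := hf x hx
      simpa [h, e, hx, curlSymbol] using congrFun h2 0
    · rw [show q • h 0 - P.adm • e 1 = q • h 0 + (-P.adm) • e 1 by module, lin]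
      refine ind (fun x hx => ?_) (lim2 2)
      obtain ⟨f', h1, h2, h3⟩ := hf x hx
      refine (hasDerivAt_pi.1 h1.snd 2).congr_deriv ?_
      have := congrFun h2 1
      simp only [curlSymbol, Matrix.cons_val_one, Pi.smul_apply, smul_eq_mul,
        Matrix.cons_val_zero] at this
      linear_combination -this
    · rw [lin]
      refine ind (fun x hx => ?_) (lim2 1)
      obtain ⟨f', h1, h2, h3⟩ := hf x hx
      refine (hasDerivAt_pi.1 h1.snd 1).congr_deriv ?_
      have : f'.2 1 - p * (f x).2 0 = P.adm * (f x).1 2 := congrFun h2 2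
      linear_combination this
    · refine alg (fun x hx => ?_) (fun x hx => by simp [e, hx]) (fun x hx => by simp [h, hx])
      obtain ⟨f', h1, h2, h3⟩ := hf x hx
      simpa [h, e, hx, curlSymbol] using congrFun h3 0
    · rw [lin]
      refine ind (fun x hx => ?_) (lim1 2)
      obtain ⟨f', h1, h2, h3⟩ := hf x hx
      refine (hasDerivAt_pi.1 h1.fst 2).congr_deriv ?_
      have : q * (f x).1 0 - f'.1 2 = -(P.imp * (f x).2 1) := congrFun h3 1
      linear_combination -this
    · rw [show p • e 0 - P.imp • h 2 = p • e 0 + (-P.imp) • h 2 by module, lin]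
      refine ind (fun x hx => ?_) (lim1 1)
      obtain ⟨f', h1, h2, h3⟩ := hf x hx
      refine (hasDerivAt_pi.1 h1.fst 1).congr_deriv ?_
      have : f'.1 1 - p * (f x).1 0 = -(P.imp * (f x).2 2) := congrFun h3 2
      linear_combination this
  obtain ⟨x₀, hx₀⟩ := (Filter.nonempty_of_mem hl)
  let ε : ℝ → ℂ := I.indicator fun x => Complex.exp (m * x)
  have expfun : ∀ {μ : ℂ} {w : ℝ → ℂ}, (w, μ • w) ∈ D →
      ∃ C : ℂ, w = C • I.indicator fun x => Complex.exp (μ * x) := by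
    intro μ w hw
    obtain ⟨C, hC⟩ := exists_eq_exp_of_hasDerivAt hI hI' hw.1
    refine ⟨C, ?_⟩
    funext x
    by_cases hx : x ∈ I
    · simpa [hx] using hC x hx
    · simpa [hx] using hw.2.1 x hx
  have hzero : ∀ w, (w, -m • w) ∈ D → w = 0 := by
    intro w hw
    obtain ⟨C, hC⟩ := expfun hw
    have h1 : Tendsto (fun x : ℝ => ‖w x‖ * Real.exp ((m * x).re)) l (𝓝 (0 * 0)) := by
      have := (hw.2.2.2 : Tendsto w l (𝓝 0)).norm
      rw [norm_zero] at this
      exact this.mul (Real.tendsto_exp_atBot.comp hm)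
    have h2 : Tendsto (fun x : ℝ => ‖w x‖ * Real.exp ((m * x).re)) l (𝓝 ‖C‖) := by
      refine tendsto_const_nhds.congr' ?_
      filter_upwards [hl] with x hx
      rw [hC, Pi.smul_apply, Set.indicator_of_mem hx, smul_eq_mul, norm_mul, Complex.norm_exp,
        mul_assoc, ← Real.exp_add]
      simp
    have h3 := tendsto_nhds_unique h2 h1
    rw [mul_zero, norm_eq_zero] at h3
    rw [hC, h3, zero_smul]
  obtain ⟨c, d, hc, hd⟩ := sys.exists_amplitude hP.adm_ne hP.imp_ne hm2 (ε := ε)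
    (fun w hw => expfun hw) hzero
  refine ⟨(c, d), ?_, fun x hx => ?_⟩
  · have hε : ε ≠ 0 := fun h0 => by
      have := congrFun h0 x₀
      simp [ε, hx₀] at this
    have hεD : (ε, m • ε) ∈ D := by
      have : m • ε = I.indicator fun x : ℝ => m * Complex.exp (m * x) := by
        funext x
        by_cases hx : x ∈ I <;> simp [ε, hx]
      rw [this]
      refine ind (fun x _ => hasDerivAt_exp_mul m x) ?_
      rw [tendsto_zero_iff_norm_tendsto_zero]
      simp only [Complex.norm_exp]
      exact Real.tendsto_exp_atBot.comp hm
    refine ModeSystem.isAmplitude (D := D) hε hεD (fun v hv => ?_) ?_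
    · funext x
      by_cases hx : x ∈ I
      · exact (hv.1 x hx).unique (hasDerivAt_const x 0)
      · exact hv.2.2.1 x hx
    · have he : e = fun i => c i • ε := funext hc
      have hh : h = fun i => d i • ε := funext hd
      rw [he, hh] at sys
      exact sys
  · have h1 : ∀ i, (f x).1 i = c i * Complex.exp (m * x) := fun i => by
      have := congrFun (hc i) x
      simpa [e, ε, hx] using this
    have h2 : ∀ i, (f x).2 i = d i * Complex.exp (m * x) := fun i => by
      have := congrFun (hd i) x
      simpa [h, ε, hx] using this
    refine Prod.ext (funext fun i => ?_) (funext fun i => ?_)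
    · simp [h1 i, mul_comm]
    · simp [h2 i, mul_comm]

/-- The decaying modes are the exponentials with admissible amplitude. -/
lemma mem_modeSpace_iff {P : Params} (hP : P.Pos) {k : Plane} {I I' : Set ℝ} {l : Filter ℝ}
    [l.NeBot] {m : ℂ} (hI : IsOpen I) (hI' : IsPreconnected I) (hl : I ∈ l)
    (h1 : I ⊆ I') (h2 : I' ⊆ closure I)
    (hm2 : m ^ 2 = P.adm * P.imp - tang k 0 ^ 2 - tang k 1 ^ 2)
    (hm : Tendsto (fun x : ℝ => (m * x).re) l atBot) {f : ℝ → EH} :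
    f ∈ modeSpace P k I' {p | p.1 ∈ I} l ↔
      ∃ c : EH, IsAmplitude P.adm P.imp m (tang k 0) (tang k 1) c.1 c.2 ∧
        f = I'.indicator fun x => Complex.exp (m * x) • c := by
  have hcont : ∀ c : EH, Continuous fun x : ℝ => Complex.exp (m * x) • c := fun c => by fun_prop
  constructor
  · rintro ⟨f1, f2, f3, f4⟩
    obtain ⟨c, hc, hfc⟩ := exists_isAmplitude_of_mode hP hI hI' hl hm2 hm f3 f4
    refine ⟨c, hc, ?_⟩
    have heq : Set.EqOn f (fun x => Complex.exp (m * x) • c) I' :=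
      Set.EqOn.of_subset_closure hfc f2 (hcont c).continuousOn h1 h2
    funext x
    by_cases hx : x ∈ I'
    · rw [heq hx, Set.indicator_of_mem hx]
    · rw [f1 x hx, Set.indicator_of_notMem hx]
  · rintro ⟨c, hc, rfl⟩
    refine ⟨fun x hx => Set.indicator_of_notMem hx _, ?_, ?_, ?_⟩
    · exact (hcont c).continuousOn.congr fun x hx => Set.indicator_of_mem hx _
    · rw [isClassicalMaxwell_mode_iff]
      intro x hx
      rw [isAmplitude_iff] at hc
      refine ⟨Complex.exp (m * x) • m • c, ?_, ?_⟩
      · have h3 := (hasDerivAt_exp_mul m x).smul_const c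
        refine (h3.congr_deriv (by rw [smul_smul, mul_comm])).congr_of_eventuallyEq ?_
        filter_upwards [hI.mem_nhds hx] with y hy
        exact Set.indicator_of_mem (h1 hy) _
      · have hs : ∀ (p q t : ℂ) (g g' : CVec),
            curlSymbol p q (t • g) (t • g') = t • curlSymbol p q g g' := by
          intro p q t g g'
          funext i
          fin_cases i <;> simp [curlSymbol] <;> ring
        rw [Set.indicator_of_mem (h1 hx)]
        simp only [Prod.smul_fst, Prod.smul_snd, hs, hc.1, hc.2]
        exact ⟨smul_comm _ _ _, by rw [smul_neg, smul_comm]⟩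
    · have h3 : Tendsto (fun x : ℝ => Complex.exp (m * x) • c) l (𝓝 ((0 : ℂ) • c)) := by
        refine Tendsto.smul_const ?_ c
        rw [tendsto_zero_iff_norm_tendsto_zero]
        simp only [Complex.norm_exp]
        exact Real.tendsto_exp_atBot.comp hm
      rw [zero_smul] at h3
      refine h3.congr' ?_
      filter_upwards [hl] with x hx
      rw [Set.indicator_of_mem (h1 hx)]

/-! ### The convergence factor of a Fourier mode -/

/-- The amplitude of exponent `m` with the tangential electric field `v`. -/
def amplitude (P : Params) (k : Plane) (m : ℂ) : ℂ × ℂ →ₗ[ℂ] EH :=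
  let p := tang k 0
  let q := tang k 1
  { toFun := fun v =>
      (![-(p * v.1 + q * v.2) / m, v.1, v.2],
       ![-(p * v.2 - q * v.1) / P.imp,
        (m * v.2 + q * (p * v.1 + q * v.2) / m) / P.imp,
        -(m * v.1 + p * (p * v.1 + q * v.2) / m) / P.imp])
    map_add' := fun v w => by
      refine Prod.ext (funext fun i => ?_) (funext fun i => ?_) <;> fin_cases i <;> simp <;> ring
    map_smul' := fun c v => by
      refine Prod.ext (funext fun i => ?_) (funext fun i => ?_) <;> fin_cases i <;> simp <;> ring }

lemma isAmplitude_amplitude {P : Params} (hP : P.Pos) {k : Plane} {m : ℂ} (hm : m ≠ 0)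
    (hm2 : m ^ 2 = P.adm * P.imp - tang k 0 ^ 2 - tang k 1 ^ 2) (v : ℂ × ℂ) :
    IsAmplitude P.adm P.imp m (tang k 0) (tang k 1) (amplitude P k m v).1
      (amplitude P k m v).2 := by
  have hb := hP.imp_ne
  simp only [amplitude, LinearMap.coe_mk, AddHom.coe_mk, IsAmplitude, Matrix.cons_val]
  set p := tang k 0
  set q := tang k 1
  refine ⟨⟨?_, ?_, ?_⟩, ?_, ?_, ?_⟩ <;> field_simp
  · linear_combination -(p * v.1 + q * v.2) * hm2
  · linear_combination -v.1 * hm2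
  · linear_combination v.2 * hm2
  all_goals ring

lemma IsAmplitude.eq_amplitude {P : Params} (hP : P.Pos) {k : Plane} {m : ℂ} (hm : m ≠ 0)
    {c : EH} (h : IsAmplitude P.adm P.imp m (tang k 0) (tang k 1) c.1 c.2) :
    c = amplitude P k m (c.1 1, c.1 2) := by
  have hb := hP.imp_ne
  have h0 := h.div_c hP.adm_ne
  obtain ⟨-, h1, h2, h3⟩ := h
  have e0 : c.1 0 = -(tang k 0 * c.1 1 + tang k 1 * c.1 2) / m := by
    rw [eq_div_iff hm]
    linear_combination h0
  refine Prod.ext (funext fun i => ?_) (funext fun i => ?_) <;> fin_cases i <;>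
    simp only [amplitude, LinearMap.coe_mk, AddHom.coe_mk, Matrix.cons_val, Fin.zero_eta,
      Fin.mk_one, Fin.reduceFinMk, Fin.isValue]
  · exact e0
  · rw [eq_div_iff hb]
    linear_combination h1
  · rw [eq_div_iff hb]
    rw [e0] at h2
    linear_combination -h2
  · rw [eq_div_iff hb]
    rw [e0] at h3
    linear_combination h3

/-- The tangential electric field of the outgoing wave produced from an incoming one with tangential
electric field `v` by an interface with impedance transmission: the reflection coefficients are
`rTE` on the orthogonal complement of `k` and `-rTM` along `k`. -/
def reflect (P : Params) (k : Plane) (v : ℂ × ℂ) : ℂ × ℂ :=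
  P.rTE k • v + (2 / ((P.imp / P.Z + P.lam k) * (P.adm * P.Z + P.lam k)) *
    (k 0 * v.1 + k 1 * v.2)) • ((k 0 : ℂ), (k 1 : ℂ))

lemma dot_reflect {P : Params} (hP : P.Pos) (k : Plane) (v : ℂ × ℂ) :
    k 0 * (reflect P k v).1 + k 1 * (reflect P k v).2 =
      -P.rTM k * (k 0 * v.1 + k 1 * v.2) := by
  have h1 := Params.imp_add_lam_ne hP k
  have h2 := Params.adm_add_lam_ne hP k
  have hZ : (P.Z : ℂ) ≠ 0 := by exact_mod_cast hP.Z.ne'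
  have hl := lam_sq_eq hP k
  rw [tang_sq, tang_sq] at hl
  have hst : (P.imp / P.Z) * (P.adm * P.Z) = P.adm * P.imp := by field_simp
  simp only [reflect, Params.rTE, Params.rTM, Prod.fst_add, Prod.snd_add, Prod.smul_fst,
    Prod.smul_snd, smul_eq_mul]
  set s := P.imp / P.Z
  set t := P.adm * P.Z
  rw [← hst] at hl
  field_simp
  linear_combination (-2 * (k 0 * v.1 + k 1 * v.2)) * hl

lemma incoming_eq_iff {P : Params} (hP : P.Pos) (k : Plane) (v w : ℂ × ℂ) :
    ((P.imp / P.Z + P.lam k) * v.1 - k 0 * (k 0 * v.1 + k 1 * v.2) / P.lam k =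
        (P.imp / P.Z - P.lam k) * w.1 + k 0 * (k 0 * w.1 + k 1 * w.2) / P.lam k ∧
      (P.imp / P.Z + P.lam k) * v.2 - k 1 * (k 0 * v.1 + k 1 * v.2) / P.lam k =
        (P.imp / P.Z - P.lam k) * w.2 + k 1 * (k 0 * w.1 + k 1 * w.2) / P.lam k) ↔
      v = reflect P k w := by
  have h1 := Params.imp_add_lam_ne hP k
  have h2 := Params.adm_add_lam_ne hP k
  have h3 := Params.lam_ne hP k
  have hZ : (P.Z : ℂ) ≠ 0 := by exact_mod_cast hP.Z.ne'
  have hl := lam_sq_eq hP k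
  rw [tang_sq, tang_sq] at hl
  have hst : (P.imp / P.Z) * (P.adm * P.Z) = P.adm * P.imp := by field_simp
  have hdot := dot_reflect hP k w
  set s := P.imp / P.Z
  set t := P.adm * P.Z
  set m := P.lam k
  rw [← hst] at hl
  have hr1 : (reflect P k w).1 = ((s - m) * w.1 +
      k 0 * (k 0 * w.1 + k 1 * w.2 + -P.rTM k * (k 0 * w.1 + k 1 * w.2)) / m) / (s + m) := by
    simp only [reflect, Params.rTE, Params.rTM, Prod.fst_add, Prod.smul_fst, smul_eq_mul]
    change (s - m) / (s + m) * w.1 + 2 / ((s + m) * (t + m)) * (k 0 * w.1 + k 1 * w.2) * k 0 =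
      ((s - m) * w.1 + k 0 * (k 0 * w.1 + k 1 * w.2 + -((t - m) / (t + m)) *
        (k 0 * w.1 + k 1 * w.2)) / m) / (s + m)
    field_simp
    ring
  have hr2 : (reflect P k w).2 = ((s - m) * w.2 +
      k 1 * (k 0 * w.1 + k 1 * w.2 + -P.rTM k * (k 0 * w.1 + k 1 * w.2)) / m) / (s + m) := by
    simp only [reflect, Params.rTE, Params.rTM, Prod.snd_add, Prod.smul_snd, smul_eq_mul]
    change (s - m) / (s + m) * w.2 + 2 / ((s + m) * (t + m)) * (k 0 * w.1 + k 1 * w.2) * k 1 =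
      ((s - m) * w.2 + k 1 * (k 0 * w.1 + k 1 * w.2 + -((t - m) / (t + m)) *
        (k 0 * w.1 + k 1 * w.2)) / m) / (s + m)
    field_simp
    ring
  constructor
  · rintro ⟨e1, e2⟩
    -- along `k` the system decouples and determines `k · v`
    have hd : k 0 * v.1 + k 1 * v.2 = -P.rTM k * (k 0 * w.1 + k 1 * w.2) := by
      have e1' := (mul_left_inj' h3).2 e1
      have e2' := (mul_left_inj' h3).2 e2
      have e3 : s * ((k 0 * v.1 + k 1 * v.2) * (t + m)) =
          s * (-((t - m)) * (k 0 * w.1 + k 1 * w.2)) := by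
        field_simp at e1' e2'
        linear_combination k 0 * e1' + k 1 * e2' + (-(k 0 * v.1 + k 1 * v.2) -
          (k 0 * w.1 + k 1 * w.2)) * hl
      have hs : s ≠ 0 := div_ne_zero hP.imp_ne hZ
      have e4 := mul_left_cancel₀ hs e3
      change _ = -((t - m) / (t + m)) * _
      field_simp
      linear_combination e4
    rw [hd] at e1 e2
    refine Prod.ext ?_ ?_
    · rw [hr1, eq_div_iff h1]
      linear_combination e1
    · rw [hr2, eq_div_iff h1]
      linear_combination e2
  · rintro rfl
    rw [hdot, hr1, hr2]
    constructor <;> field_simp <;> ring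

lemma reflect_add (P : Params) (k : Plane) (v w : ℂ × ℂ) :
    reflect P k (v + w) = reflect P k v + reflect P k w := by
  refine Prod.ext ?_ ?_ <;> simp [reflect] <;> ring

lemma reflect_smul (P : Params) (k : Plane) (c : ℂ) (v : ℂ × ℂ) :
    reflect P k (c • v) = c • reflect P k v := by
  refine Prod.ext ?_ ?_ <;> simp [reflect] <;> ring

lemma vec3_eq_iff {x y x' y' : ℂ} : (![0, x, y] : CVec) = ![0, x', y'] ↔ x = x' ∧ y = y' := by
  simp [funext_iff, Fin.forall_fin_succ]

lemma impedance_ex_amplitude_iff {P : Params} (hP : P.Pos) (k : Plane) (v w : ℂ × ℂ) :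
    impedance P ex (amplitude P k (P.lam k) v) = impedance P ex (amplitude P k (-P.lam k) w) ↔
      v = reflect P k w := by
  have hb := hP.imp_ne
  have hZ : (P.Z : ℂ) ≠ 0 := by exact_mod_cast hP.Z.ne'
  have hm := Params.lam_ne hP k
  rw [← incoming_eq_iff hP, impedance_ex, impedance_ex, vec3_eq_iff, and_comm]
  simp only [amplitude, LinearMap.coe_mk, AddHom.coe_mk, Matrix.cons_val, tang]
  have hI := Complex.I_sq
  refine and_congr ?_ ?_
  · rw [← mul_right_inj' hb]
    constructor <;> intro h <;> field_simp at h ⊢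
    · linear_combination h - ((k 0 : ℂ) * P.Z * (k 0 * v.1 + k 1 * v.2) +
        k 0 * P.Z * (k 0 * w.1 + k 1 * w.2)) * hI
    · linear_combination h + ((k 0 : ℂ) * P.Z * (k 0 * v.1 + k 1 * v.2) +
        k 0 * P.Z * (k 0 * w.1 + k 1 * w.2)) * hI
  · rw [← mul_right_inj' hb]
    constructor <;> intro h <;> field_simp at h ⊢
    · linear_combination -h - ((k 1 : ℂ) * P.Z * (k 0 * v.1 + k 1 * v.2) +
        k 1 * P.Z * (k 0 * w.1 + k 1 * w.2)) * hI
    · linear_combination -h - ((k 1 : ℂ) * P.Z * (k 0 * v.1 + k 1 * v.2) +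
        k 1 * P.Z * (k 0 * w.1 + k 1 * w.2)) * hI

lemma impedance_neg_ex_amplitude (P : Params) (k : Plane) (m : ℂ) (v : ℂ × ℂ) :
    impedance P (-ex) (amplitude P k (-m) v) = -impedance P ex (amplitude P k m v) := by
  rw [impedance_ex, impedance_neg_ex]
  funext i
  fin_cases i <;> simp [amplitude] <;> ring

lemma impedance_neg_ex_amplitude_iff {P : Params} (hP : P.Pos) (k : Plane) (v w : ℂ × ℂ) :
    impedance P (-ex) (amplitude P k (-P.lam k) v) = impedance P (-ex) (amplitude P k (P.lam k) w) ↔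
      v = reflect P k w := by
  have h := impedance_neg_ex_amplitude P k (-P.lam k) w
  rw [neg_neg] at h
  rw [impedance_neg_ex_amplitude, h, neg_inj, impedance_ex_amplitude_iff hP]

/-- The modes in `I`, parametrized by the tangential electric field at `x = 0`. -/
def modeEquiv {P : Params} (hP : P.Pos) {k : Plane} {I I' : Set ℝ} {l : Filter ℝ}
    [l.NeBot] {m : ℂ} (hI : IsOpen I) (hI' : IsPreconnected I) (hl : I ∈ l)
    (h1 : I ⊆ I') (h2 : I' ⊆ closure I) (h0 : 0 ∈ I')
    (hm0 : m ≠ 0) (hm2 : m ^ 2 = P.adm * P.imp - tang k 0 ^ 2 - tang k 1 ^ 2)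
    (hm : Tendsto (fun x : ℝ => (m * x).re) l atBot) :
    (ℂ × ℂ) ≃ₗ[ℂ] modeSpace P k I' {p | p.1 ∈ I} l where
  toFun v := ⟨I'.indicator fun x => Complex.exp (m * x) • amplitude P k m v,
    (mem_modeSpace_iff hP hI hI' hl h1 h2 hm2 hm).2
      ⟨_, isAmplitude_amplitude hP hm0 hm2 v, rfl⟩⟩
  map_add' v w := by
    refine Subtype.ext (funext fun x => ?_)
    by_cases hx : x ∈ I' <;> simp [hx]
  map_smul' c v := by
    refine Subtype.ext (funext fun x => ?_)
    by_cases hx : x ∈ I' <;> simp [hx, smul_comm c]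
  invFun f := ((f.1 0).1 1, (f.1 0).1 2)
  left_inv v := by
    simp [h0, amplitude]
  right_inv f := by
    obtain ⟨c, hc, hf⟩ := (mem_modeSpace_iff hP hI hI' hl h1 h2 hm2 hm).1 f.2
    refine Subtype.ext ?_
    have hc0 : f.1 0 = c := by
      rw [hf, Set.indicator_of_mem h0]
      simp
    change I'.indicator (fun x : ℝ => Complex.exp (m * x) •
      amplitude P k m ((f.1 0).1 1, (f.1 0).1 2)) = f.1
    rw [hc0, ← hc.eq_amplitude hP hm0, hf]

lemma modeEquiv_apply {P : Params} (hP : P.Pos) {k : Plane} {I I' : Set ℝ} {l : Filter ℝ}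
    [l.NeBot] {m : ℂ} (hI : IsOpen I) (hI' : IsPreconnected I) (hl : I ∈ l)
    (h1 : I ⊆ I') (h2 : I' ⊆ closure I) (h0 : 0 ∈ I')
    (hm0 : m ≠ 0) (hm2 : m ^ 2 = P.adm * P.imp - tang k 0 ^ 2 - tang k 1 ^ 2)
    (hm : Tendsto (fun x : ℝ => (m * x).re) l atBot) (v : ℂ × ℂ) {x : ℝ} (hx : x ∈ I') :
    (modeEquiv hP hI hI' hl h1 h2 h0 hm0 hm2 hm v).1 x =
      Complex.exp (m * x) • amplitude P k m v :=
  Set.indicator_of_mem hx fun x : ℝ => Complex.exp (m * x) • amplitude P k m v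

/-- The step of the algorithm in terms of the tangential electric fields at `x = 0`. -/
def modeStep (P : Params) (L : ℝ) (k : Plane) :
    Module.End ℂ ((ℂ × ℂ) × (ℂ × ℂ)) where
  toFun v := (Complex.exp (-(P.lam k * L)) ^ 2 • reflect P k v.2, reflect P k v.1)
  map_add' v w := by simp [reflect_add]
  map_smul' c v := by simp [reflect_smul, smul_comm c]

lemma reflect_reflect (P : Params) (k : Plane) (v : ℂ × ℂ)
    (hv : k 0 * v.1 + k 1 * v.2 = 0) : reflect P k (reflect P k v) = P.rTE k ^ 2 • v := by
  have h : ∀ w : ℂ × ℂ, k 0 * w.1 + k 1 * w.2 = 0 → reflect P k w = P.rTE k • w := by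
    intro w hw
    rw [reflect, hw, mul_zero, zero_smul, add_zero]
  rw [h v hv, reflect_smul, h v hv, smul_smul, pow_two]

lemma modeStep_sq (P : Params) (L : ℝ) (k : Plane) (v : (ℂ × ℂ) × (ℂ × ℂ)) :
    (modeStep P L k ^ 2) v = Complex.exp (-(P.lam k * L)) ^ 2 •
      (reflect P k (reflect P k v.1), reflect P k (reflect P k v.2)) := by
  rw [pow_two, Module.End.mul_apply]
  simp [modeStep, reflect_smul]

lemma spectrum_modeStep_sq {P : Params} (hP : P.Pos) (L : ℝ) (k : Plane) :
    (Complex.exp (-(P.lam k * L)) * P.rTE k) ^ 2 ∈ spectrum ℂ (modeStep P L k ^ 2) ∧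
    ∀ z ∈ spectrum ℂ (modeStep P L k ^ 2), z = (Complex.exp (-(P.lam k * L)) * P.rTE k) ^ 2 ∨
      z = (Complex.exp (-(P.lam k * L)) * P.rTM k) ^ 2 := by
  set E := Complex.exp (-(P.lam k * L))
  constructor
  · rw [← Module.End.hasEigenvalue_iff_mem_spectrum]
    obtain ⟨v, hv0, hv⟩ : ∃ v : ℂ × ℂ, v ≠ 0 ∧ k 0 * v.1 + k 1 * v.2 = 0 := by
      by_cases hk : (k 0 : ℂ) = 0 ∧ (k 1 : ℂ) = 0
      · exact ⟨(1, 0), by simp, by simp [hk.1]⟩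
      · refine ⟨(-(k 1 : ℂ), (k 0 : ℂ)), fun h => hk ?_, by ring⟩
        rw [Prod.mk_eq_zero, neg_eq_zero] at h
        exact ⟨h.2, h.1⟩
    refine Module.End.hasEigenvalue_of_hasEigenvector (x := (v, 0)) ⟨?_, ?_⟩
    · rw [Module.End.mem_eigenspace_iff, modeStep_sq, reflect_reflect P k v hv,
        reflect_reflect P k 0 (by simp)]
      simp only [Prod.smul_mk, smul_zero, smul_smul]
      rw [mul_pow]
    · simp [hv0]
  · intro z hz
    rw [← Module.End.hasEigenvalue_iff_mem_spectrum] at hz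
    obtain ⟨v, hv⟩ := hz.exists_hasEigenvector
    have hv1 := hv.apply_eq_smul
    rw [modeStep_sq] at hv1
    have key : ∀ w : ℂ × ℂ, w ≠ 0 → E ^ 2 • reflect P k (reflect P k w) = z • w →
        z = (E * P.rTE k) ^ 2 ∨ z = (E * P.rTM k) ^ 2 := by
      intro w hw h
      by_cases hd : k 0 * w.1 + k 1 * w.2 = 0
      · left
        rw [reflect_reflect P k w hd, smul_smul, ← mul_pow] at h
        exact (smul_left_injective ℂ hw h).symm
      · right
        have h3 : E ^ 2 * (k 0 * (reflect P k (reflect P k w)).1 +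
            k 1 * (reflect P k (reflect P k w)).2) = z * (k 0 * w.1 + k 1 * w.2) := by
          have e1 := congrArg Prod.fst h
          have e2 := congrArg Prod.snd h
          simp only [Prod.smul_fst, Prod.smul_snd, smul_eq_mul] at e1 e2
          linear_combination k 0 * e1 + k 1 * e2
        rw [dot_reflect hP, dot_reflect hP, ← mul_assoc, ← mul_assoc] at h3
        have := mul_right_cancel₀ hd h3
        rw [← this]
        ring
    by_cases h1 : v.1 = 0
    · refine key v.2 (fun h2 => hv.2 (Prod.ext h1 h2)) ?_
      simpa using congrArg Prod.snd hv1
    · refine key v.1 h1 ?_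
      simpa using congrArg Prod.fst hv1

/-- The mode by mode convergence factor is the modulus of the transverse electric eigenvalue, which
is never smaller than that of the transverse magnetic one. -/
theorem isModeConvergenceFactor_rho {P : Params} (hP : P.Pos) {L : ℝ} (hL : 0 ≤ L) (k : Plane) :
    IsModeConvergenceFactor P L k (P.rho L k) := by
  have hm := lam_sq_eq hP k
  have hm0 := Params.lam_ne hP k
  have hre := Params.lam_re_pos hP k
  have lim1 : Tendsto (fun x : ℝ => (P.lam k * x).re) atBot atBot := by
    simp only [Complex.re_mul_ofReal]
    exact tendsto_id.const_mul_atBot hre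
  have lim2 : Tendsto (fun x : ℝ => (-P.lam k * x).re) atTop atBot := by
    simp only [Complex.re_mul_ofReal, Complex.neg_re]
    exact tendsto_id.const_mul_atTop_of_neg (neg_lt_zero.2 hre)
  let Φ₁ : (ℂ × ℂ) ≃ₗ[ℂ] Mode₁ P L k :=
    modeEquiv hP (I := Set.Iio L) (I' := Set.Iic L) isOpen_Iio isPreconnected_Iio
      (Iio_mem_atBot L) Set.Iio_subset_Iic_self (by rw [closure_Iio]) hL hm0 hm lim1
  let Φ₂ : (ℂ × ℂ) ≃ₗ[ℂ] Mode₂ P k :=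
    modeEquiv hP (I := Set.Ioi 0) (I' := Set.Ici 0) isOpen_Ioi isPreconnected_Ioi
      (Ioi_mem_atTop 0) Set.Ioi_subset_Ici_self (by rw [closure_Ioi]) Set.self_mem_Ici
      (neg_ne_zero.2 hm0) ((neg_sq _).trans hm) lim2
  have val1 : ∀ v, ∀ x ≤ L, (Φ₁ v).1 x =
      Complex.exp (P.lam k * x) • amplitude P k (P.lam k) v := fun v x hx =>
    modeEquiv_apply hP _ _ _ _ _ _ _ _ _ v hx
  have val2 : ∀ v, ∀ x : ℝ, 0 ≤ x → (Φ₂ v).1 x =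
      Complex.exp (-P.lam k * x) • amplitude P k (-P.lam k) v := fun v x hx =>
    modeEquiv_apply hP _ _ _ _ _ _ _ _ _ v hx
  let Ψ : ((ℂ × ℂ) × (ℂ × ℂ)) ≃ₗ[ℂ] (Mode₁ P L k × Mode₂ P k) := Φ₁.prodCongr Φ₂
  refine ⟨Module.Finite.equiv Ψ, Ψ.conjAlgEquiv ℂ (modeStep P L k), ?_, ?_⟩
  · intro u w
    obtain ⟨v, rfl⟩ := Ψ.surjective u
    obtain ⟨v', rfl⟩ := Ψ.surjective w
    have h1 : Ψ.conjAlgEquiv ℂ (modeStep P L k) (Ψ v) = Ψ (modeStep P L k v) := by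
      simp [LinearEquiv.conjAlgEquiv]
    rw [h1, Ψ.injective.eq_iff]
    have hE : Complex.exp (P.lam k * L) ≠ 0 := Complex.exp_ne_zero _
    have e1 : impedance P ex ((Ψ v').1.1 L) = impedance P ex ((Ψ v).2.1 L) ↔
        (modeStep P L k v).1 = v'.1 := by
      change impedance P ex ((Φ₁ v'.1).1 L) = impedance P ex ((Φ₂ v.2).1 L) ↔ _
      rw [val1 _ _ le_rfl, val2 _ _ hL, show Complex.exp (-P.lam k * L) =
        Complex.exp (P.lam k * L) * Complex.exp (-(P.lam k * L)) ^ 2 by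
          rw [pow_two, ← Complex.exp_add, ← Complex.exp_add]; ring_nf,
        mul_smul, map_smul, map_smul, (smul_right_injective CVec hE).eq_iff, ← map_smul,
        impedance_ex_amplitude_iff hP, reflect_smul, eq_comm]
      rfl
    have e2 : impedance P (-ex) ((Ψ v').2.1 0) = impedance P (-ex) ((Ψ v).1.1 0) ↔
        (modeStep P L k v).2 = v'.2 := by
      change impedance P (-ex) ((Φ₂ v'.2).1 0) = impedance P (-ex) ((Φ₁ v.1).1 0) ↔ _
      rw [val1 _ _ hL, val2 _ _ le_rfl]
      simp only [Complex.ofReal_zero, mul_zero, Complex.exp_zero, one_smul]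
      rw [impedance_neg_ex_amplitude_iff hP, eq_comm]
      rfl
    rw [ModeStep, e1, e2, Prod.ext_iff]
  · rw [← map_pow, AlgEquiv.spectrum_eq]
    obtain ⟨h1, h2⟩ := spectrum_modeStep_sq hP L k
    have hval : ∀ r : ℂ, √‖(Complex.exp (-(P.lam k * L)) * r) ^ 2‖ =
        ‖Complex.exp (-(P.lam k * L))‖ * ‖r‖ := fun r => by
      rw [norm_pow, Real.sqrt_sq (norm_nonneg _), norm_mul]
    have hrho : P.rho L k = ‖Complex.exp (-(P.lam k * L))‖ * ‖P.rTE k‖ := by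
      rw [Params.rho_eq hP, norm_mul, mul_comm]
    refine ⟨⟨_, h1, ?_⟩, ?_⟩
    · rw [hrho]
      exact hval _
    · rintro _ ⟨z, hz, rfl⟩
      rw [hrho]
      rcases h2 z hz with rfl | rfl
      · exact (hval _).le
      · exact (hval _).le.trans (mul_le_mul_of_nonneg_left (Params.norm_rTM_le hP k)
          (norm_nonneg _))

/-! ### Weak derivatives in one variable -/

/-- Complex valued smooth functions with compact support in `S`. -/
structure IsTest {E : Type*} [NormedAddCommGroup E] [NormedSpace ℝ E] (S : Set E) (η : E → ℂ) :
    Prop where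
  smooth : ContDiff ℝ (⊤ : ℕ∞) η
  compact : HasCompactSupport η
  subset : tsupport η ⊆ S

namespace IsTest

variable {E : Type*} [NormedAddCommGroup E] [NormedSpace ℝ E] {S : Set E} {η θ : E → ℂ}

lemma eq_zero (h : IsTest S η) {x : E} (hx : x ∉ S) : η x = 0 :=
  image_eq_zero_of_notMem_tsupport fun h' => hx (h.subset h')

lemma continuous (h : IsTest S η) : Continuous η := h.smooth.continuous

lemma add (h : IsTest S η) (h' : IsTest S θ) : IsTest S (fun x => η x + θ x) :=
  ⟨h.smooth.add h'.smooth, h.compact.add h'.compact,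
    (tsupport_add η θ).trans (Set.union_subset h.subset h'.subset)⟩

lemma smooth_mul (h : IsTest S η) (hθ : ContDiff ℝ (⊤ : ℕ∞) θ) : IsTest S (fun x => θ x * η x) :=
  ⟨hθ.mul h.smooth, h.compact.mul_left, (tsupport_mul_subset_right).trans h.subset⟩

lemma const_mul (h : IsTest S η) (c : ℂ) : IsTest S (fun x => c * η x) :=
  h.smooth_mul contDiff_const

lemma fderiv_apply (h : IsTest S η) (v : E) : IsTest S (fun x => fderiv ℝ η x v) :=
  ⟨(h.smooth.fderiv_right (m := (⊤ : ℕ∞)) (by simp)).clm_apply contDiff_const,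
    h.compact.fderiv_apply (𝕜 := ℝ) v,
    (tsupport_fderiv_apply_subset ℝ v).trans h.subset⟩

lemma ofReal {g : E → ℝ} (h1 : ContDiff ℝ (⊤ : ℕ∞) g) (h2 : HasCompactSupport g)
    (h3 : tsupport g ⊆ S) : IsTest S (fun x => (g x : ℂ)) :=
  ⟨Complex.ofRealCLM.contDiff.comp h1, h2.comp_left (g := fun x : ℝ => (x : ℂ)) (by simp),
    (tsupport_comp_subset (g := fun x : ℝ => (x : ℂ)) (by simp) g).trans h3⟩

lemma deriv {I : Set ℝ} {η : ℝ → ℂ} (h : IsTest I η) : IsTest I (deriv η) := by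
  have := h.fderiv_apply 1
  simpa using this

lemma hasDerivAt {I : Set ℝ} {η : ℝ → ℂ} (h : IsTest I η) (x : ℝ) :
    HasDerivAt η (_root_.deriv η x) x :=
  (h.smooth.differentiable (by simp) x).hasDerivAt

variable [MeasurableSpace E] {μ : Measure E}

lemma setIntegral_mul (h : IsTest S η) (f : E → ℂ) :
    ∫ x in S, f x * η x ∂μ = ∫ x, f x * η x ∂μ :=
  setIntegral_eq_integral_of_forall_compl_eq_zero fun x hx => by rw [h.eq_zero hx, mul_zero]

lemma integrable_mul [OpensMeasurableSpace E] (h : IsTest S η) {f : E → ℂ}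
    (hf : LocallyIntegrableOn f S μ) : Integrable (fun x => f x * η x) μ := by
  have h1 := hf.integrableOn_compact_subset h.subset h.compact
  have h2 : IntegrableOn (fun x => f x * η x) (tsupport η) μ :=
    h1.mul_continuousOn h.continuous.continuousOn h.compact
  refine (integrableOn_iff_integrable_of_support_subset ?_).1 h2
  intro x hx
  by_contra h0
  exact hx (by simp [image_eq_zero_of_notMem_tsupport h0])

end IsTest

lemma exists_isTest_integral_eq_one {I : Set ℝ} (hI : IsOpen I) (hne : I.Nonempty) :
    ∃ η : ℝ → ℂ, IsTest I η ∧ ∫ x, η x = 1 := by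
  obtain ⟨x, hx⟩ := hne
  obtain ⟨r, hr, hrI⟩ := Metric.isOpen_iff.1 hI x hx
  let φ : ContDiffBump x := ⟨r / 4, r / 2, by positivity, by linarith⟩
  refine ⟨fun t => (φ.normed volume t : ℝ), IsTest.ofReal φ.contDiff_normed
    φ.hasCompactSupport_normed ?_, ?_⟩
  · rw [φ.tsupport_normed_eq]
    exact (Metric.closedBall_subset_ball (by change r / 2 < r; linarith)).trans hrI
  · rw [integral_complex_ofReal, φ.integral_normed, Complex.ofReal_one]

/-- `v` is the weak derivative of `u` in the set `I`. -/
def HasWeakDeriv (I : Set ℝ) (u v : ℝ → ℂ) : Prop :=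
  ∀ η : ℝ → ℂ, IsTest I η → ∫ x in I, u x * deriv η x = -∫ x in I, v x * η x

/-- A test function which is orthogonal to `e^{mx}` is of the form `η' + m η` with a test function
`η`. -/
lemma exists_deriv_add_eq {I : Set ℝ} (hI : I.OrdConnected) {m : ℂ} {χ : ℝ → ℂ}
    (hχ : IsTest I χ) (h0 : ∫ x : ℝ, Complex.exp (m * x) * χ x = 0) :
    ∃ η, IsTest I η ∧ ∀ x, χ x = deriv η x + m * η x := by
  rcases (tsupport χ).eq_empty_or_nonempty with he | hne
  · have hz : χ = 0 := by rwa [tsupport_eq_empty_iff] at he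
    refine ⟨0, ⟨contDiff_const, HasCompactSupport.zero, ?_⟩, fun x => ?_⟩
    · rw [tsupport_eq_empty_iff.2 rfl]
      exact Set.empty_subset _
    · have : deriv (0 : ℝ → ℂ) x = 0 := by
        rw [show (0 : ℝ → ℂ) = fun _ => 0 from rfl, deriv_const]
      simp [hz, this]
  obtain ⟨α, hα⟩ := hχ.compact.isCompact.exists_isLeast hne
  obtain ⟨β, hβ⟩ := hχ.compact.isCompact.exists_isGreatest hne
  have hsub : Set.Icc α β ⊆ I := hI.out (hχ.subset hα.1) (hχ.subset hβ.1)
  have hz : ∀ x, x ∉ Set.Icc α β → χ x = 0 := fun x hx =>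
    image_eq_zero_of_notMem_tsupport fun h => hx ⟨hα.2 h, hβ.2 h⟩
  -- `η = e^{-mx} G` with the primitive `G` of `e^{mx} χ`, which has compact support by orthogonality
  let g : ℝ → ℂ := fun x => Complex.exp (m * x) * χ x
  have hexp : ContDiff ℝ (⊤ : ℕ∞) fun x : ℝ => Complex.exp (m * x) :=
    (contDiff_const.mul Complex.ofRealCLM.contDiff).cexp
  have hexp' : ContDiff ℝ (⊤ : ℕ∞) fun x : ℝ => Complex.exp (-m * x) :=
    (contDiff_const.mul Complex.ofRealCLM.contDiff).cexp
  have hg : ContDiff ℝ (⊤ : ℕ∞) g := hexp.mul hχ.smooth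
  let G : ℝ → ℂ := fun x => ∫ t in (α - 1)..x, g t
  have hG : ∀ x, HasDerivAt G (g x) x := fun x =>
    intervalIntegral.integral_hasDerivAt_right (hg.continuous.intervalIntegrable _ _)
      (hg.continuous.stronglyMeasurableAtFilter _ _) hg.continuous.continuousAt
  have hGs : ContDiff ℝ (⊤ : ℕ∞) G := by
    rw [contDiff_infty_iff_deriv]
    refine ⟨fun x => (hG x).differentiableAt, ?_⟩
    rw [show deriv G = g from funext fun x => (hG x).deriv]
    exact hg
  have hgz : ∀ x, x ∉ Set.Icc α β → g x = 0 := fun x hx => by simp only [g, hz x hx, mul_zero]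
  have hGz : ∀ x, x ∉ Set.Icc α β → G x = 0 := by
    intro x hx
    rw [Set.mem_Icc, not_and_or, not_le, not_le] at hx
    rcases hx with hx | hx
    · refine intervalIntegral.integral_zero_ae (ae_of_all _ fun t ht => hgz t fun h => ?_)
      exact absurd (ht.2.trans_lt (max_lt (by linarith) hx)) (not_lt.2 h.1)
    · refine (intervalIntegral.integral_eq_integral_of_support_subset fun t ht => ?_).trans h0
      by_contra h
      refine ht (hgz t fun h' => h ⟨by linarith [h'.1], h'.2.trans hx.le⟩)
  refine ⟨fun x => Complex.exp (-m * x) * G x, ⟨hexp'.mul hGs, ?_, ?_⟩, fun x => ?_⟩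
  · exact HasCompactSupport.intro (K := Set.Icc α β) isCompact_Icc fun x hx => by simp [hGz x hx]
  · refine (closure_minimal (fun x hx => ?_) isClosed_Icc).trans hsub
    by_contra h
    exact hx (by simp [hGz x h])
  · have h1 := (hasDerivAt_exp_mul (-m) x).mul (hG x)
    have h2 : deriv (fun x : ℝ => Complex.exp (-m * x) * G x) x = _ := h1.deriv
    have h3 : Complex.exp (-m * x) * g x = χ x := by
      rw [← mul_assoc, ← Complex.exp_add]
      simp
    rw [h2, h3]
    ring

/-- Weak solutions of `w' = m w` are multiples of the exponential. -/
lemma HasWeakDeriv.exists_eq_exp {I : Set ℝ} (hI : IsOpen I) (hI' : I.OrdConnected) {m : ℂ}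
    {w : ℝ → ℂ} (hw : LocallyIntegrableOn w I) (h : HasWeakDeriv I w fun x => m * w x) :
    ∃ C : ℂ, ∀ᵐ x, x ∈ I → w x = C * Complex.exp (m * x) := by
  rcases I.eq_empty_or_nonempty with rfl | hne
  · exact ⟨0, by simp⟩
  have hexp : ∀ μ : ℂ, ContDiff ℝ (⊤ : ℕ∞) fun x : ℝ => Complex.exp (μ * x) := fun μ =>
    (contDiff_const.mul Complex.ofRealCLM.contDiff).cexp
  obtain ⟨φ, hφ, hφ1⟩ := exists_isTest_integral_eq_one hI hne
  let χ₀ : ℝ → ℂ := fun x => Complex.exp (-m * x) * φ x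
  have hχ₀ : IsTest I χ₀ := hφ.smooth_mul (hexp _)
  have hχ₀1 : ∫ x : ℝ, Complex.exp (m * x) * χ₀ x = 1 := by
    rw [← hφ1]
    congr 1
    funext x
    rw [← mul_assoc, ← Complex.exp_add]
    simp
  set C := ∫ x, w x * χ₀ x
  have key : ∀ χ, IsTest I χ → ∫ x, w x * χ x = C * ∫ x : ℝ, Complex.exp (m * x) * χ x := by
    intro χ hχ
    set K := ∫ x : ℝ, Complex.exp (m * x) * χ x with hK
    have hexpint : ∀ θ, IsTest I θ → Integrable fun x : ℝ => Complex.exp (m * x) * θ x :=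
      fun θ hθ => hθ.integrable_mul ((hexp m).continuous.locallyIntegrable.locallyIntegrableOn _)
    have h1 : IsTest I fun x => χ x + -K * χ₀ x := hχ.add (hχ₀.const_mul _)
    have h2 : ∫ x : ℝ, Complex.exp (m * x) * (χ x + -K * χ₀ x) = 0 := by
      have : ∀ x : ℝ, Complex.exp (m * x) * (χ x + -K * χ₀ x) =
          Complex.exp (m * x) * χ x + -K * (Complex.exp (m * x) * χ₀ x) := fun x => by ring
      simp only [this]
      rw [integral_add (hexpint _ hχ) ((hexpint _ hχ₀).const_mul _), integral_const_mul, hχ₀1, ← hK]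
      ring
    obtain ⟨η, hη, he⟩ := exists_deriv_add_eq hI' h1 h2
    have h3 : ∫ x, w x * (χ x + -K * χ₀ x) = 0 := by
      simp only [he, mul_add]
      rw [integral_add (hη.deriv.integrable_mul hw)
        (by simpa [mul_assoc, mul_left_comm] using (hη.const_mul m).integrable_mul hw),
        ← hη.deriv.setIntegral_mul, h η hη, ← (hη.const_mul m).setIntegral_mul]
      simp only [mul_assoc, mul_left_comm m]
      exact neg_add_cancel _
    have h4 : ∀ x, w x * (χ x + -K * χ₀ x) = w x * χ x + -K * (w x * χ₀ x) := fun x => by ring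
    simp only [h4] at h3
    rw [integral_add (hχ.integrable_mul hw) ((hχ₀.integrable_mul hw).const_mul _),
      integral_const_mul] at h3
    linear_combination h3
  have hloc : LocallyIntegrableOn (fun x : ℝ => C * Complex.exp (m * x)) I :=
    (show Continuous fun x : ℝ => C * Complex.exp (m * x) from
      continuous_const.mul (hexp m).continuous).locallyIntegrable.locallyIntegrableOn _
  have h5 := hI.ae_eq_zero_of_integral_contDiff_smul_eq_zero (μ := volume)
    (f := fun x => w x - C * Complex.exp (m * x)) (hw.sub hloc) (fun g g1 g2 g3 => by
      have hg := IsTest.ofReal g1 g2 g3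
      have h6 := key _ hg
      rw [← integral_const_mul, ← sub_eq_zero, ← integral_sub (hg.integrable_mul hw)
        (by simpa [mul_assoc] using hg.integrable_mul hloc)] at h6
      rw [← h6]
      congr 1
      funext x
      rw [Complex.real_smul]
      ring)
  refine ⟨C, ?_⟩
  filter_upwards [h5] with x hx hxI
  exact sub_eq_zero.1 (hx hxI)

/-- The primitive of an integrable function has that function as its weak derivative. -/
lemma hasWeakDeriv_primitive {I : Set ℝ} {g : ℝ → ℂ} (hg : Integrable g) (a : ℝ) :
    HasWeakDeriv I (fun x => ∫ t in a..x, g t) g := by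
  intro η hη
  rw [hη.deriv.setIntegral_mul, hη.setIntegral_mul]
  have hint : Integrable (deriv η) :=
    hη.deriv.continuous.integrable_of_hasCompactSupport hη.deriv.compact
  have htot : ∫ x, deriv η x = 0 := integral_eq_zero_of_hasDerivAt_of_integrable
    (fun x => hη.hasDerivAt x) hint (hη.continuous.integrable_of_hasCompactSupport hη.compact)
  have h1 : ∀ x, ∫ t in a..x, g t = (∫ t in Set.Iic x, g t) - ∫ t in Set.Iic a, g t := fun x =>
    (intervalIntegral.integral_Iic_sub_Iic hg.integrableOn hg.integrableOn).symm
  have h2 : ∀ x, (∫ t in Set.Iic x, g t) = ∫ t, (Set.Iic x).indicator g t := fun x =>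
    (integral_indicator measurableSet_Iic).symm
  -- Fubini on the half-plane `t ≤ x`
  have h3 : ∫ x, (∫ t in Set.Iic x, g t) * deriv η x = -∫ x, g x * η x := by
    have hF : Integrable (fun z : ℝ × ℝ => {z : ℝ × ℝ | z.2 ≤ z.1}.indicator
        (fun z => g z.2 * deriv η z.1) z) (volume.prod volume) := by
      refine Integrable.indicator ?_ (measurableSet_le measurable_snd measurable_fst)
      have := (hint.mul_prod hg)
      simpa [mul_comm] using this
    have e1 : ∀ x, (∫ t in Set.Iic x, g t) * deriv η x =
        ∫ t, {z : ℝ × ℝ | z.2 ≤ z.1}.indicator (fun z => g z.2 * deriv η z.1) (x, t) := by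
      intro x
      rw [h2, ← integral_mul_const]
      congr 1
      funext t
      by_cases ht : t ≤ x <;> simp [Set.indicator, ht]
    simp only [e1]
    rw [integral_integral_swap hF, ← integral_neg]
    congr 1
    funext t
    have e2 : ∀ x, {z : ℝ × ℝ | z.2 ≤ z.1}.indicator (fun z => g z.2 * deriv η z.1) (x, t) =
        g t * (Set.Ici t).indicator (deriv η) x := by
      intro x
      by_cases ht : t ≤ x <;> simp [Set.indicator, ht]
    simp only [e2]
    rw [integral_const_mul, integral_indicator measurableSet_Ici, integral_Ici_eq_integral_Ioi,
      hη.compact.integral_Ioi_deriv_eq (hη.smooth.of_le (by simp))]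
    ring
  simp only [h1, sub_mul]
  rw [integral_sub, h3, integral_const_mul, htot, mul_zero, sub_zero]
  · have hc : Continuous fun x => ∫ t in Set.Iic x, g t := by
      have h4 : Continuous fun x => ∫ t in a..x, g t :=
        intervalIntegral.continuous_primitive (fun _ _ => hg.intervalIntegrable) a
      have h5 : (fun x => ∫ t in Set.Iic x, g t) =
          fun x => (∫ t in a..x, g t) + ∫ t in Set.Iic a, g t := by
        funext x
        rw [h1]
        ring
      rw [h5]
      exact h4.add continuous_const
    exact hη.deriv.integrable_mul (hc.locallyIntegrable.locallyIntegrableOn _)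
  · exact hint.const_mul _

/-- A function with an integrable weak derivative near `a` has the same averages on the two sides
of `a`, in the limit of short intervals. -/
lemma HasWeakDeriv.tendsto_average {a δ : ℝ} (hδ : 0 < δ) {q g : ℝ → ℂ}
    (hq : IntegrableOn q (Set.Ioo (a - δ) (a + δ)))
    (hg : IntegrableOn g (Set.Ioo (a - δ) (a + δ)))
    (h : HasWeakDeriv (Set.Ioo (a - δ) (a + δ)) q g) :
    ∃ C : ℂ, Tendsto (fun t : ℝ => t⁻¹ • ∫ x in Set.Ioo (a - t) a, q x) (𝓝[>] 0) (𝓝 C) ∧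
      Tendsto (fun t : ℝ => t⁻¹ • ∫ x in Set.Ioo a (a + t), q x) (𝓝[>] 0) (𝓝 C) := by
  set J := Set.Ioo (a - δ) (a + δ) with hJ
  let g' := J.indicator g
  have hg' : Integrable g' := (integrable_indicator_iff measurableSet_Ioo).2 hg
  let G : ℝ → ℂ := fun x => ∫ t in a..x, g' t
  have hGc : Continuous G :=
    intervalIntegral.continuous_primitive (fun _ _ => hg'.intervalIntegrable) a
  have hGl : LocallyIntegrableOn G J := hGc.locallyIntegrable.locallyIntegrableOn _
  have hG : HasWeakDeriv J G g' := hasWeakDeriv_primitive hg' a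
  have hd : HasWeakDeriv J (fun x => q x - G x) fun x => 0 * (q x - G x) := by
    intro η hη
    simp only [sub_mul, zero_mul, integral_zero, neg_zero]
    rw [integral_sub, h η hη, hG η hη, sub_eq_zero, neg_inj]
    · refine setIntegral_congr_fun measurableSet_Ioo fun x hx => ?_
      simp only [g', Set.indicator_of_mem hx]
    · exact (hη.deriv.integrable_mul hq.locallyIntegrableOn).integrableOn
    · exact (hη.deriv.integrable_mul hGl).integrableOn
  obtain ⟨C, hC⟩ := hd.exists_eq_exp isOpen_Ioo Set.ordConnected_Ioo
    (hq.locallyIntegrableOn.sub hGl)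
  let F : ℝ → ℂ := fun x => C + G x
  have hFc : Continuous F := continuous_const.add hGc
  have hqF : ∀ᵐ x, x ∈ J → q x = F x := by
    filter_upwards [hC] with x hx hxJ
    have : q x - G x = _ := hx hxJ
    simp only [zero_mul, Complex.exp_zero, mul_one] at this
    simp only [F]
    linear_combination this
  have hder : HasDerivAt (fun x => ∫ t in a..x, F t) (F a) a :=
    intervalIntegral.integral_hasDerivAt_right (hFc.intervalIntegrable _ _)
      (hFc.stronglyMeasurableAtFilter _ _) hFc.continuousAt
  have hsmall : ∀ᶠ t : ℝ in 𝓝[>] 0, 0 < t ∧ t < δ := Ioo_mem_nhdsGT hδ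
  refine ⟨F a, ?_, ?_⟩
  · have hneg : Tendsto (fun t : ℝ => -t) (𝓝[>] 0) (𝓝[<] 0) := by
      simpa using tendsto_neg_nhdsGT (a := (0 : ℝ))
    refine (hder.tendsto_slope_zero_left.comp hneg).congr' ?_
    filter_upwards [hsmall] with t ht
    simp only [Function.comp, intervalIntegral.integral_same, sub_zero]
    rw [intervalIntegral.integral_of_ge (by linarith), inv_neg, neg_smul, smul_neg, neg_neg,
      integral_Ioc_eq_integral_Ioo, ← sub_eq_add_neg]
    congr 1
    refine (setIntegral_congr_ae measurableSet_Ioo ?_).symm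
    filter_upwards [hqF] with x hx hxt
    exact hx ⟨by linarith [hxt.1], by linarith [hxt.2]⟩
  · refine hder.tendsto_slope_zero_right.congr' ?_
    filter_upwards [hsmall] with t ht
    simp only [intervalIntegral.integral_same, sub_zero]
    rw [intervalIntegral.integral_of_le (by linarith), integral_Ioc_eq_integral_Ioo]
    congr 1
    refine (setIntegral_congr_ae measurableSet_Ioo ?_).symm
    filter_upwards [hqF] with x hx hxt
    exact hx ⟨by linarith [hxt.1], by linarith [hxt.2]⟩

/-! ### Solvability of coercive problems by duality -/

/-- A linear functional `g` that is bounded by the norm of `A` is represented by a vector tested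
against `A`. -/
lemma exists_inner_eq_of_bound {V X : Type*} [AddCommGroup V] [Module ℂ V] [NormedAddCommGroup X]
    [InnerProductSpace ℂ X] [CompleteSpace X] (A : V →ₗ[ℂ] X) (g : V →ₗ[ℂ] ℂ) (K : ℝ)
    (h : ∀ v, ‖g v‖ ≤ K * ‖A v‖) : ∃ x : X, ∀ v, inner ℂ x (A v) = g v := by
  have hker : LinearMap.ker A ≤ LinearMap.ker g := fun v hv => by
    rw [LinearMap.mem_ker] at hv ⊢
    have := h v
    rw [hv, norm_zero, mul_zero] at this
    exact norm_le_zero_iff.1 this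
  let g' : LinearMap.range A →ₗ[ℂ] ℂ :=
    ((LinearMap.ker A).liftQ g hker).comp A.quotKerEquivRange.symm.toLinearMap
  have hg' : ∀ v, g' ⟨A v, LinearMap.mem_range_self A v⟩ = g v := fun v => by
    have : A.quotKerEquivRange.symm ⟨A v, LinearMap.mem_range_self A v⟩ =
        (LinearMap.ker A).mkQ v := by
      rw [LinearEquiv.symm_apply_eq]
      rfl
    simp only [g', LinearMap.comp_apply, LinearEquiv.coe_coe, this]
    rfl
  let G : LinearMap.range A →L[ℂ] ℂ := g'.mkContinuous K (by
    rintro ⟨_, v, rfl⟩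
    rw [hg']
    exact h v)
  obtain ⟨F, hF, -⟩ := exists_extension_norm_eq (LinearMap.range A) G
  refine ⟨(InnerProductSpace.toDual ℂ X).symm F, fun v => ?_⟩
  rw [InnerProductSpace.toDual_symm_apply]
  exact (hF ⟨A v, LinearMap.mem_range_self A v⟩).trans (hg' v)

/-- Coercivity of the conductive Maxwell system. The weights `-(1 + iη)` and `1 - iη` on the two
equations turn the contribution of the (symmetric) curl into a purely imaginary number plus the
boundary term `β`; a small `η > 0` transfers some of the conductive damping to the magnetic field.
-/
lemma maxwell_coercive {P : Params} (hP : P.Pos) : ∃ K : ℝ, ∀ (X : Type) [NormedAddCommGroup X]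
    [InnerProductSpace ℂ X] (e h ce ch : X) (β : ℝ), 0 ≤ β →
    inner ℂ h ce - inner ℂ ch e = (β : ℂ) →
    ‖e‖ + ‖h‖ ≤ K * (‖ch - P.adm • e‖ + ‖ce + P.imp • h‖) := by
  have hre : P.adm.re = P.σ := by simp [Params.adm]
  have him : P.adm.im = P.ω * P.ε := by simp [Params.adm]
  have hw : 0 < P.ω * P.ε := mul_pos hP.ω hP.ε
  have hwm : 0 < P.ω * P.μ := mul_pos hP.ω hP.μ
  set η := P.σ / (2 * (P.ω * P.ε)) with hη
  have hη0 : 0 < η := div_pos hP.σ (by positivity)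
  have hηe : η * (P.ω * P.ε) = P.σ / 2 := by
    rw [hη]
    field_simp [hP.ω.ne', hP.ε.ne']
  set c := min (P.σ / 2) (η * (P.ω * P.μ))
  have hc : 0 < c := lt_min (half_pos hP.σ) (mul_pos hη0 hwm)
  refine ⟨2 * (1 + η) / c, fun X _ _ e h ce ch β hβ hflux => ?_⟩
  set τ : ℂ := 1 + η * Complex.I with hτ
  have hτn : ‖τ‖ ≤ 1 + η := by
    refine (norm_add_le _ _).trans ?_
    simp [abs_of_pos hη0]
  have hτn' : ‖(starRingEnd ℂ) τ‖ ≤ 1 + η := by rwa [RCLike.norm_conj]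
  set Y := inner ℂ e ch with hY
  have hYc : inner ℂ ch e = (starRingEnd ℂ) Y := (inner_conj_symm _ _).symm
  have hce : inner ℂ h ce = (starRingEnd ℂ) Y + β := by
    rw [← hYc]
    linear_combination hflux
  have key : c * (‖e‖ ^ 2 + ‖h‖ ^ 2) ≤
      (-τ * inner ℂ e (ch - P.adm • e) + (starRingEnd ℂ) τ * inner ℂ h (ce + P.imp • h)).re := by
    rw [inner_sub_right, inner_add_right, inner_smul_right, inner_smul_right,
      inner_self_eq_norm_sq_to_K, inner_self_eq_norm_sq_to_K, ← hY, hce]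
    have e1 : (-τ * (Y - P.adm * (‖e‖ : ℂ) ^ 2) +
        (starRingEnd ℂ) τ * ((starRingEnd ℂ) Y + β + P.imp * (‖h‖ : ℂ) ^ 2)).re =
        (P.σ - η * (P.ω * P.ε)) * ‖e‖ ^ 2 + η * (P.ω * P.μ) * ‖h‖ ^ 2 + β := by
      rw [← Complex.ofReal_pow, ← Complex.ofReal_pow]
      simp [hτ, Params.adm, Params.imp, -Complex.ofReal_pow]
      ring
    refine le_trans ?_ (le_of_eq e1.symm)
    rw [hηe]
    nlinarith [mul_le_mul_of_nonneg_right (min_le_left (P.σ / 2) (η * (P.ω * P.μ))) (sq_nonneg ‖e‖),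
      mul_le_mul_of_nonneg_right (min_le_right (P.σ / 2) (η * (P.ω * P.μ))) (sq_nonneg ‖h‖)]
  have upper : (-τ * inner ℂ e (ch - P.adm • e) +
      (starRingEnd ℂ) τ * inner ℂ h (ce + P.imp • h)).re ≤
      (1 + η) * ((‖e‖ + ‖h‖) * (‖ch - P.adm • e‖ + ‖ce + P.imp • h‖)) := by
    refine (Complex.re_le_norm _).trans ((norm_add_le _ _).trans ?_)
    rw [norm_mul, norm_mul, norm_neg]
    have h1 := norm_inner_le_norm (𝕜 := ℂ) e (ch - P.adm • e)
    have h2 := norm_inner_le_norm (𝕜 := ℂ) h (ce + P.imp • h)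
    have h3 : 0 ≤ ‖e‖ * ‖ce + P.imp • h‖ := by positivity
    have h4 : 0 ≤ ‖h‖ * ‖ch - P.adm • e‖ := by positivity
    calc _ ≤ (1 + η) * (‖e‖ * ‖ch - P.adm • e‖) + (1 + η) * (‖h‖ * ‖ce + P.imp • h‖) := by
          gcongr
      _ ≤ _ := by nlinarith
  set R := ‖ch - P.adm • e‖ + ‖ce + P.imp • h‖
  set s := ‖e‖ + ‖h‖ with hs
  have hs0 : 0 ≤ s := by positivity
  have h5 : c * s ^ 2 ≤ 2 * (1 + η) * (s * R) := by
    have : s ^ 2 ≤ 2 * (‖e‖ ^ 2 + ‖h‖ ^ 2) := by nlinarith [sq_nonneg (‖e‖ - ‖h‖)]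
    nlinarith [key.trans upper]
  rcases hs0.eq_or_lt with h0 | h0
  · rw [← h0]
    have : 0 ≤ R := by positivity
    positivity
  · have h6 : c * s ≤ 2 * (1 + η) * R := by
      refine le_of_mul_le_mul_right ?_ h0
      nlinarith
    rw [div_mul_eq_mul_div, le_div_iff₀ hc]
    linarith

/-- Solvability of the weak Maxwell problem in a Hilbert space `X`, for test pairs `(φ₁, φ₂)` with
curls `(c₁, c₂)` and a nonnegative boundary term. -/
lemma exists_solution_of_flux {P : Params} (hP : P.Pos) {V X : Type} [AddCommGroup V] [Module ℂ V]
    [NormedAddCommGroup X] [InnerProductSpace ℂ X] [CompleteSpace X] (φ₁ φ₂ c₁ c₂ : V →ₗ[ℂ] X)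
    (hflux : ∀ v, ∃ β : ℝ, 0 ≤ β ∧ inner ℂ (φ₂ v) (c₁ v) - inner ℂ (c₂ v) (φ₁ v) = (β : ℂ))
    (F G : X) : ∃ E H : X, ∀ v, inner ℂ E (c₂ v - P.adm • φ₁ v) +
      inner ℂ H (c₁ v + P.imp • φ₂ v) = inner ℂ F (φ₁ v) + inner ℂ G (φ₂ v) := by
  obtain ⟨K, hK⟩ := maxwell_coercive hP
  let A₁ : V →ₗ[ℂ] X := c₂ - P.adm • φ₁
  let A₂ : V →ₗ[ℂ] X := c₁ + P.imp • φ₂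
  let A : V →ₗ[ℂ] WithLp 2 (X × X) :=
    (WithLp.linearEquiv 2 ℂ (X × X)).symm.toLinearMap.comp (A₁.prod A₂)
  let ℓ : V →ₗ[ℂ] ℂ :=
    (innerSL ℂ F).toLinearMap.comp φ₁ + (innerSL ℂ G).toLinearMap.comp φ₂
  obtain ⟨x, hx⟩ := exists_inner_eq_of_bound A ℓ ((‖F‖ + ‖G‖) * (|K| * 2)) (by
    intro v
    obtain ⟨β, hβ, hf⟩ := hflux v
    have h1 := hK X (φ₁ v) (φ₂ v) (c₁ v) (c₂ v) β hβ hf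
    have hA : ‖A v‖ ^ 2 = ‖A₁ v‖ ^ 2 + ‖A₂ v‖ ^ 2 := WithLp.prod_norm_sq_eq_of_L2 (A v)
    have h2 : ‖A₁ v‖ ≤ ‖A v‖ := le_of_sq_le_sq (by nlinarith [sq_nonneg ‖A₂ v‖]) (norm_nonneg _)
    have h3 : ‖A₂ v‖ ≤ ‖A v‖ := le_of_sq_le_sq (by nlinarith [sq_nonneg ‖A₁ v‖]) (norm_nonneg _)
    have h4 : ‖ℓ v‖ ≤ ‖F‖ * ‖φ₁ v‖ + ‖G‖ * ‖φ₂ v‖ :=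
      (norm_add_le _ _).trans (add_le_add (norm_inner_le_norm (𝕜 := ℂ) F (φ₁ v))
        (norm_inner_le_norm (𝕜 := ℂ) G (φ₂ v)))
    have h5 : ‖φ₁ v‖ + ‖φ₂ v‖ ≤ |K| * (‖A v‖ + ‖A v‖) := by
      refine h1.trans ?_
      refine (mul_le_mul_of_nonneg_right (le_abs_self K) (by positivity)).trans ?_
      exact mul_le_mul_of_nonneg_left (add_le_add h2 h3) (abs_nonneg K)
    have h6 := norm_nonneg F
    have h7 := norm_nonneg G
    have h8 := norm_nonneg (φ₁ v)
    have h9 := norm_nonneg (φ₂ v)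
    calc ‖ℓ v‖ ≤ (‖F‖ + ‖G‖) * (‖φ₁ v‖ + ‖φ₂ v‖) := by nlinarith
      _ ≤ (‖F‖ + ‖G‖) * (|K| * (‖A v‖ + ‖A v‖)) := by gcongr
      _ = _ := by ring)
  exact ⟨x.fst, x.snd, fun v => (WithLp.prod_inner_apply x (A v)).symm.trans (hx v)⟩

/-! ### Test fields -/

lemma isTestField_iff {S : Set Space} {φ : Space → CVec} :
    IsTestField S φ ↔ ∀ i, IsTest S fun p => φ p i := by
  constructor
  · rintro ⟨h1, h2, h3⟩ i
    exact ⟨contDiff_pi.1 h1 i, h2.comp_left (g := fun v : CVec => v i) rfl,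
      (tsupport_comp_subset (g := fun v : CVec => v i) rfl φ).trans h3⟩
  · intro h
    have hsupp : tsupport φ ⊆ ⋃ i, tsupport fun p => φ p i := by
      refine closure_minimal (fun p hp => ?_) (isClosed_iUnion_of_finite fun i => isClosed_closure)
      obtain ⟨i, hi⟩ := Function.ne_iff.1 hp
      exact Set.mem_iUnion.2 ⟨i, subset_closure hi⟩
    refine ⟨contDiff_pi.2 fun i => (h i).smooth, ?_, hsupp.trans (Set.iUnion_subset fun i =>
      (h i).subset)⟩
    exact (isCompact_iUnion fun i => (h i).compact).of_isClosed_subset isClosed_closure hsupp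

namespace IsTestField

variable {S T : Set Space} {φ ψ : Space → CVec}

lemma mono (h : IsTestField S φ) (hST : S ⊆ T) : IsTestField T φ :=
  ⟨h.1, h.2.1, h.2.2.trans hST⟩

lemma differentiableAt (h : IsTestField S φ) (p : Space) : DifferentiableAt ℝ φ p :=
  h.1.differentiable (by simp) p

lemma pderiv_eq (h : IsTestField S φ) (j i : Fin 3) (p : Space) :
    pderiv φ j i p = fderiv ℝ (fun q => φ q i) p (dir j) := by
  rw [pderiv, fderiv_apply (h.differentiableAt p)]
  rfl

lemma isTest_pderiv (h : IsTestField S φ) (j i : Fin 3) : IsTest S (pderiv φ j i) := by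
  rw [show pderiv φ j i = fun p => fderiv ℝ (fun q => φ q i) p (dir j) from
    funext fun p => h.pderiv_eq j i p]
  exact (isTestField_iff.1 h i).fderiv_apply _

lemma curl (h : IsTestField S φ) : IsTestField S (curl φ) := by
  rw [isTestField_iff]
  have key : ∀ i j i' j' : Fin 3, IsTest S fun p => pderiv φ j i p - pderiv φ j' i' p := by
    intro i j i' j'
    simpa [sub_eq_add_neg] using
      (h.isTest_pderiv j i).add ((h.isTest_pderiv j' i').const_mul (-1))
  intro i
  fin_cases i
  · exact key 2 1 1 2
  · exact key 0 2 2 0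
  · exact key 1 0 0 1

lemma add (h : IsTestField S φ) (h' : IsTestField S ψ) : IsTestField S (φ + ψ) :=
  isTestField_iff.2 fun i => (isTestField_iff.1 h i).add (isTestField_iff.1 h' i)

lemma smul (h : IsTestField S φ) (c : ℂ) : IsTestField S (c • φ) :=
  isTestField_iff.2 fun i => (isTestField_iff.1 h i).const_mul c

lemma memLp (h : IsTestField S φ) (μ : Measure Space) [IsFiniteMeasureOnCompacts μ] :
    MemLp (fun p => WithLp.toLp 2 (φ p) : Space → EuclideanSpace ℂ (Fin 3)) 2 μ := by
  refine Continuous.memLp_of_hasCompactSupport ?_ ?_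
  · exact (PiLp.continuous_toLp 2 _).comp h.1.continuous
  · exact h.2.1.comp_left (g := fun v : CVec => (WithLp.toLp 2 v : EuclideanSpace ℂ (Fin 3)))
      rfl

end IsTestField

/-- The space of test fields. -/
def testFields : Submodule ℂ (Space → CVec) where
  carrier := {φ | IsTestField Set.univ φ}
  add_mem' := fun h h' => h.add h'
  zero_mem' := isTestField_iff.2 fun _ =>
    ⟨contDiff_const, HasCompactSupport.zero, Set.subset_univ _⟩
  smul_mem' := fun c _ h => h.smul c

/-- Square integrable vector fields as a Hilbert space. -/
abbrev VecL2 (S : Set Space) := Lp (EuclideanSpace ℂ (Fin 3)) 2 (volume.restrict S)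

/-- A test field as a square integrable field. -/
def testToL2 (S : Set Space) : testFields →ₗ[ℂ] VecL2 S where
  toFun φ := (φ.2.memLp (volume.restrict S)).toLp _
  map_add' _ _ := rfl
  map_smul' _ _ := rfl

/-- The curl of a test field as a square integrable field. -/
def testCurlToL2 (S : Set Space) : testFields →ₗ[ℂ] VecL2 S where
  toFun φ := (φ.2.curl.memLp (volume.restrict S)).toLp _
  map_add' φ ψ := by
    rw [← MemLp.toLp_add]
    congr 1
    funext p
    have : curl (φ.1 + ψ.1) p = curl φ.1 p + curl ψ.1 p :=
      curl_add (φ.2.differentiableAt p) (ψ.2.differentiableAt p)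
    simp [this]
  map_smul' c φ := by
    rw [RingHom.id_apply, ← MemLp.toLp_const_smul]
    congr 1
    funext p
    have : curl (c • φ.1) p = c • curl φ.1 p := curl_smul c (φ.2.differentiableAt p)
    simp [this]

lemma inner_toLp_eq {S : Set Space} {f g : Space → CVec}
    (hf : MemLp (fun p => WithLp.toLp 2 (f p) : Space → EuclideanSpace ℂ (Fin 3)) 2
      (volume.restrict S))
    (hg : MemLp (fun p => WithLp.toLp 2 (g p) : Space → EuclideanSpace ℂ (Fin 3)) 2
      (volume.restrict S)) :
    inner ℂ (hf.toLp _) (hg.toLp _) = ∫ p in S, star (f p) ⬝ᵥ g p := by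
  rw [L2.inner_def]
  refine integral_congr_ae ?_
  filter_upwards [hf.coeFn_toLp, hg.coeFn_toLp] with p h1 h2
  rw [h1, h2, EuclideanSpace.inner_eq_star_dotProduct]
  exact dotProduct_comm _ _

/-- Solvability of the weak Maxwell problem with test pairs in `V`, provided the boundary term of
every pair in `V` is nonnegative. The boundary conditions on the solution are those that are
natural for `V`. -/
theorem exists_weak_solution {P : Params} (hP : P.Pos) (S : Set Space)
    (V : Submodule ℂ (testFields × testFields))
    (hV : ∀ v ∈ V, ∃ β : ℝ, 0 ≤ β ∧ (∫ p in S, star (v.2.1 p) ⬝ᵥ curl v.1.1 p) -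
      ∫ p in S, star (curl v.2.1 p) ⬝ᵥ v.1.1 p = β)
    {f g : Space → CVec}
    (hf : MemLp f 2 (volume.restrict S)) (hg : MemLp g 2 (volume.restrict S)) :
    ∃ E H : Space → CVec, MemLp E 2 (volume.restrict S) ∧ MemLp H 2 (volume.restrict S) ∧
      ∀ v ∈ V, (∫ p in S, E p ⬝ᵥ (curl v.2.1 p - P.adm • v.1.1 p)) +
        (∫ p in S, H p ⬝ᵥ (curl v.1.1 p + P.imp • v.2.1 p)) =
        (∫ p in S, f p ⬝ᵥ v.1.1 p) + ∫ p in S, g p ⬝ᵥ v.2.1 p := by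
  have toE : ∀ {f : Space → CVec}, MemLp f 2 (volume.restrict S) →
      MemLp (fun p => WithLp.toLp 2 (star (f p)) : Space → EuclideanSpace ℂ (Fin 3)) 2
        (volume.restrict S) := fun hf =>
    (PiLp.continuousLinearEquiv 2 ℂ (fun _ : Fin 3 => ℂ)).symm.toContinuousLinearMap.comp_memLp'
      hf.star
  have ofE : ∀ u : VecL2 S, ∃ u' : Space → CVec, MemLp u' 2 (volume.restrict S) ∧
      ∃ h : MemLp (fun p => WithLp.toLp 2 (star (u' p)) : Space → EuclideanSpace ℂ (Fin 3)) 2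
        (volume.restrict S), u = h.toLp _ := by
    intro u
    have h1 : MemLp (fun p => (u p).ofLp) 2 (volume.restrict S) :=
      (PiLp.continuousLinearEquiv 2 ℂ (fun _ : Fin 3 => ℂ)).toContinuousLinearMap.comp_memLp'
        (Lp.memLp u)
    exact ⟨fun p => star (u p).ofLp, h1.star, by simpa using Lp.memLp u, by simp⟩
  let T := testToL2 S
  let C := testCurlToL2 S
  obtain ⟨E', H', hEH⟩ := exists_solution_of_flux hP
    ((T.comp (LinearMap.fst ℂ _ _)).comp V.subtype) ((T.comp (LinearMap.snd ℂ _ _)).comp V.subtype)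
    ((C.comp (LinearMap.fst ℂ _ _)).comp V.subtype) ((C.comp (LinearMap.snd ℂ _ _)).comp V.subtype)
    (fun v : V => by
      obtain ⟨β, hβ, hflux⟩ := hV v.1 v.2
      have i1 : inner ℂ (T v.1.2) (C v.1.1) = ∫ p in S, star (v.1.2.1 p) ⬝ᵥ curl v.1.1.1 p :=
        inner_toLp_eq (v.1.2.2.memLp _) (v.1.1.2.curl.memLp _)
      have i2 : inner ℂ (C v.1.2) (T v.1.1) = ∫ p in S, star (curl v.1.2.1 p) ⬝ᵥ v.1.1.1 p :=
        inner_toLp_eq (v.1.2.2.curl.memLp _) (v.1.1.2.memLp _)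
      exact ⟨β, hβ, (congrArg₂ (· - ·) i1 i2).trans hflux⟩)
    ((toE hf).toLp _) ((toE hg).toLp _)
  obtain ⟨E, hE, hE', hEx⟩ := ofE E'
  obtain ⟨H, hH, hH', hHx⟩ := ofE H'
  refine ⟨E, H, hE, hH, fun v hv => ?_⟩
  have h1 : inner ℂ E' (C v.2 - P.adm • T v.1) + inner ℂ H' (C v.1 + P.imp • T v.2) =
    inner ℂ ((toE hf).toLp _) (T v.1) + inner ℂ ((toE hg).toLp _) (T v.2) := hEH ⟨v, hv⟩
  have e1 : C v.2 - P.adm • T v.1 =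
      ((v.2.2.curl.add (v.1.2.smul (-P.adm))).memLp _).toLp _ := by
    rw [sub_eq_add_neg, ← neg_smul]
    rfl
  have e2 : C v.1 + P.imp • T v.2 = ((v.1.2.curl.add (v.2.2.smul P.imp)).memLp _).toLp _ := rfl
  have h2 : inner ℂ ((toE hf).toLp _) (T v.1) = ∫ p in S, star (star (f p)) ⬝ᵥ v.1.1 p :=
    inner_toLp_eq _ (v.1.2.memLp _)
  have h3 : inner ℂ ((toE hg).toLp _) (T v.2) = ∫ p in S, star (star (g p)) ⬝ᵥ v.2.1 p :=
    inner_toLp_eq _ (v.2.2.memLp _)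
  rw [hEx, hHx, e1, e2, inner_toLp_eq, inner_toLp_eq, h2, h3] at h1
  simpa [sub_eq_add_neg] using h1

/-! ### Integration by parts -/

lemma restrict_fst_mem (I : Set ℝ) :
    (volume : Measure Space).restrict {p | p.1 ∈ I} = (volume.restrict I).prod volume := by
  have h : {p : Space | p.1 ∈ I} = I ×ˢ (Set.univ : Set Plane) := by
    ext p
    simp
  rw [h, Measure.volume_eq_prod, ← Measure.prod_restrict, Measure.restrict_univ]

lemma IsTest.integrable {E : Type*} [NormedAddCommGroup E] [NormedSpace ℝ E]
    [MeasurableSpace E] [OpensMeasurableSpace E] {μ : Measure E} [IsFiniteMeasureOnCompacts μ]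
    {S : Set E} {η : E → ℂ} (h : IsTest S η) : Integrable η μ :=
  h.continuous.integrable_of_hasCompactSupport h.compact

lemma IsTest.integral_fderiv {E : Type*} [NormedAddCommGroup E] [NormedSpace ℝ E]
    [FiniteDimensional ℝ E] [MeasurableSpace E] [BorelSpace E] {μ : Measure E}
    [μ.IsAddHaarMeasure] {S : Set E} {η : E → ℂ} (h : IsTest S η) (v : E) :
    ∫ x, fderiv ℝ η x v ∂μ = 0 := by
  have i1 : Integrable (fun x => (1 : ℂ) * fderiv ℝ η x v) μ := by
    have := (h.fderiv_apply v).integrable (μ := μ)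
    simpa using this
  have i2 : Integrable (fun x => (1 : ℂ) * η x) μ := by
    have := h.integrable (μ := μ)
    simpa using this
  have h1 := integral_mul_fderiv_eq_neg_fderiv_mul_of_integrable (μ := μ)
    (f := fun _ : E => (1 : ℂ))
    (g := η) (v := v) (by simp) i1 i2
    (fun _ _ => differentiableAt_const _) (fun x _ => h.smooth.differentiable (by simp) x)
  simpa using h1

section Slices

variable {f : Space → ℂ}

lemma IsTest.slice_left (hf : IsTest Set.univ f) (y : Plane) :
    IsTest Set.univ fun x : ℝ => f (x, y) := by
  refine ⟨hf.smooth.comp (contDiff_id.prodMk contDiff_const), ?_, Set.subset_univ _⟩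
  refine HasCompactSupport.intro (hf.compact.isCompact.image continuous_fst) fun x hx => ?_
  by_contra h
  exact hx ⟨(x, y), subset_tsupport _ h, rfl⟩

lemma IsTest.slice_right (hf : IsTest Set.univ f) (x : ℝ) :
    IsTest Set.univ fun y : Plane => f (x, y) := by
  refine ⟨hf.smooth.comp (contDiff_const.prodMk contDiff_id), ?_, Set.subset_univ _⟩
  refine HasCompactSupport.intro (hf.compact.isCompact.image continuous_snd) fun y hy => ?_
  by_contra h
  exact hy ⟨(x, y), subset_tsupport _ h, rfl⟩

lemma IsTest.fderiv_slice_left (hf : IsTest Set.univ f) (x : ℝ) (y : Plane) :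
    fderiv ℝ f (x, y) (1, 0) = _root_.deriv (fun t : ℝ => f (t, y)) x := by
  have h1 : HasFDerivAt f (fderiv ℝ f (x, y)) (x, y) :=
    (hf.smooth.differentiable (by simp) _).hasFDerivAt
  have h2 : HasDerivAt (fun t : ℝ => ((t, y) : Space)) (1, 0) x :=
    (hasDerivAt_id x).prodMk (hasDerivAt_const x y)
  exact (h1.comp_hasDerivAt x h2).deriv.symm

lemma IsTest.fderiv_slice_right (hf : IsTest Set.univ f) (x : ℝ) (y w : Plane) :
    fderiv ℝ f (x, y) (0, w) = fderiv ℝ (fun z : Plane => f (x, z)) y w := by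
  have h1 : HasFDerivAt f (fderiv ℝ f (x, y)) (x, y) :=
    (hf.smooth.differentiable (by simp) _).hasFDerivAt
  have h2 : HasFDerivAt (fun z : Plane => ((x, z) : Space))
      ((0 : Plane →L[ℝ] ℝ).prod (ContinuousLinearMap.id ℝ Plane)) y :=
    (hasFDerivAt_const x y).prodMk (hasFDerivAt_id y)
  have h3 : fderiv ℝ (fun z : Plane => f (x, z)) y = _ := (h1.comp y h2).fderiv
  rw [h3]
  rfl

/-- Tangential derivatives integrate to zero over slabs. -/
lemma IsTest.setIntegral_fderiv_tangential (hf : IsTest Set.univ f) (I : Set ℝ) (w : Plane) :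
    ∫ p in {p : Space | p.1 ∈ I}, fderiv ℝ f p (0, w) = 0 := by
  have hint : Integrable (fun p => fderiv ℝ f p (0, w)) ((volume.restrict I).prod volume) := by
    rw [← restrict_fst_mem]
    exact (hf.fderiv_apply _).integrable
  rw [restrict_fst_mem, integral_prod _ hint]
  simp only [hf.fderiv_slice_right, (hf.slice_right _).integral_fderiv, integral_zero]

lemma IsTest.setIntegral_fderiv_normal (hf : IsTest Set.univ f) (L : ℝ) :
    ∫ p in {p : Space | p.1 ∈ Set.Iio L}, fderiv ℝ f p (1, 0) = ∫ y, f (L, y) := by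
  have hint : Integrable (fun p => fderiv ℝ f p (1, 0))
      ((volume.restrict (Set.Iio L)).prod volume) := by
    rw [← restrict_fst_mem]
    exact (hf.fderiv_apply _).integrable
  rw [restrict_fst_mem, integral_prod_symm _ hint]
  congr 1
  funext y
  simp only [hf.fderiv_slice_left]
  rw [← integral_Iic_eq_integral_Iio,
    (hf.slice_left y).compact.integral_Iic_deriv_eq ((hf.slice_left y).smooth.of_le (by simp))]

end Slices

lemma IsTest.mul {E : Type*} [NormedAddCommGroup E] [NormedSpace ℝ E] {S : Set E} {η θ : E → ℂ}
    (h : IsTest S η) (h' : IsTest S θ) : IsTest S fun x => η x * θ x :=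
  h'.smooth_mul h.smooth

lemma IsTest.sub {E : Type*} [NormedAddCommGroup E] [NormedSpace ℝ E] {S : Set E} {η θ : E → ℂ}
    (h : IsTest S η) (h' : IsTest S θ) : IsTest S fun x => η x - θ x := by
  simpa [sub_eq_add_neg] using h.add (h'.const_mul (-1))

/-- `curl φ · ψ - φ · curl ψ` is the divergence of `φ × ψ`. -/
lemma curl_dot_sub {φ ψ : Space → CVec} (hφ : IsTestField Set.univ φ)
    (hψ : IsTestField Set.univ ψ) (p : Space) :
    curl φ p ⬝ᵥ ψ p - φ p ⬝ᵥ curl ψ p =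
      fderiv ℝ (fun q => φ q 1 * ψ q 2 - φ q 2 * ψ q 1) p (dir 0) +
      fderiv ℝ (fun q => φ q 2 * ψ q 0 - φ q 0 * ψ q 2) p (dir 1) +
      fderiv ℝ (fun q => φ q 0 * ψ q 1 - φ q 1 * ψ q 0) p (dir 2) := by
  have d1 : ∀ i, HasFDerivAt (fun q => φ q i) (fderiv ℝ (fun q => φ q i) p) p := fun i =>
    ((isTestField_iff.1 hφ i).smooth.differentiable (by simp) p).hasFDerivAt
  have d2 : ∀ i, HasFDerivAt (fun q => ψ q i) (fderiv ℝ (fun q => ψ q i) p) p := fun i =>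
    ((isTestField_iff.1 hψ i).smooth.differentiable (by simp) p).hasFDerivAt
  have key : ∀ i j i' j', fderiv ℝ (fun q => φ q i * ψ q j - φ q i' * ψ q j') p = _ :=
    fun i j i' j' => (((d1 i).mul (d2 j)).sub ((d1 i').mul (d2 j'))).fderiv
  rw [key, key, key]
  simp only [curl, dotProduct, Fin.sum_univ_three, hφ.pderiv_eq, hψ.pderiv_eq, Matrix.cons_val]
  simp
  ring

lemma dir_zero : dir 0 = (1, 0) := rfl

lemma dir_one : dir 1 = (0, EuclideanSpace.single 0 1) := rfl

lemma dir_two : dir 2 = (0, EuclideanSpace.single 1 1) := rfl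

lemma integrable_dot {φ ψ : Space → CVec} (hφ : IsTestField Set.univ φ)
    (hψ : IsTestField Set.univ ψ) {μ : Measure Space} [IsFiniteMeasureOnCompacts μ] :
    Integrable (fun p => φ p ⬝ᵥ ψ p) μ := by
  simp only [dotProduct]
  exact integrable_finsetSum _ fun i _ =>
    ((isTestField_iff.1 hφ i).mul (isTestField_iff.1 hψ i)).integrable

/-- Green's formula for the curl in a half space. -/
lemma integral_curl_dot_halfSpace {φ ψ : Space → CVec} (hφ : IsTestField Set.univ φ)
    (hψ : IsTestField Set.univ ψ) (L : ℝ) :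
    (∫ p in Ω₁ L, curl φ p ⬝ᵥ ψ p) - ∫ p in Ω₁ L, φ p ⬝ᵥ curl ψ p =
      ∫ y, (φ (L, y) 1 * ψ (L, y) 2 - φ (L, y) 2 * ψ (L, y) 1) := by
  have t : ∀ i j i' j', IsTest Set.univ fun q => φ q i * ψ q j - φ q i' * ψ q j' :=
    fun i j i' j' => ((isTestField_iff.1 hφ i).mul (isTestField_iff.1 hψ j)).sub
      ((isTestField_iff.1 hφ i').mul (isTestField_iff.1 hψ j'))
  rw [← integral_sub (integrable_dot hφ.curl hψ) (integrable_dot hφ hψ.curl)]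
  simp only [curl_dot_sub hφ hψ]
  have hI : ∀ i j i' j' m, Integrable
      (fun p => fderiv ℝ (fun q => φ q i * ψ q j - φ q i' * ψ q j') p (dir m))
      (volume.restrict (Ω₁ L)) := fun i j i' j' m => ((t i j i' j').fderiv_apply _).integrable
  have hI2 : Integrable (fun p => fderiv ℝ (fun q => φ q 1 * ψ q 2 - φ q 2 * ψ q 1) p (dir 0) +
      fderiv ℝ (fun q => φ q 2 * ψ q 0 - φ q 0 * ψ q 2) p (dir 1)) (volume.restrict (Ω₁ L)) :=
    (hI _ _ _ _ _).add (hI _ _ _ _ _)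
  rw [integral_add hI2 (hI _ _ _ _ _),
    integral_add (hI _ _ _ _ _) (hI _ _ _ _ _), dir_zero, dir_one, dir_two]
  have h1 := (t 2 0 0 2).setIntegral_fderiv_tangential (Set.Iio L) (EuclideanSpace.single 0 1)
  have h2 := (t 0 1 1 0).setIntegral_fderiv_tangential (Set.Iio L) (EuclideanSpace.single 1 1)
  have h3 := (t 1 2 2 1).setIntegral_fderiv_normal L
  change (∫ p in Ω₁ L, _) = _ at h1
  change (∫ p in Ω₁ L, _) = _ at h2
  change (∫ p in Ω₁ L, _) = _ at h3
  rw [h1, h2, h3, add_zero, add_zero]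

instance : (volume : Measure Space).IsAddHaarMeasure := by
  rw [Measure.volume_eq_prod]
  infer_instance

lemma integral_curl_dot {φ ψ : Space → CVec} (hφ : IsTestField Set.univ φ)
    (hψ : IsTestField Set.univ ψ) : ∫ p, curl φ p ⬝ᵥ ψ p = ∫ p, φ p ⬝ᵥ curl ψ p := by
  have t : ∀ i j i' j', IsTest Set.univ fun q => φ q i * ψ q j - φ q i' * ψ q j' :=
    fun i j i' j' => ((isTestField_iff.1 hφ i).mul (isTestField_iff.1 hψ j)).sub
      ((isTestField_iff.1 hφ i').mul (isTestField_iff.1 hψ j'))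
  have hI : ∀ i j i' j' m, Integrable
      (fun p => fderiv ℝ (fun q => φ q i * ψ q j - φ q i' * ψ q j') p (dir m)) :=
    fun i j i' j' m => ((t i j i' j').fderiv_apply _).integrable
  rw [← sub_eq_zero, ← integral_sub (integrable_dot hφ.curl hψ) (integrable_dot hφ hψ.curl)]
  simp only [curl_dot_sub hφ hψ]
  have hI2 : Integrable (fun p => fderiv ℝ (fun q => φ q 1 * ψ q 2 - φ q 2 * ψ q 1) p (dir 0) +
      fderiv ℝ (fun q => φ q 2 * ψ q 0 - φ q 0 * ψ q 2) p (dir 1)) :=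
    (hI _ _ _ _ _).add (hI _ _ _ _ _)
  rw [integral_add hI2 (hI _ _ _ _ _),
    integral_add (hI _ _ _ _ _) (hI _ _ _ _ _), (t _ _ _ _).integral_fderiv,
    (t _ _ _ _).integral_fderiv, (t _ _ _ _).integral_fderiv]
  simp

lemma IsTestField.star {φ : Space → CVec} {S : Set Space} (hφ : IsTestField S φ) :
    IsTestField S (fun p => star (φ p)) ∧ ∀ p, MaxwellSchwarz.curl (fun p => star (φ p)) p =
      star (MaxwellSchwarz.curl φ p) := by
  have h : IsTestField S (fun p => Star.star (φ p)) := by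
    refine isTestField_iff.2 fun i => ?_
    have hi := isTestField_iff.1 hφ i
    exact ⟨Complex.conjCLE.contDiff.comp hi.smooth,
      hi.compact.comp_left (g := fun z : ℂ => (starRingEnd ℂ) z) (by simp),
      (tsupport_comp_subset (g := fun z : ℂ => (starRingEnd ℂ) z) (by simp) _).trans hi.subset⟩
  refine ⟨h, fun p => ?_⟩
  have key : ∀ j i, pderiv (fun p => Star.star (φ p)) j i p = (starRingEnd ℂ) (pderiv φ j i p) := by
    intro j i
    rw [h.pderiv_eq, hφ.pderiv_eq]
    have hd : HasFDerivAt (fun q => φ q i) (fderiv ℝ (fun q => φ q i) p) p :=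
      ((isTestField_iff.1 hφ i).smooth.differentiable (by simp) p).hasFDerivAt
    have : HasFDerivAt (fun q => (starRingEnd ℂ) (φ q i)) _ p :=
      (Complex.conjCLE.toContinuousLinearMap.hasFDerivAt (x := φ p i)).comp p hd
    change fderiv ℝ (fun q => (starRingEnd ℂ) (φ q i)) p (dir j) = _
    rw [this.fderiv]
    rfl
  funext i
  fin_cases i <;> simp [MaxwellSchwarz.curl, key]

lemma IsTestField.integrable_dot_memLp {S : Set Space} {φ : Space → CVec} (hφ : IsTestField S φ)
    {μ : Measure Space} [IsFiniteMeasureOnCompacts μ] {F : Space → CVec} (hF : MemLp F 2 μ) :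
    Integrable (fun p => F p ⬝ᵥ φ p) μ := by
  simp only [dotProduct]
  refine integrable_finsetSum _ fun i _ => ?_
  have h1 : MemLp (fun p => F p i) 2 μ := memLp_pi_iff.1 hF i
  have h2 : MemLp (fun p => φ p i) 2 μ := 
    (isTestField_iff.1 hφ i).continuous.memLp_of_hasCompactSupport (isTestField_iff.1 hφ i).compact
  exact h1.integrable_mul h2

/-- The weak form with the test fields supported in `S` is the system in the sense of
distributions. -/
lemma hasWeakCurl_of_weak {P : Params} {S : Set Space} {E H f g : Space → CVec}
    (hE : MemLp E 2 (volume.restrict S)) (hH : MemLp H 2 (volume.restrict S))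
    (hf : MemLp f 2 (volume.restrict S)) (hg : MemLp g 2 (volume.restrict S))
    (h : ∀ φ₁ φ₂ : Space → CVec, IsTestField S φ₁ → IsTestField S φ₂ →
      (∫ p in S, E p ⬝ᵥ (curl φ₂ p - P.adm • φ₁ p)) +
        (∫ p in S, H p ⬝ᵥ (curl φ₁ p + P.imp • φ₂ p)) =
        (∫ p in S, f p ⬝ᵥ φ₁ p) + ∫ p in S, g p ⬝ᵥ φ₂ p) :
    HasWeakCurl S H (fun p => f p + P.adm • E p) ∧
      HasWeakCurl S E (fun p => g p - P.imp • H p) := by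
  have z : IsTestField S (fun _ => (0 : CVec)) := by
    refine ⟨contDiff_const, HasCompactSupport.zero, ?_⟩
    simp [tsupport, Function.support]
  have cz : ∀ p, curl (fun _ => (0 : CVec)) p = 0 := by
    intro p
    funext i
    fin_cases i <;> simp [curl, pderiv]
  constructor <;> intro φ hφ
  · have h1 := h φ _ hφ z
    simp only [cz, zero_sub, smul_zero, add_zero, dotProduct_zero, integral_zero, dotProduct_neg,
      dotProduct_smul, integral_neg] at h1
    rw [← sub_eq_zero]
    simp only [add_dotProduct, smul_dotProduct]
    have i1 : Integrable (fun p => P.adm • (E p ⬝ᵥ φ p)) (volume.restrict S) :=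
      (hφ.integrable_dot_memLp hE).smul P.adm
    rw [integral_add (hφ.integrable_dot_memLp hf) i1]
    linear_combination h1
  · have h1 := h _ φ z hφ
    simp only [cz, zero_add, smul_zero, sub_zero, dotProduct_zero, integral_zero,
      dotProduct_smul] at h1
    rw [← sub_eq_zero]
    simp only [sub_dotProduct, smul_dotProduct]
    have i1 : Integrable (fun p => P.imp • (H p ⬝ᵥ φ p)) (volume.restrict S) :=
      (hφ.integrable_dot_memLp hH).smul P.imp
    rw [integral_sub (hφ.integrable_dot_memLp hg) i1]
    linear_combination h1

lemma isWeakMaxwell_iff {P : Params} {S : Set Space} {J : Space → CVec} {U : Space → EH} :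
    IsWeakMaxwell P S J U ↔
      HasWeakCurl S (fun p => (U p).2) (fun p => J p + P.adm • (U p).1) ∧
      HasWeakCurl S (fun p => (U p).1) (fun p => 0 - P.imp • (U p).2) := by
  simp only [IsWeakMaxwell, Params.adm, Params.imp, add_smul, add_assoc, zero_sub]

lemma memLp_prod_iff_fst_snd {α : Type*} [MeasurableSpace α] {ν : Measure α} {U : α → EH} :
    MemLp U 2 ν ↔ MemLp (fun p => (U p).1) 2 ν ∧ MemLp (fun p => (U p).2) 2 ν := by
  refine ⟨fun h => ⟨(ContinuousLinearMap.fst ℂ CVec CVec).comp_memLp' h,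
    (ContinuousLinearMap.snd ℂ CVec CVec).comp_memLp' h⟩, fun ⟨h1, h2⟩ => ?_⟩
  refine (h1.norm.add h2.norm).mono (h1.1.prodMk h2.1) (.of_forall fun p => ?_)
  rw [Prod.norm_def]
  exact (max_le_add_of_nonneg (norm_nonneg _) (norm_nonneg _)).trans (le_abs_self _)

/-- The whole space problem has a square integrable solution. -/
theorem exists_wholeSpace {P : Params} (hP : P.Pos) {J : Space → CVec} (hJ : MemLp J 2 volume) :
    ∃ U : Space → EH, MemLp U 2 volume ∧ IsWeakMaxwell P Set.univ J U := by
  obtain ⟨E, H, hE, hH, h⟩ := exists_weak_solution hP Set.univ ⊤ (fun v _ => by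
      refine ⟨0, le_rfl, ?_⟩
      obtain ⟨s1, s2⟩ := v.2.2.star
      rw [Measure.restrict_univ, Complex.ofReal_zero, sub_eq_zero]
      have := integral_curl_dot v.1.2 s1
      simp only [s2] at this
      simpa [dotProduct_comm] using this)
    (f := J) (g := 0) (by simpa using hJ) MemLp.zero'
  rw [Measure.restrict_univ] at hE hH
  refine ⟨fun p => (E p, H p), memLp_prod_iff_fst_snd.2 ⟨hE, hH⟩, isWeakMaxwell_iff.2 ?_⟩
  refine hasWeakCurl_of_weak (by simpa using hE) (by simpa using hH) (by simpa using hJ)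
    MemLp.zero' fun φ₁ φ₂ h₁ h₂ => ?_
  exact h (⟨φ₁, h₁⟩, ⟨φ₂, h₂⟩) trivial

/-! ### Test fields with separated variables -/

lemma IsTest.tensor {I : Set ℝ} {η : ℝ → ℂ} {ψ : Plane → ℂ} (hη : IsTest I η)
    (hψ : IsTest Set.univ ψ) : IsTest {p : Space | p.1 ∈ I} fun p => η p.1 * ψ p.2 := by
  have hz : ∀ p : Space, p ∉ tsupport η ×ˢ tsupport ψ → η p.1 * ψ p.2 = 0 := by
    intro p hp
    by_contra h
    exact hp ⟨subset_tsupport _ (left_ne_zero_of_mul h), subset_tsupport _ (right_ne_zero_of_mul h)⟩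
  have hK : IsCompact (tsupport η ×ˢ tsupport ψ) := hη.compact.isCompact.prod hψ.compact.isCompact
  refine ⟨(hη.smooth.comp contDiff_fst).mul (hψ.smooth.comp contDiff_snd),
    HasCompactSupport.intro hK hz, ?_⟩
  have h : tsupport (fun p : Space => η p.1 * ψ p.2) ⊆ tsupport η ×ˢ tsupport ψ :=
    closure_minimal (fun p hp => by_contra fun h => hp (hz p h)) hK.isClosed
  exact h.trans fun p hp => hη.subset hp.1

/-- The tangential gradient of a function on the plane, as a vector with vanishing first
component. -/
def gradT (ψ : Plane → ℂ) (y : Plane) : CVec :=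
  ![0, fderiv ℝ ψ y (EuclideanSpace.single 0 1), fderiv ℝ ψ y (EuclideanSpace.single 1 1)]

lemma isTestField_tensor {I : Set ℝ} {η : ℝ → ℂ} {ψ : Plane → ℂ} (hη : IsTest I η)
    (hψ : IsTest Set.univ ψ) (v : CVec) :
    IsTestField {p : Space | p.1 ∈ I} fun p => (η p.1 * ψ p.2) • v := by
  refine isTestField_iff.2 fun i => ?_
  simpa [mul_comm] using (hη.tensor hψ).const_mul (v i)

lemma curl_tensor {I : Set ℝ} {η : ℝ → ℂ} {ψ : Plane → ℂ} (hη : IsTest I η)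
    (hψ : IsTest Set.univ ψ) (v : CVec) (p : Space) :
    curl (fun p : Space => (η p.1 * ψ p.2) • v) p =
      (deriv η p.1 * ψ p.2) • (ex ⨯₃ v) + η p.1 • (gradT ψ p.2 ⨯₃ v) := by
  have key : ∀ j i, pderiv (fun p : Space => (η p.1 * ψ p.2) • v) j i p =
      (deriv η p.1 * ψ p.2) * ex j * v i + η p.1 * gradT ψ p.2 j * v i := by
    intro j i
    rw [(isTestField_tensor hη hψ v).pderiv_eq]
    have h1 : HasFDerivAt (fun q : Space => η q.1) _ p :=
      (hη.hasDerivAt p.1).hasFDerivAt.comp p hasFDerivAt_fst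
    have h2 : HasFDerivAt (fun q : Space => ψ q.2) _ p :=
      (hψ.smooth.differentiable (by simp) p.2).hasFDerivAt.comp p hasFDerivAt_snd
    have h3 : HasFDerivAt (fun q : Space => ((η q.1 * ψ q.2) • v) i) _ p :=
      (h1.mul h2).mul_const (v i)
    rw [h3.fderiv]
    fin_cases j <;> simp [dir, ex, gradT] <;> ring
  funext i
  fin_cases i <;> simp [curl, key, crossProduct, ex, gradT] <;> ring

/-! ### Averages over thin slabs -/

lemma restrict_slab (a b : ℝ) :
    (volume : Measure Space).restrict (slab a b) = (volume.restrict (Set.Ioo a b)).prod volume :=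
  restrict_fst_mem (Set.Ioo a b)

lemma measurableSet_slab (a b : ℝ) : MeasurableSet (slab a b) :=
  measurable_fst (measurableSet_Ioo (a := a) (b := b))

lemma setIntegral_slab {a b : ℝ} {f : Space → ℂ} (hf : IntegrableOn f (slab a b)) :
    ∫ p in slab a b, f p = ∫ x in Set.Ioo a b, ∫ y, f (x, y) := by
  rw [IntegrableOn, restrict_slab] at hf
  rw [restrict_slab, integral_prod _ hf]

lemma integrableOn_mul_test {f : Space → ℂ} {η : ℝ → ℂ} {I : Set ℝ} {S : Set Space}
    (hf : IntegrableOn f S) (hη : IsTest I η) : IntegrableOn (fun p => f p * η p.1) S := by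
  obtain ⟨c, hc⟩ := hη.continuous.bounded_above_of_compact_support hη.compact
  exact hf.mul_bdd (c := c) (hη.continuous.comp continuous_fst).aestronglyMeasurable
    (.of_forall fun p => hc _)

/-- A function on a slab around the plane `x = a` with a weak derivative in `x`, at least after
integration over the plane, has the same averages over thin slabs on the two sides of the plane,
in the limit. -/
lemma tendsto_slab_average {a δ : ℝ} (hδ : 0 < δ) {f g : Space → ℂ}
    (hf : IntegrableOn f (slab (a - δ) (a + δ))) (hg : IntegrableOn g (slab (a - δ) (a + δ)))
    (h : ∀ η : ℝ → ℂ, IsTest (Set.Ioo (a - δ) (a + δ)) η →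
      ∫ p in slab (a - δ) (a + δ), f p * deriv η p.1 =
        -∫ p in slab (a - δ) (a + δ), g p * η p.1) :
    ∃ C : ℂ, Tendsto (fun t : ℝ => t⁻¹ • ∫ p in slab (a - t) a, f p) (𝓝[>] 0) (𝓝 C) ∧
      Tendsto (fun t : ℝ => t⁻¹ • ∫ p in slab a (a + t), f p) (𝓝[>] 0) (𝓝 C) := by
  have hf' := hf
  have hg' := hg
  rw [IntegrableOn, restrict_slab] at hf' hg'
  obtain ⟨C, hC1, hC2⟩ := HasWeakDeriv.tendsto_average (a := a) hδ
    (q := fun x => ∫ y, f (x, y)) (g := fun x => ∫ y, g (x, y))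
    hf'.integral_prod_left hg'.integral_prod_left (by
      intro η hη
      have h1 := h η hη
      rw [setIntegral_slab (integrableOn_mul_test hf hη.deriv),
        setIntegral_slab (integrableOn_mul_test hg hη)] at h1
      simpa only [integral_mul_const] using h1)
  have hsmall : ∀ᶠ t : ℝ in 𝓝[>] 0, 0 < t ∧ t < δ := Ioo_mem_nhdsGT hδ
  refine ⟨C, hC1.congr' ?_, hC2.congr' ?_⟩
  · filter_upwards [hsmall] with t ht
    rw [setIntegral_slab (hf.mono_set fun p hp => ⟨by linarith [hp.1, ht.2], by linarith [hp.2]⟩)]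
  · filter_upwards [hsmall] with t ht
    rw [setIntegral_slab (hf.mono_set fun p hp => ⟨by linarith [hp.1], by linarith [hp.2, ht.2]⟩)]

/-- The difference of the averages of `ψ u` and `ψ v` over the slabs of thickness `t` on the two
sides of the plane `x = a`. -/
def slabGap (a : ℝ) (ψ : Plane → ℂ) (u v : Space → ℂ) (t : ℝ) : ℂ :=
  t⁻¹ • (∫ p in slab (a - t) a, ψ p.2 * u p) - t⁻¹ • ∫ p in slab a (a + t), ψ p.2 * v p

lemma IsTest.memLp_slab {ψ : Plane → ℂ} (hψ : IsTest Set.univ ψ) (a b : ℝ) :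
    MemLp (fun p : Space => ψ p.2) 2 (volume.restrict (slab a b)) := by
  rw [restrict_slab]
  exact (hψ.continuous.memLp_of_hasCompactSupport hψ.compact).comp_snd _

lemma IsTest.integrable_slab {ψ : Plane → ℂ} (hψ : IsTest Set.univ ψ) {a b : ℝ} {u : Space → ℂ}
    {S : Set Space} (hu : MemLp u 2 (volume.restrict S)) (hS : slab a b ⊆ S) :
    Integrable (fun p => ψ p.2 * u p) (volume.restrict (slab a b)) :=
  (hψ.memLp_slab a b).integrable_mul (hu.mono_measure (Measure.restrict_mono hS le_rfl))

lemma memLp_impedance {P : Params} {n : CVec} {U : Space → EH} {ν : Measure Space}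
    (hU : MemLp U 2 ν) (i : Fin 3) : MemLp (fun p => impedance P n (U p) i) 2 ν :=
  memLp_pi_iff.1 ((impedance P n).toContinuousLinearMap.comp_memLp' hU) i

lemma tracesAgree_iff {P : Params} {n : CVec} {a : ℝ} {U V : Space → EH} {S T : Set Space}
    (hU : MemLp U 2 (volume.restrict S)) (hS : {p | p.1 < a} ⊆ S)
    (hV : MemLp V 2 (volume.restrict T)) (hT : {p | a < p.1} ⊆ T) :
    TracesAgree P n a U V ↔ ∀ (i : Fin 3) (ψ : Plane → ℂ), IsTest Set.univ ψ →
      Tendsto (slabGap a ψ (fun p => impedance P n (U p) i) fun p => impedance P n (V p) i)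
        (𝓝[>] 0) (𝓝 0) := by
  have key : ∀ (ψ : Plane → ℂ), IsTest Set.univ ψ → ∀ (h : ℝ) (i : Fin 3),
      (h⁻¹ • (∫ p in slab (a - h) a, ψ p.2 • impedance P n (U p))
        - h⁻¹ • (∫ p in slab a (a + h), ψ p.2 • impedance P n (V p))) i =
      slabGap a ψ (fun p => impedance P n (U p) i) (fun p => impedance P n (V p) i) h := by
    intro ψ hψ h i
    simp only [Pi.sub_apply, Pi.smul_apply, slabGap]
    rw [eval_integral, eval_integral]
    · rfl
    · exact fun j => hψ.integrable_slab (memLp_impedance hV j) fun p hp => hT hp.1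
    · exact fun j => hψ.integrable_slab (memLp_impedance hU j) fun p hp => hS hp.2
  refine ⟨fun h i ψ hψ => ?_, fun h ψ hψ1 hψ2 => ?_⟩
  · exact (tendsto_pi_nhds.1 (h ψ hψ.smooth hψ.compact) i).congr fun t => key ψ hψ t i
  · have hψ : IsTest Set.univ ψ := ⟨hψ1, hψ2, Set.subset_univ _⟩
    refine tendsto_pi_nhds.2 fun i => ?_
    exact (h i ψ hψ).congr fun t => (key ψ hψ t i).symm

lemma HasWeakCurl.mono {S T : Set Space} {F G : Space → CVec} (h : HasWeakCurl S F G)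
    (hTS : T ⊆ S) : HasWeakCurl T F G := by
  intro φ hφ
  have restrict : ∀ {A φ : Space → CVec} {R : Set Space}, IsTestField R φ →
      ∫ p in R, A p ⬝ᵥ φ p = ∫ p, A p ⬝ᵥ φ p := by
    intro A φ R hφ
    refine setIntegral_eq_integral_of_forall_compl_eq_zero fun p hp => ?_
    rw [image_eq_zero_of_notMem_tsupport fun h' => hp (hφ.2.2 h'), dotProduct_zero]
  rw [restrict hφ.curl, restrict hφ, ← restrict (hφ.mono hTS).curl, ← restrict (hφ.mono hTS)]
  exact h φ (hφ.mono hTS)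

lemma memLp_dot_const {F : Space → CVec} {ν : Measure Space} (hF : MemLp F 2 ν) (v : CVec) :
    MemLp (fun p => F p ⬝ᵥ v) 2 ν := by
  simp only [dotProduct]
  exact memLp_finsetSum _ fun i _ => (memLp_pi_iff.1 hF i).mul_const (v i)

lemma isTest_gradT {ψ : Plane → ℂ} (hψ : IsTest Set.univ ψ) (i : Fin 3) :
    IsTest Set.univ fun y => gradT ψ y i := by
  fin_cases i
  · simpa [gradT] using hψ.const_mul 0
  · exact hψ.fderiv_apply _
  · exact hψ.fderiv_apply _

lemma isTest_gradT_cross {ψ : Plane → ℂ} (hψ : IsTest Set.univ ψ) (v : CVec) (i : Fin 3) :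
    IsTest Set.univ fun y => (gradT ψ y ⨯₃ v) i := by
  have key : ∀ j l m n, IsTest Set.univ fun y => gradT ψ y j * v l - gradT ψ y m * v n := by
    intro j l m n
    have := ((isTest_gradT hψ j).const_mul (v l)).sub ((isTest_gradT hψ m).const_mul (v n))
    simpa only [mul_comm] using this
  fin_cases i
  · simpa [crossProduct] using key 1 2 2 1
  · simpa [crossProduct] using key 2 0 0 2
  · simpa [crossProduct] using key 0 1 1 0

lemma integrable_dot_gradT_cross {ψ : Plane → ℂ} (hψ : IsTest Set.univ ψ) {a b : ℝ}
    {F : Space → CVec} (hF : MemLp F 2 (volume.restrict (slab a b))) (v : CVec) :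
    Integrable (fun p => F p ⬝ᵥ (gradT ψ p.2 ⨯₃ v)) (volume.restrict (slab a b)) := by
  simp only [dotProduct]
  exact integrable_finsetSum _ fun i _ =>
    (memLp_pi_iff.1 hF i).integrable_mul ((isTest_gradT_cross hψ v i).memLp_slab a b)

/-- Tangential components of fields with square integrable curls have the same averages over thin
slabs on the two sides of a plane, in the limit. The hypothesis is the weak form of the equations
`curl H = f`, `curl E = g`, for a single polarization `(v₁, v₂)` of the test fields. -/
lemma tendsto_slab_average_tangential {a δ : ℝ} (hδ : 0 < δ) {E H f g : Space → CVec}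
    (hE : MemLp E 2 (volume.restrict (slab (a - δ) (a + δ))))
    (hH : MemLp H 2 (volume.restrict (slab (a - δ) (a + δ))))
    (hf : MemLp f 2 (volume.restrict (slab (a - δ) (a + δ))))
    (hg : MemLp g 2 (volume.restrict (slab (a - δ) (a + δ))))
    {ψ : Plane → ℂ} (hψ : IsTest Set.univ ψ) (v₁ v₂ : CVec)
    (h : ∀ η : ℝ → ℂ, IsTest (Set.Ioo (a - δ) (a + δ)) η →
      ∫ p in slab (a - δ) (a + δ), (E p ⬝ᵥ curl (fun p => (η p.1 * ψ p.2) • v₂) p +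
        H p ⬝ᵥ curl (fun p => (η p.1 * ψ p.2) • v₁) p) =
      ∫ p in slab (a - δ) (a + δ), (f p ⬝ᵥ ((η p.1 * ψ p.2) • v₁) +
        g p ⬝ᵥ ((η p.1 * ψ p.2) • v₂))) :
    ∃ C : ℂ, Tendsto (fun t : ℝ => t⁻¹ • ∫ p in slab (a - t) a,
        ψ p.2 * (E p ⬝ᵥ (ex ⨯₃ v₂) + H p ⬝ᵥ (ex ⨯₃ v₁))) (𝓝[>] 0) (𝓝 C) ∧
      Tendsto (fun t : ℝ => t⁻¹ • ∫ p in slab a (a + t),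
        ψ p.2 * (E p ⬝ᵥ (ex ⨯₃ v₂) + H p ⬝ᵥ (ex ⨯₃ v₁))) (𝓝[>] 0) (𝓝 C) := by
  have hu : MemLp (fun p => E p ⬝ᵥ (ex ⨯₃ v₂) + H p ⬝ᵥ (ex ⨯₃ v₁)) 2
      (volume.restrict (slab (a - δ) (a + δ))) :=
    (memLp_dot_const hE _).add (memLp_dot_const hH _)
  have hs : MemLp (fun p => f p ⬝ᵥ v₁ + g p ⬝ᵥ v₂) 2 (volume.restrict (slab (a - δ) (a + δ))) :=
    (memLp_dot_const hf _).add (memLp_dot_const hg _)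
  have i1 := hψ.integrable_slab hu subset_rfl
  have i2 : Integrable (fun p => (E p ⬝ᵥ (gradT ψ p.2 ⨯₃ v₂) + H p ⬝ᵥ (gradT ψ p.2 ⨯₃ v₁)) -
      ψ p.2 * (f p ⬝ᵥ v₁ + g p ⬝ᵥ v₂)) (volume.restrict (slab (a - δ) (a + δ))) :=
    ((integrable_dot_gradT_cross hψ hE v₂).add (integrable_dot_gradT_cross hψ hH v₁)).sub
      (hψ.integrable_slab hs subset_rfl)
  refine tendsto_slab_average hδ i1 i2 fun η hη => ?_
  have h1 := h η hη
  simp only [curl_tensor hη hψ] at h1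
  have h2 := integral_add (integrableOn_mul_test i1 hη.deriv) (integrableOn_mul_test i2 hη)
  have h3 : ∫ p in slab (a - δ) (a + δ), (ψ p.2 * (f p ⬝ᵥ v₁ + g p ⬝ᵥ v₂)) * η p.1 =
      ∫ p in slab (a - δ) (a + δ), (f p ⬝ᵥ ((η p.1 * ψ p.2) • v₁) +
        g p ⬝ᵥ ((η p.1 * ψ p.2) • v₂)) := by
    congr 1
    funext p
    simp only [dotProduct_smul, smul_eq_mul]
    ring
  rw [← h1] at h3
  rw [eq_neg_iff_add_eq_zero, ← h2, ← sub_eq_zero.2 h3.symm, ← integral_sub]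
  · congr 1
    funext p
    simp only [dotProduct_smul, dotProduct_add, smul_eq_mul]
    ring
  · have e : (fun p : Space => E p ⬝ᵥ ((deriv η p.1 * ψ p.2) • (ex ⨯₃ v₂) +
        η p.1 • (gradT ψ p.2 ⨯₃ v₂)) + H p ⬝ᵥ ((deriv η p.1 * ψ p.2) • (ex ⨯₃ v₁) +
        η p.1 • (gradT ψ p.2 ⨯₃ v₁))) = fun p =>
        ψ p.2 * (E p ⬝ᵥ (ex ⨯₃ v₂) + H p ⬝ᵥ (ex ⨯₃ v₁)) * deriv η p.1 +
        (E p ⬝ᵥ (gradT ψ p.2 ⨯₃ v₂) + H p ⬝ᵥ (gradT ψ p.2 ⨯₃ v₁)) * η p.1 := by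
      funext p
      simp only [dotProduct_smul, dotProduct_add, smul_eq_mul]
      ring
    rw [e]
    exact (integrableOn_mul_test i1 hη.deriv).add
      (integrableOn_mul_test ((integrable_dot_gradT_cross hψ hE v₂).add
      (integrable_dot_gradT_cross hψ hH v₁)) hη)
  · exact integrableOn_mul_test (hψ.integrable_slab hs subset_rfl) hη

/-- The components of the impedance traces are tested with polarizations `(v₁, v₂)`. For the normal
`ex`, these satisfy the adjoint impedance condition. -/
lemma exists_polarization (P : Params) (hZ : (P.Z : ℂ) ≠ 0) (i : Fin 3) :
    (∃ v₁ v₂ : CVec, (P.Z * v₂ 2 = v₁ 1 ∧ P.Z * v₂ 1 = -v₁ 2) ∧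
      ∀ u, impedance P ex u i = u.1 ⬝ᵥ (ex ⨯₃ v₂) + u.2 ⬝ᵥ (ex ⨯₃ v₁)) ∧
    ∃ v₁ v₂ : CVec, ∀ u, impedance P (-ex) u i = u.1 ⬝ᵥ (ex ⨯₃ v₂) + u.2 ⬝ᵥ (ex ⨯₃ v₁) := by
  simp only [impedance_ex, impedance_neg_ex]
  fin_cases i
  · exact ⟨⟨0, 0, by simp, by simp⟩, 0, 0, by simp⟩
  · refine ⟨⟨![0, 0, 1], ![0, -(P.Z : ℂ)⁻¹, 0], by simp [hZ], fun u => ?_⟩,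
      ![0, 0, 1], ![0, (P.Z : ℂ)⁻¹, 0], fun u => ?_⟩ <;>
      simp [crossProduct, ex, dotProduct, Fin.sum_univ_three] <;> ring
  · refine ⟨⟨![0, -1, 0], ![0, 0, -(P.Z : ℂ)⁻¹], by simp [hZ], fun u => ?_⟩,
      ![0, -1, 0], ![0, 0, (P.Z : ℂ)⁻¹], fun u => ?_⟩ <;>
      simp [crossProduct, ex, dotProduct, Fin.sum_univ_three] <;> ring

lemma IsTestField.integrable_dot_left {S : Set Space} {φ F : Space → CVec} {R : Set Space}
    (hφ : IsTestField R φ) (hF : MemLp F 2 (volume.restrict S)) :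
    Integrable (fun p => F p ⬝ᵥ φ p) (volume.restrict S) :=
  hφ.integrable_dot_memLp hF

lemma HasWeakCurl.tendsto_slab_average {a δ : ℝ} (hδ : 0 < δ) {E H f g : Space → CVec}
    (hE : MemLp E 2 (volume.restrict (slab (a - δ) (a + δ))))
    (hH : MemLp H 2 (volume.restrict (slab (a - δ) (a + δ))))
    (hf : MemLp f 2 (volume.restrict (slab (a - δ) (a + δ))))
    (hg : MemLp g 2 (volume.restrict (slab (a - δ) (a + δ))))
    (h1 : HasWeakCurl (slab (a - δ) (a + δ)) H f) (h2 : HasWeakCurl (slab (a - δ) (a + δ)) E g)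
    {ψ : Plane → ℂ} (hψ : IsTest Set.univ ψ) (v₁ v₂ : CVec) :
    ∃ C : ℂ, Tendsto (fun t : ℝ => t⁻¹ • ∫ p in slab (a - t) a,
        ψ p.2 * (E p ⬝ᵥ (ex ⨯₃ v₂) + H p ⬝ᵥ (ex ⨯₃ v₁))) (𝓝[>] 0) (𝓝 C) ∧
      Tendsto (fun t : ℝ => t⁻¹ • ∫ p in slab a (a + t),
        ψ p.2 * (E p ⬝ᵥ (ex ⨯₃ v₂) + H p ⬝ᵥ (ex ⨯₃ v₁))) (𝓝[>] 0) (𝓝 C) := by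
  refine tendsto_slab_average_tangential hδ hE hH hf hg hψ v₁ v₂ fun η hη => ?_
  have t1 := isTestField_tensor hη hψ v₁
  have t2 := isTestField_tensor hη hψ v₂
  rw [integral_add (t2.curl.integrable_dot_left hE) (t1.curl.integrable_dot_left hH),
    integral_add (t1.integrable_dot_left hf) (t2.integrable_dot_left hg), add_comm]
  exact congrArg₂ _ (h1 _ t1) (h2 _ t2)

/-- The traces of a square integrable solution of the Maxwell system agree from the two sides of a
plane in the interior of the domain. -/
lemma IsWeakMaxwell.tracesAgree_self {P : Params} (hP : P.Pos) {J : Space → CVec}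
    (hJ : MemLp J 2 volume) {U : Space → EH} (hU : MemLp U 2 volume)
    (h : IsWeakMaxwell P Set.univ J U) (a : ℝ) :
    TracesAgree P ex a U U ∧ TracesAgree P (-ex) a U U := by
  have hUu : MemLp U 2 (volume.restrict Set.univ) := by simpa using hU
  have key : ∀ {ψ : Plane → ℂ}, IsTest Set.univ ψ → ∀ v₁ v₂ : CVec,
      Tendsto (fun t : ℝ =>
        t⁻¹ • (∫ p in slab (a - t) a, ψ p.2 * ((U p).1 ⬝ᵥ (ex ⨯₃ v₂) + (U p).2 ⬝ᵥ (ex ⨯₃ v₁))) -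
        t⁻¹ • ∫ p in slab a (a + t), ψ p.2 * ((U p).1 ⬝ᵥ (ex ⨯₃ v₂) + (U p).2 ⬝ᵥ (ex ⨯₃ v₁)))
        (𝓝[>] 0) (𝓝 0) := by
    intro ψ hψ v₁ v₂
    obtain ⟨hE, hH⟩ := memLp_prod_iff_fst_snd.1 hU
    obtain ⟨h1, h2⟩ := isWeakMaxwell_iff.1 h
    have hf : MemLp (fun p => J p + P.adm • (U p).1) 2 volume := hJ.add (hE.const_smul P.adm)
    have hg : MemLp (fun p => 0 - P.imp • (U p).2) 2 volume := by
      simp only [zero_sub]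
      exact (hH.const_smul P.imp).neg
    have e1 := hE.restrict (slab (a - 1) (a + 1))
    have e2 := hH.restrict (slab (a - 1) (a + 1))
    have e3 := hf.restrict (slab (a - 1) (a + 1))
    have e4 := hg.restrict (slab (a - 1) (a + 1))
    have e5 := h1.mono (Set.subset_univ (slab (a - 1) (a + 1)))
    have e6 := h2.mono (Set.subset_univ (slab (a - 1) (a + 1)))
    obtain ⟨C, c1, c2⟩ := HasWeakCurl.tendsto_slab_average one_pos e1 e2 e3 e4 e5 e6 hψ v₁ v₂
    rw [← sub_self C]
    exact c1.sub c2
  have hZ : (P.Z : ℂ) ≠ 0 := by exact_mod_cast hP.Z.ne'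
  constructor
  · refine (tracesAgree_iff hUu (Set.subset_univ _) hUu (Set.subset_univ _)).2 fun i ψ hψ => ?_
    obtain ⟨⟨v₁, v₂, -, hv⟩, -⟩ := exists_polarization P hZ i
    simp only [hv]
    exact key hψ v₁ v₂
  · refine (tracesAgree_iff hUu (Set.subset_univ _) hUu (Set.subset_univ _)).2 fun i ψ hψ => ?_
    obtain ⟨-, v₁, v₂, hv⟩ := exists_polarization P hZ i
    simp only [hv]
    exact key hψ v₁ v₂

/-! ### The problem in a half space -/

/-- Pairs of test fields that satisfy the adjoint impedance condition on the plane `x = L`. -/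
def adjointPairs (P : Params) (L : ℝ) : Submodule ℂ (testFields × testFields) where
  carrier := {v | ∀ y, P.Z * v.2.1 (L, y) 2 = v.1.1 (L, y) 1 ∧
    P.Z * v.2.1 (L, y) 1 = -v.1.1 (L, y) 2}
  add_mem' := by
    intro v w hv hw y
    obtain ⟨h1, h2⟩ := hv y
    obtain ⟨h3, h4⟩ := hw y
    simp only [Prod.fst_add, Prod.snd_add, Submodule.coe_add, Pi.add_apply]
    exact ⟨by linear_combination h1 + h3, by linear_combination h2 + h4⟩
  zero_mem' := by
    intro y
    simp
  smul_mem' := by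
    intro c v hv y
    obtain ⟨h1, h2⟩ := hv y
    simp only [Prod.smul_fst, Prod.smul_snd, Submodule.coe_smul, Pi.smul_apply, smul_eq_mul]
    exact ⟨by linear_combination c * h1, by linear_combination c * h2⟩

/-- The boundary term in Green's formula, which is the energy flux through the plane, has a sign for
pairs that satisfy the adjoint impedance condition. -/
lemma adjointPairs_flux {P : Params} (hP : P.Pos) (L : ℝ) {v : testFields × testFields}
    (hv : v ∈ adjointPairs P L) :
    ∃ β : ℝ, 0 ≤ β ∧ (∫ p in Ω₁ L, star (v.2.1 p) ⬝ᵥ curl v.1.1 p) -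
      ∫ p in Ω₁ L, star (curl v.2.1 p) ⬝ᵥ v.1.1 p = β := by
  obtain ⟨s1, s2⟩ := v.2.2.star
  have h1 := integral_curl_dot_halfSpace v.1.2 s1 L
  simp only [s2] at h1
  refine ⟨∫ y, P.Z * (‖v.2.1 (L, y) 2‖ ^ 2 + ‖v.2.1 (L, y) 1‖ ^ 2), integral_nonneg fun y => ?_, ?_⟩
  · have := hP.Z
    positivity
  · rw [← integral_complex_ofReal]
    simp only [dotProduct_comm (star (v.2.1 _)), dotProduct_comm (star (curl v.2.1 _))]
    rw [h1]
    congr 1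
    funext y
    obtain ⟨h3, h4⟩ := hv y
    rw [← h3, show v.1.1 (L, y) 2 = -(P.Z * v.2.1 (L, y) 1) by rw [h4, neg_neg]]
    simp only [Pi.star_apply, RCLike.star_def]
    push_cast
    rw [← Complex.mul_conj', ← Complex.mul_conj']
    ring

lemma weak_form_rearrange {P : Params} {S R : Set Space} {E H f g φ₁ φ₂ : Space → CVec}
    (hE : MemLp E 2 (volume.restrict S)) (hH : MemLp H 2 (volume.restrict S))
    (hf : MemLp f 2 (volume.restrict S)) (hg : MemLp g 2 (volume.restrict S))
    (t1 : IsTestField R φ₁) (t2 : IsTestField R φ₂)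
    (h1 : (∫ p in S, E p ⬝ᵥ (curl φ₂ p - P.adm • φ₁ p)) +
      (∫ p in S, H p ⬝ᵥ (curl φ₁ p + P.imp • φ₂ p)) =
        (∫ p in S, f p ⬝ᵥ φ₁ p) + ∫ p in S, g p ⬝ᵥ φ₂ p) :
    (∫ p in S, E p ⬝ᵥ curl φ₂ p) + ∫ p in S, H p ⬝ᵥ curl φ₁ p =
      (∫ p in S, (f p + P.adm • E p) ⬝ᵥ φ₁ p) + ∫ p in S, (g p - P.imp • H p) ⬝ᵥ φ₂ p := by
  simp only [dotProduct_sub, dotProduct_add, add_dotProduct, sub_dotProduct, dotProduct_smul,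
    smul_dotProduct, smul_eq_mul] at h1 ⊢
  rw [integral_sub (t2.curl.integrable_dot_left hE) ((t1.integrable_dot_left hE).const_mul P.adm),
    integral_add (t1.curl.integrable_dot_left hH)
      ((t2.integrable_dot_left hH).const_mul P.imp)] at h1
  rw [integral_add (t1.integrable_dot_left hf) ((t1.integrable_dot_left hE).const_mul P.adm),
    integral_sub (t2.integrable_dot_left hg) ((t2.integrable_dot_left hH).const_mul P.imp)]
  linear_combination h1

/-- Solvability of the Maxwell system with electric and magnetic sources in the left half space,
with vanishing incoming impedance trace. -/
theorem exists_halfSpace_solution {P : Params} (hP : P.Pos) (L : ℝ) {f g : Space → CVec}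
    (hf : MemLp f 2 (volume.restrict (Ω₁ L))) (hg : MemLp g 2 (volume.restrict (Ω₁ L))) :
    ∃ U : Space → EH, MemLp U 2 (volume.restrict (Ω₁ L)) ∧
      HasWeakCurl (Ω₁ L) (fun p => (U p).2) (fun p => f p + P.adm • (U p).1) ∧
      HasWeakCurl (Ω₁ L) (fun p => (U p).1) (fun p => g p - P.imp • (U p).2) ∧
      TracesAgree P ex L U 0 := by
  have hZ : (P.Z : ℂ) ≠ 0 := by exact_mod_cast hP.Z.ne'
  have hm : MeasurableSet (Ω₁ L) := measurable_fst measurableSet_Iio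
  obtain ⟨E, H, hE, hH, h⟩ := exists_weak_solution hP (Ω₁ L) (adjointPairs P L)
    (fun v hv => adjointPairs_flux hP L hv) hf hg
  have hU : MemLp (fun p => (E p, H p)) 2 (volume.restrict (Ω₁ L)) :=
    memLp_prod_iff_fst_snd.2 ⟨hE, hH⟩
  have hc := hasWeakCurl_of_weak hE hH hf hg (P := P) (by
    intro φ₁ φ₂ h₁ h₂
    refine h (⟨φ₁, h₁.mono (Set.subset_univ _)⟩, ⟨φ₂, h₂.mono (Set.subset_univ _)⟩) fun y => ?_
    have z : ∀ {φ}, IsTestField (Ω₁ L) φ → φ (L, y) = 0 := fun h =>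
      image_eq_zero_of_notMem_tsupport fun h' => lt_irrefl L (h.2.2 h')
    simp only [z h₁, z h₂]
    simp)
  refine ⟨fun p => (E p, H p), hU, hc.1, hc.2, ?_⟩
  refine (tracesAgree_iff hU subset_rfl (MemLp.zero (μ := volume.restrict Set.univ))
    (Set.subset_univ _)).2 fun i ψ hψ => ?_
  obtain ⟨⟨v₁, v₂, hbc, hv⟩, -⟩ := exists_polarization P hZ i
  have ext : ∀ {F : Space → CVec}, MemLp F 2 (volume.restrict (Ω₁ L)) →
      MemLp ((Ω₁ L).indicator F) 2 (volume.restrict (slab (L - 1) (L + 1))) := fun hF =>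
    ((memLp_indicator_iff_restrict hm).2 hF).restrict _
  have hf' : MemLp (fun p => f p + P.adm • E p) 2 (volume.restrict (Ω₁ L)) :=
    hf.add (hE.const_smul P.adm)
  have hg' : MemLp (fun p => g p - P.imp • H p) 2 (volume.restrict (Ω₁ L)) :=
    hg.sub (hH.const_smul P.imp)
  obtain ⟨C, c1, c2⟩ := tendsto_slab_average_tangential (a := L) one_pos (ext hE) (ext hH)
    (ext hf') (ext hg') hψ v₁ v₂ (by
      intro η hη
      have t1 := isTestField_tensor hη hψ v₁
      have t2 := isTestField_tensor hη hψ v₂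
      have h1 := h (⟨_, t1.mono (Set.subset_univ _)⟩, ⟨_, t2.mono (Set.subset_univ _)⟩) (fun y => by
        simp only [Pi.smul_apply, smul_eq_mul]
        exact ⟨by linear_combination η L * ψ y * hbc.1, by linear_combination η L * ψ y * hbc.2⟩)
      have move : ∀ {φ F : Space → CVec}, IsTestField (slab (L - 1) (L + 1)) φ →
          ∫ p in slab (L - 1) (L + 1), (Ω₁ L).indicator F p ⬝ᵥ φ p = ∫ p in Ω₁ L, F p ⬝ᵥ φ p := by
        intro φ F hφ
        rw [setIntegral_eq_integral_of_forall_compl_eq_zero, ← integral_indicator hm]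
        · congr 1
          funext p
          by_cases hp : p ∈ Ω₁ L <;> simp [hp]
        · intro p hp
          rw [image_eq_zero_of_notMem_tsupport fun h' => hp (hφ.2.2 h'), dotProduct_zero]
      rw [integral_add (t2.curl.integrable_dot_left (ext hE))
          (t1.curl.integrable_dot_left (ext hH)),
        integral_add (t1.integrable_dot_left (ext hf'))
          (t2.integrable_dot_left (ext hg')), move t2.curl, move t1.curl, move t1, move t2]
      exact weak_form_rearrange hE hH hf hg t1 t2 h1)
  have hz : ∀ t : ℝ, ∫ p in slab L (L + t), ψ p.2 * ((Ω₁ L).indicator E p ⬝ᵥ (ex ⨯₃ v₂) +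
      (Ω₁ L).indicator H p ⬝ᵥ (ex ⨯₃ v₁)) = 0 := by
    intro t
    refine setIntegral_eq_zero_of_forall_eq_zero fun p hp => ?_
    have : p ∉ Ω₁ L := fun h' => lt_asymm hp.1 h'
    simp [this]
  have hC : C = 0 := by
    simp only [hz, smul_zero] at c2
    exact tendsto_nhds_unique c2 tendsto_const_nhds
  rw [hC] at c1
  refine c1.congr fun t => ?_
  have h0 : ∀ p : Space, impedance P ex ((0 : Space → EH) p) i = 0 := fun p => by
    rw [Pi.zero_apply, map_zero, Pi.zero_apply]
  simp only [slabGap, h0, mul_zero, integral_zero, smul_zero, sub_zero]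
  congr 1
  refine setIntegral_congr_fun (measurableSet_slab _ _) fun p hp => ?_
  have : p ∈ Ω₁ L := hp.2
  simp only [hv, Set.indicator_of_mem this]

/-! ### Reflection in a plane -/

/-- The reflection that exchanges `x` and `c - x`. -/
def mirror (c : ℝ) : Space ≃ₜ Space := (Homeomorph.subLeft c).prodCongr (Homeomorph.refl Plane)

lemma mirror_apply (c : ℝ) (p : Space) : mirror c p = (c - p.1, p.2) := rfl

lemma mirror_mirror (c : ℝ) (p : Space) : mirror c (mirror c p) = p := by
  simp [mirror_apply]

lemma measurePreserving_mirror (c : ℝ) : MeasurePreserving (mirror c) volume volume :=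
  (volume.measurePreserving_sub_left c).prod (MeasurePreserving.id volume)

lemma setIntegral_mirror {E : Type*} [NormedAddCommGroup E] [NormedSpace ℝ E] (c : ℝ)
    (f : Space → E) (S : Set Space) :
    ∫ p in mirror c ⁻¹' S, f (mirror c p) = ∫ p in S, f p :=
  (measurePreserving_mirror c).setIntegral_preimage_emb (mirror c).measurableEmbedding f S

lemma memLp_mirror {E : Type*} [NormedAddCommGroup E] {f : Space → E} {S : Set Space}
    (hf : MemLp f 2 (volume.restrict S)) (c : ℝ) :
    MemLp (fun p => f (mirror c p)) 2 (volume.restrict (mirror c ⁻¹' S)) :=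
  hf.comp_measurePreserving
    ((measurePreserving_mirror c).restrict_preimage_emb (mirror c).measurableEmbedding S)

/-- The reflection of a vector that reverses the direction of `x`. -/
def flipX : CVec →ₗ[ℂ] CVec where
  toFun v := ![-v 0, v 1, v 2]
  map_add' u v := by
    funext i
    fin_cases i <;> simp [add_comm]
  map_smul' c v := by
    funext i
    fin_cases i <;> simp

lemma flipX_apply (v : CVec) : flipX v = ![-v 0, v 1, v 2] := rfl

lemma flipX_eq_mul (v : CVec) (i : Fin 3) : flipX v i = (![-1, 1, 1] : CVec) i * v i := by
  fin_cases i <;> simp [flipX_apply]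

lemma flipX_flipX (v : CVec) : flipX (flipX v) = v := by
  funext i
  fin_cases i <;> simp [flipX_apply]

lemma flipX_dotProduct (u v : CVec) : flipX u ⬝ᵥ v = u ⬝ᵥ flipX v := by
  simp [flipX_apply, dotProduct, Fin.sum_univ_three]

lemma memLp_flipX {f : Space → CVec} {ν : Measure Space} (hf : MemLp f 2 ν) :
    MemLp (fun p => flipX (f p)) 2 ν :=
  flipX.toContinuousLinearMap.comp_memLp' hf

lemma isTest_mirror {S : Set Space} {η : Space → ℂ} (h : IsTest S η) (c : ℝ) :
    IsTest (mirror c ⁻¹' S) fun p => η (mirror c p) :=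
  ⟨h.smooth.comp ((contDiff_const.sub contDiff_fst).prodMk contDiff_snd),
    h.compact.comp_homeomorph _,
    (tsupport_comp_subset_preimage η (mirror c).continuous).trans (Set.preimage_mono h.subset)⟩

lemma isTestField_mirror {S : Set Space} {φ : Space → CVec} (h : IsTestField S φ) (c : ℝ) :
    IsTestField (mirror c ⁻¹' S) (fun p => flipX (φ (mirror c p))) ∧
    ∀ p, curl (fun p => flipX (φ (mirror c p))) p =
      -flipX (curl φ (mirror c p)) := by
  have hi := fun i => isTest_mirror (isTestField_iff.1 h i) c
  have ht : IsTestField (mirror c ⁻¹' S)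
      (fun p => flipX (φ (mirror c p))) := by
    refine isTestField_iff.2 fun i => ?_
    simp only [flipX_eq_mul]
    exact (hi i).const_mul _
  refine ⟨ht, fun p => ?_⟩
  have hd : ∀ i j, fderiv ℝ (fun q => φ (mirror c q) i) p (dir j) =
      (![-1, 1, 1] : CVec) j * pderiv φ j i (mirror c p) := by
    intro i j
    have h1 : HasFDerivAt (fun q => φ q i) (fderiv ℝ (fun q => φ q i) (mirror c p))
        (mirror c p) :=
      ((isTestField_iff.1 h i).smooth.differentiable (by simp) _).hasFDerivAt
    have h2 : HasFDerivAt (fun q : Space => (c - q.1, q.2)) _ p :=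
      ((hasFDerivAt_const c p).sub (hasFDerivAt_fst (𝕜 := ℝ))).prodMk (hasFDerivAt_snd (𝕜 := ℝ))
    have h3 : HasFDerivAt (fun q => φ (mirror c q) i) _ p := h1.comp p h2
    rw [h3.fderiv, h.pderiv_eq]
    fin_cases j
    · have e : ((-1 : ℝ), (0 : Plane)) = -(1, 0) := by simp
      have e' : fderiv ℝ (fun q => φ q i) (mirror c p) (-1, 0) =
          -fderiv ℝ (fun q => φ q i) (mirror c p) (1, 0) := by rw [e, map_neg]
      simpa [dir] using e'
    · simp [dir]
    · simp [dir]
  have key : ∀ i j, pderiv (fun p => flipX (φ (mirror c p))) j i p =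
      (![-1, 1, 1] : CVec) i *
        ((![-1, 1, 1] : CVec) j * pderiv φ j i (mirror c p)) := by
    intro i j
    rw [ht.pderiv_eq, ← hd]
    simp only [flipX_eq_mul]
    rw [fderiv_const_mul ((hi i).smooth.differentiable (by simp) p)]
    rfl
  funext i
  rw [Pi.neg_apply, flipX_eq_mul]
  simp only [curl, key]
  fin_cases i <;> simp <;> ring

/-- A reflection changes the sign of the curl. -/
lemma hasWeakCurl_mirror {S : Set Space} {F G : Space → CVec} (h : HasWeakCurl S F G) (c : ℝ) :
    HasWeakCurl (mirror c ⁻¹' S) (fun p => flipX (F (mirror c p)))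
      (fun p => -flipX (G (mirror c p))) := by
  intro φ hφ
  obtain ⟨h1, h2⟩ := isTestField_mirror hφ c
  have hS : mirror c ⁻¹' (mirror c ⁻¹' S) = S := by
    ext p
    simp [mirror_mirror]
  rw [hS] at h1
  have h3 := h _ h1
  simp only [h2, dotProduct_neg, integral_neg] at h3
  have e : ∀ (A B : Space → CVec), ∫ p in S, A p ⬝ᵥ flipX (B (mirror c p)) =
      ∫ p in mirror c ⁻¹' S, flipX (A (mirror c p)) ⬝ᵥ B p := by
    intro A B
    rw [← setIntegral_mirror c]
    simp only [mirror_mirror, flipX_dotProduct]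
  rw [e, e] at h3
  simp only [neg_dotProduct, integral_neg]
  rw [← h3, neg_neg]

/-! ### Existence of the iterates -/

lemma HasWeakCurl.add {S : Set Space} {F F' G G' : Space → CVec}
    (hF : MemLp F 2 (volume.restrict S)) (hF' : MemLp F' 2 (volume.restrict S))
    (hG : MemLp G 2 (volume.restrict S)) (hG' : MemLp G' 2 (volume.restrict S))
    (h : HasWeakCurl S F G) (h' : HasWeakCurl S F' G') :
    HasWeakCurl S (fun p => F p + F' p) (fun p => G p + G' p) := by
  intro φ hφ
  simp only [add_dotProduct]
  rw [integral_add (hφ.curl.integrable_dot_left hF) (hφ.curl.integrable_dot_left hF'),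
    integral_add (hφ.integrable_dot_left hG) (hφ.integrable_dot_left hG'), h φ hφ, h' φ hφ]

lemma HasWeakCurl.congr {S : Set Space} {F F' G G' : Space → CVec} (h : HasWeakCurl S F G)
    (hF : ∀ p, F p = F' p) (hG : ∀ p, G p = G' p) : HasWeakCurl S F' G' := by
  rwa [← funext hF, ← funext hG]

lemma curl_mul_fst {S : Set Space} {φ : Space → CVec} (hφ : IsTestField S φ) {θ : ℝ → ℂ}
    (hθ : ContDiff ℝ (⊤ : ℕ∞) θ) (p : Space) :
    curl (fun p => θ p.1 • φ p) p = θ p.1 • curl φ p + deriv θ p.1 • (ex ⨯₃ φ p) := by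
  have ht : IsTestField S fun p => θ p.1 • φ p :=
    isTestField_iff.2 fun i => (isTestField_iff.1 hφ i).smooth_mul (hθ.comp contDiff_fst)
  have key : ∀ j i, pderiv (fun p : Space => θ p.1 • φ p) j i p =
      θ p.1 * pderiv φ j i p + deriv θ p.1 * ex j * φ p i := by
    intro j i
    rw [ht.pderiv_eq, hφ.pderiv_eq]
    have h1 : HasFDerivAt (fun q : Space => θ q.1) _ p :=
      ((hθ.differentiable (by simp) p.1).hasDerivAt).hasFDerivAt.comp p hasFDerivAt_fst
    have h2 : HasFDerivAt (fun q => φ q i) (fderiv ℝ (fun q => φ q i) p) p :=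
      ((isTestField_iff.1 hφ i).smooth.differentiable (by simp) p).hasFDerivAt
    have h3 : HasFDerivAt (fun q : Space => (θ q.1 • φ q) i) _ p := h1.mul h2
    rw [h3.fderiv]
    fin_cases j <;> simp [dir, ex]
    ring
  funext i
  fin_cases i <;> (simp [curl, key, crossProduct, ex]; ring)

/-- Multiplication by a cutoff function of `x` extends a field with square integrable curl from a
slab next to the plane `x = L` to the half space. -/
lemma HasWeakCurl.cutoff {L δ : ℝ} {F C : Space → CVec} {θ : ℝ → ℂ}
    (hθ : IsTest (Set.Ioo (L - δ) (L + δ)) θ)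
    (hF : MemLp F 2 (volume.restrict (Ω₁ L))) (hC : MemLp C 2 (volume.restrict (slab (L - δ) L)))
    (h : HasWeakCurl (slab (L - δ) L) F C) :
    ∃ K : Space → CVec, MemLp K 2 (volume.restrict (Ω₁ L)) ∧
      HasWeakCurl (Ω₁ L) (fun p => θ p.1 • F p) K := by
  have bdd : ∀ {η : ℝ → ℂ}, IsTest (Set.Ioo (L - δ) (L + δ)) η → ∀ {A : Space → CVec}
      {ν : Measure Space}, MemLp A 2 ν → MemLp (fun p => η p.1 • A p) 2 ν := by
    intro η hη A ν hA
    obtain ⟨c, hc⟩ := hη.continuous.bounded_above_of_compact_support hη.compact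
    exact hA.of_le_mul (c := c)
      ((hη.continuous.comp continuous_fst).aestronglyMeasurable.smul hA.1)
      (.of_forall fun p => (norm_smul_le _ _).trans
        (mul_le_mul_of_nonneg_right (hc _) (norm_nonneg _)))
  have hC' : MemLp (fun p => θ p.1 • (slab (L - δ) L).indicator C p) 2 (volume.restrict (Ω₁ L)) :=
    bdd hθ (((memLp_indicator_iff_restrict (measurableSet_slab _ _)).2 hC).restrict _)
  have hX : MemLp (fun p => deriv θ p.1 • (ex ⨯₃ F p)) 2 (volume.restrict (Ω₁ L)) :=
    bdd hθ.deriv ((crossProduct ex).toContinuousLinearMap.comp_memLp' hF)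
  refine ⟨_, hC'.add hX, fun φ hφ => ?_⟩
  have ht : IsTestField (slab (L - δ) L) fun p => θ p.1 • φ p := by
    have ht0 : IsTestField (Ω₁ L) fun p => θ p.1 • φ p :=
      isTestField_iff.2 fun i => (isTestField_iff.1 hφ i).smooth_mul (hθ.smooth.comp contDiff_fst)
    refine ⟨ht0.1, ht0.2.1, fun p hp => ?_⟩
    have h2 : p.1 ∈ tsupport θ := by
      have := closure_mono (Function.support_smul_subset_left (fun p : Space => θ p.1) φ) hp
      exact tsupport_comp_subset_preimage θ continuous_fst this
    exact ⟨(hθ.subset h2).1, ht0.2.2 hp⟩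
  have h1 := h _ ht
  simp only [curl_mul_fst hφ hθ.smooth] at h1
  have hsub : slab (L - δ) L ⊆ Ω₁ L := fun p hp => hp.2
  have out : ∀ p ∈ Ω₁ L, p ∉ slab (L - δ) L → θ p.1 = 0 ∧ deriv θ p.1 = 0 := by
    intro p hp hp'
    have : p.1 ∉ Set.Ioo (L - δ) (L + δ) := fun h => hp' ⟨h.1, hp⟩
    exact ⟨hθ.eq_zero this, hθ.deriv.eq_zero this⟩
  have e1 : ∫ p in slab (L - δ) L, F p ⬝ᵥ (θ p.1 • curl φ p + deriv θ p.1 • (ex ⨯₃ φ p)) =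
      ∫ p in Ω₁ L, (θ p.1 • F p) ⬝ᵥ curl φ p - (deriv θ p.1 • (ex ⨯₃ F p)) ⬝ᵥ φ p := by
    rw [← setIntegral_eq_of_subset_of_forall_sdiff_eq_zero (measurable_fst measurableSet_Iio) hsub]
    · congr 1
      funext p
      simp only [dotProduct_add, dotProduct_smul, smul_dotProduct, smul_eq_mul, sub_eq_add_neg,
        ← mul_neg]
      congr 2
      simp [crossProduct, ex, dotProduct, Fin.sum_univ_three]
    · intro p hp
      obtain ⟨h1, h2⟩ := out p hp.1 hp.2
      simp [h1, h2]
  have e2 : ∫ p in slab (L - δ) L, C p ⬝ᵥ (θ p.1 • φ p) =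
      ∫ p in Ω₁ L, (θ p.1 • (slab (L - δ) L).indicator C p) ⬝ᵥ φ p := by
    rw [← setIntegral_eq_of_subset_of_forall_sdiff_eq_zero (measurable_fst measurableSet_Iio) hsub]
    · refine setIntegral_congr_fun (measurable_fst measurableSet_Iio) fun p hp => ?_
      by_cases hp' : p ∈ slab (L - δ) L
      · simp [Set.indicator_of_mem hp']
      · simp [(out p hp hp').1]
    · intro p hp
      simp [(out p hp.1 hp.2).1]
  rw [e1, e2, integral_sub (hφ.curl.integrable_dot_left (bdd hθ hF)) (hφ.integrable_dot_left hX),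
    sub_eq_iff_eq_add] at h1
  rw [h1, ← integral_add (hφ.integrable_dot_left hC') (hφ.integrable_dot_left hX)]
  congr 1
  funext p
  rw [Pi.add_apply, add_dotProduct]

lemma impedance_flipX (P : Params) (u : EH) :
    impedance P ex (flipX u.1, flipX u.2) = impedance P ex u := by
  simp [impedance_ex, flipX_apply]

lemma impedance_neg_flipX (P : Params) (u : EH) :
    impedance P (-ex) (flipX u.1, -flipX u.2) = -impedance P ex u := by
  simp only [impedance_ex, impedance_neg_ex, flipX_apply]
  funext i
  fin_cases i <;> (simp; try ring)

lemma preimage_mirror_Ω₁ (L : ℝ) : mirror L ⁻¹' Ω₁ L = Ω₂ := by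
  ext p
  simp [mirror_apply, Ω₁, Ω₂]

lemma preimage_mirror_Ω₂ (L : ℝ) : mirror L ⁻¹' Ω₂ = Ω₁ L := by
  ext p
  simp [mirror_apply, Ω₁, Ω₂]

lemma preimage_mirror_slab (c a b : ℝ) : mirror c ⁻¹' slab a b = slab (c - b) (c - a) := by
  ext p
  simp only [mirror_apply, slab, Set.mem_preimage, Set.mem_ofPred_eq]
  constructor <;> rintro ⟨h1, h2⟩ <;> constructor <;> linarith

/-- The reflection under which the homogeneous Maxwell system is invariant. -/
def mirrorEH (c : ℝ) (U : Space → EH) (p : Space) : EH :=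
  (flipX (U (mirror c p)).1, -flipX (U (mirror c p)).2)

lemma memLp_mirrorEH {U : Space → EH} {S : Set Space} (hU : MemLp U 2 (volume.restrict S)) (c : ℝ) :
    MemLp (mirrorEH c U) 2 (volume.restrict (mirror c ⁻¹' S)) := by
  obtain ⟨h1, h2⟩ := memLp_prod_iff_fst_snd.1 (memLp_mirror hU c)
  exact memLp_prod_iff_fst_snd.2 ⟨memLp_flipX h1, (memLp_flipX h2).neg⟩

lemma HasWeakCurl.neg {S : Set Space} {F G : Space → CVec} (h : HasWeakCurl S F G) :
    HasWeakCurl S (fun p => -F p) (fun p => -G p) := by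
  intro φ hφ
  simp only [neg_dotProduct, integral_neg, h φ hφ]

lemma isWeakMaxwell_mirrorEH {P : Params} {S : Set Space} {J : Space → CVec} {U : Space → EH}
    (h : IsWeakMaxwell P S J U) (c : ℝ) :
    IsWeakMaxwell P (mirror c ⁻¹' S) (fun p => flipX (J (mirror c p))) (mirrorEH c U) := by
  obtain ⟨h1, h2⟩ := isWeakMaxwell_iff.1 h
  refine isWeakMaxwell_iff.2 ⟨(hasWeakCurl_mirror h1 c).neg.congr (fun _ => rfl) fun p => ?_,
    (hasWeakCurl_mirror h2 c).congr (fun _ => rfl) fun p => ?_⟩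
  · simp [mirrorEH]
  · simp [mirrorEH]

lemma hasSqIntegrableCurl_mirrorEH {S : Set Space} {U : Space → EH} (h : HasSqIntegrableCurl S U)
    (c : ℝ) : HasSqIntegrableCurl (mirror c ⁻¹' S) (mirrorEH c U) := by
  obtain ⟨C, hC, h1, h2⟩ := h
  obtain ⟨c1, c2⟩ := memLp_prod_iff_fst_snd.1 (memLp_mirror hC c)
  exact ⟨fun p => (-flipX (C (mirror c p)).1, - -flipX (C (mirror c p)).2),
    memLp_prod_iff_fst_snd.2 ⟨(memLp_flipX c1).neg, (memLp_flipX c2).neg.neg⟩,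
    hasWeakCurl_mirror h1 c, (hasWeakCurl_mirror h2 c).neg⟩

lemma tracesAgree_mirrorEH {P : Params} {L : ℝ} {U V : Space → EH} (h : TracesAgree P ex L U V) :
    TracesAgree P (-ex) 0 (mirrorEH L V) (mirrorEH L U) := by
  intro ψ h1 h2
  have key : ∀ (W : Space → EH) (a b : ℝ), ∫ p in slab (L - b) (L - a),
      ψ p.2 • impedance P (-ex) (mirrorEH L W p) =
        -∫ p in slab a b, ψ p.2 • impedance P ex (W p) := by
    intro W a b
    rw [← preimage_mirror_slab, ← setIntegral_mirror L _ (slab a b), ← integral_neg]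
    simp only [mirrorEH, impedance_neg_flipX, smul_neg]
    rfl
  refine (h ψ h1 h2).congr fun t => ?_
  have k1 := key V L (L + t)
  have k2 := key U (L - t) L
  rw [show L - (L + t) = 0 - t by ring, sub_self] at k1
  rw [sub_self, show L - (L - t) = 0 + t by ring] at k2
  rw [k1, k2, smul_neg, smul_neg]
  abel

/-- One step of the algorithm in the left subdomain. The mirror image of the old field, cut off away
from the plane, has the right incoming trace; it is corrected by a field with vanishing incoming
trace. -/
theorem exists_step_left {P : Params} (hP : P.Pos) {L : ℝ} (hL : 0 ≤ L) {J : Space → CVec}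
    (hJ : MemLp J 2 (volume.restrict (Ω₁ L))) {V : Space → EH}
    (hV : MemLp V 2 (volume.restrict Ω₂)) {δ : ℝ} (hδ : 0 < δ)
    (hc : HasSqIntegrableCurl (slab L (L + δ)) V) :
    ∃ U : Space → EH, MemLp U 2 (volume.restrict (Ω₁ L)) ∧ IsWeakMaxwell P (Ω₁ L) J U ∧
      TracesAgree P ex L U V := by
  obtain ⟨C, hC, hc1, hc2⟩ := hc
  obtain ⟨C1, C2⟩ := memLp_prod_iff_fst_snd.1 (memLp_mirror hC (2 * L))
  have hslab : mirror (2 * L) ⁻¹' slab L (L + δ) = slab (L - δ) L := by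
    rw [preimage_mirror_slab]
    congr 1 <;> ring
  have hhalf : Ω₁ L ⊆ mirror (2 * L) ⁻¹' Ω₂ := by
    intro p hp
    have : p.1 < L := hp
    change 0 < 2 * L - p.1
    linarith
  obtain ⟨V1, V2⟩ := memLp_prod_iff_fst_snd.1
    ((memLp_mirror hV (2 * L)).mono_measure (Measure.restrict_mono hhalf le_rfl))
  rw [hslab] at C1 C2
  have w1 := hasWeakCurl_mirror hc1 (2 * L)
  have w2 := hasWeakCurl_mirror hc2 (2 * L)
  rw [hslab] at w1 w2
  -- a cutoff function which is one near the plane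
  let χ : ContDiffBump L := ⟨δ / 3, δ / 2, by positivity, by linarith⟩
  have hχ : IsTest (Set.Ioo (L - δ) (L + δ)) fun x => (χ x : ℂ) := by
    refine IsTest.ofReal χ.contDiff χ.hasCompactSupport ?_
    rw [χ.tsupport_eq, Real.closedBall_eq_Icc]
    change Set.Icc (L - δ / 2) (L + δ / 2) ⊆ _
    exact fun x hx => ⟨by linarith [hx.1], by linarith [hx.2]⟩
  obtain ⟨K1, k1, kc1⟩ := HasWeakCurl.cutoff hχ (memLp_flipX V1) (memLp_flipX C1).neg w1
  obtain ⟨K2, k2, kc2⟩ := HasWeakCurl.cutoff hχ (memLp_flipX V2) (memLp_flipX C2).neg w2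
  set W : Space → EH := fun p => ((χ p.1 : ℂ) • flipX (V (mirror (2 * L) p)).1,
    (χ p.1 : ℂ) • flipX (V (mirror (2 * L) p)).2) with hW
  have bdd : ∀ {A : Space → CVec} {ν : Measure Space}, MemLp A 2 ν →
      MemLp (fun p => (χ p.1 : ℂ) • A p) 2 ν := by
    intro A ν hA
    exact hA.of_le_mul (c := 1)
      ((hχ.continuous.comp continuous_fst).aestronglyMeasurable.smul hA.1)
      (.of_forall fun p => (norm_smul_le _ _).trans (mul_le_mul_of_nonneg_right (by
        rw [Complex.norm_real, Real.norm_of_nonneg χ.nonneg]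
        exact χ.le_one) (norm_nonneg _)))
  have hW1 : MemLp (fun p => (W p).1) 2 (volume.restrict (Ω₁ L)) := bdd (memLp_flipX V1)
  have hW2 : MemLp (fun p => (W p).2) 2 (volume.restrict (Ω₁ L)) := bdd (memLp_flipX V2)
  have hWm : MemLp W 2 (volume.restrict (Ω₁ L)) := memLp_prod_iff_fst_snd.2 ⟨hW1, hW2⟩
  have f1 : MemLp (fun p => J p + P.adm • (W p).1 - K2 p) 2 (volume.restrict (Ω₁ L)) :=
    (hJ.add (hW1.const_smul P.adm)).sub k2
  have g1 : MemLp (fun p => -(P.imp • (W p).2) - K1 p) 2 (volume.restrict (Ω₁ L)) :=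
    (hW2.const_smul P.imp).neg.sub k1
  obtain ⟨D, hD, d1, d2, hT⟩ := exists_halfSpace_solution hP L f1 g1
  obtain ⟨D1, D2⟩ := memLp_prod_iff_fst_snd.1 hD
  have hU := hWm.add hD
  refine ⟨W + D, hU, isWeakMaxwell_iff.2 ⟨?_, ?_⟩, ?_⟩
  · have f2 : MemLp (fun p => J p + P.adm • (W p).1 - K2 p + P.adm • (D p).1) 2
        (volume.restrict (Ω₁ L)) := f1.add (D1.const_smul P.adm)
    refine (kc2.add hW2 D2 k2 f2 d1).congr (fun _ => rfl) fun p => ?_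
    simp only [Pi.add_apply, Prod.fst_add, smul_add]
    abel
  · have g2 : MemLp (fun p => -(P.imp • (W p).2) - K1 p - P.imp • (D p).2) 2
        (volume.restrict (Ω₁ L)) := g1.sub (D2.const_smul P.imp)
    refine (kc1.add hW1 D1 k1 g2 d2).congr (fun _ => rfl) fun p => ?_
    simp only [Pi.add_apply, Prod.snd_add, smul_add]
    abel
  · have hV' : {p : Space | L < p.1} ⊆ Ω₂ := fun p hp => lt_of_le_of_lt hL hp
    refine (tracesAgree_iff hU subset_rfl hV hV').2 fun i ψ hψ => ?_
    have hD0 := (tracesAgree_iff hD subset_rfl (MemLp.zero (μ := volume.restrict Set.univ))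
      (Set.subset_univ _)).1 hT i ψ hψ
    refine hD0.congr' ?_
    have hsmall : ∀ᶠ t : ℝ in 𝓝[>] 0, 0 < t ∧ t < δ / 3 := Ioo_mem_nhdsGT (by positivity)
    filter_upwards [hsmall] with t ht
    -- near the plane `W` is the mirror image of `V`, with the same tangential components
    have hWV : ∫ p in slab (L - t) L, ψ p.2 * impedance P ex (W p) i =
        ∫ p in slab L (L + t), ψ p.2 * impedance P ex (V p) i := by
      rw [← setIntegral_mirror (2 * L) _ (slab L (L + t)), preimage_mirror_slab,
        show 2 * L - (L + t) = L - t by ring, show 2 * L - L = L by ring]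
      refine setIntegral_congr_fun (measurableSet_slab _ _) fun p hp => ?_
      have h1 : χ p.1 = 1 := by
        refine χ.one_of_mem_closedBall ?_
        rw [Real.closedBall_eq_Icc]
        change p.1 ∈ Set.Icc (L - δ / 3) (L + δ / 3)
        exact ⟨by linarith [hp.1, ht.2], by linarith [hp.2]⟩
      simp only [hW, h1, Complex.ofReal_one, one_smul, impedance_flipX]
      rfl
    simp only [slabGap, Pi.add_apply, map_add, mul_add]
    rw [integral_add (hψ.integrable_slab (memLp_impedance hWm i) fun p hp => hp.2)
      (hψ.integrable_slab (memLp_impedance hD i) fun p hp => hp.2), hWV]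
    simp only [Pi.zero_apply, map_zero, mul_zero, integral_zero, smul_zero, smul_add]
    abel

lemma mirrorEH_mirrorEH (c : ℝ) (U : Space → EH) : mirrorEH c (mirrorEH c U) = U := by
  funext p
  simp [mirrorEH, flipX_flipX, mirror_mirror]

/-- One step of the algorithm in the right subdomain, by reflection. -/
theorem exists_step_right {P : Params} (hP : P.Pos) {L : ℝ} (hL : 0 ≤ L) {J : Space → CVec}
    (hJ : MemLp J 2 (volume.restrict Ω₂)) {V : Space → EH}
    (hV : MemLp V 2 (volume.restrict (Ω₁ L))) {δ : ℝ} (hδ : 0 < δ)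
    (hc : HasSqIntegrableCurl (slab (-δ) 0) V) :
    ∃ U : Space → EH, MemLp U 2 (volume.restrict Ω₂) ∧ IsWeakMaxwell P Ω₂ J U ∧
      TracesAgree P (-ex) 0 V U := by
  have hJ' := memLp_flipX (memLp_mirror hJ L)
  have hV' := memLp_mirrorEH hV L
  have hc' := hasSqIntegrableCurl_mirrorEH hc L
  rw [preimage_mirror_Ω₂] at hJ'
  rw [preimage_mirror_Ω₁] at hV'
  rw [preimage_mirror_slab, sub_zero, sub_neg_eq_add] at hc'
  obtain ⟨U, hU, h1, h2⟩ := exists_step_left hP hL hJ' hV' hδ hc'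
  have hU' := memLp_mirrorEH hU L
  have h1' := isWeakMaxwell_mirrorEH h1 L
  have h2' := tracesAgree_mirrorEH h2
  rw [preimage_mirror_Ω₁] at hU' h1'
  rw [mirrorEH_mirrorEH] at h2'
  simp only [mirror_mirror, flipX_flipX] at h1'
  exact ⟨mirrorEH L U, hU', h1', h2'⟩

/-- Square integrable solutions have square integrable curls. -/
lemma IsWeakMaxwell.hasSqIntegrableCurl {P : Params} {S T : Set Space} {J : Space → CVec}
    {U : Space → EH} (h : IsWeakMaxwell P S J U) (hJ : MemLp J 2 (volume.restrict S))
    (hU : MemLp U 2 (volume.restrict S)) (hTS : T ⊆ S) : HasSqIntegrableCurl T U := by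
  obtain ⟨hE, hH⟩ := memLp_prod_iff_fst_snd.1 (hU.mono_measure (Measure.restrict_mono hTS le_rfl))
  have hJ' := hJ.mono_measure (Measure.restrict_mono hTS le_rfl)
  obtain ⟨h1, h2⟩ := isWeakMaxwell_iff.1 h
  refine ⟨fun p => (0 - P.imp • (U p).2, J p + P.adm • (U p).1), memLp_prod_iff_fst_snd.2 ⟨?_, ?_⟩,
    h2.mono hTS, h1.mono hTS⟩
  · simp only [zero_sub]
    exact (hH.const_smul P.imp).neg
  · exact hJ'.add (hE.const_smul P.adm)

/-- Existence of the iterates from a guess with tangential traces. -/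
theorem exists_isSchwarz {P : Params} (hP : P.Pos) {L : ℝ} (hL : 0 ≤ L) {J : Space → CVec}
    (hJ : MemLp J 2 volume) {G₁ G₂ : Space → EH} (hG₁ : MemLp G₁ 2 (volume.restrict (Ω₁ L)))
    (hG₂ : MemLp G₂ 2 (volume.restrict Ω₂)) {δ : ℝ} (hδ : 0 < δ)
    (hc₁ : HasSqIntegrableCurl (slab (-δ) 0) G₁) (hc₂ : HasSqIntegrableCurl (slab L (L + δ)) G₂) :
    ∃ U₁ U₂ : ℕ → Space → EH, U₁ 0 = G₁ ∧ U₂ 0 = G₂ ∧ IsSchwarz P L J U₁ U₂ := by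
  -- pairs of fields from which a further step is possible
  let X := {W : (Space → EH) × (Space → EH) //
    (MemLp W.1 2 (volume.restrict (Ω₁ L)) ∧ MemLp W.2 2 (volume.restrict Ω₂)) ∧
    HasSqIntegrableCurl (slab (-δ) 0) W.1 ∧ HasSqIntegrableCurl (slab L (L + δ)) W.2}
  have step : ∀ W : X, ∃ W' : X, IsWeakMaxwell P (Ω₁ L) J W'.1.1 ∧ IsWeakMaxwell P Ω₂ J W'.1.2 ∧
      TracesAgree P ex L W'.1.1 W.1.2 ∧ TracesAgree P (-ex) 0 W.1.1 W'.1.2 := by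
    rintro ⟨⟨A, B⟩, ⟨hA, hB⟩, cA, cB⟩
    obtain ⟨A', a1, a2, a3⟩ := exists_step_left hP hL (hJ.restrict _) hB hδ cB
    obtain ⟨B', b1, b2, b3⟩ := exists_step_right hP hL (hJ.restrict _) hA hδ cA
    exact ⟨⟨(A', B'), ⟨a1, b1⟩,
      a2.hasSqIntegrableCurl (hJ.restrict _) a1 fun p hp => lt_of_lt_of_le hp.2 hL,
      b2.hasSqIntegrableCurl (hJ.restrict _) b1 fun p hp => lt_of_le_of_lt hL hp.1⟩,
      a2, b2, a3, b3⟩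
  choose next hnext using step
  let W : ℕ → X := fun n => Nat.rec ⟨(G₁, G₂), ⟨hG₁, hG₂⟩, hc₁, hc₂⟩ (fun _ => next) n
  exact ⟨fun n => (W n).1.1, fun n => (W n).1.2, rfl, rfl, fun n => (W n).2.1.1,
    fun n => (W n).2.1.2, fun n => (hnext (W n)).1, fun n => (hnext (W n)).2.1,
    fun n => (hnext (W n)).2.2.1, fun n => (hnext (W n)).2.2.2⟩

open scoped FourierTransform SchwartzMap LineDeriv

/-! ### The Fourier transform in the tangential variables -/

/-- The inverse Fourier transform of a test function on the plane. -/
def ift {ψ : Plane → ℂ} (hψ : IsTest Set.univ ψ) : 𝓢(Plane, ℂ) :=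
  𝓕⁻ (hψ.compact.toSchwartzMap hψ.smooth)

lemma ift_apply {ψ : Plane → ℂ} (hψ : IsTest Set.univ ψ) (k : Plane) :
    ift hψ k = ∫ y, Complex.exp (((2 * Real.pi * inner ℝ y k : ℝ) : ℂ) * Complex.I) * ψ y := by
  rw [ift, SchwartzMap.fourierInv_coe, Real.fourierInv_eq']
  rfl

lemma ift_fderiv {ψ : Plane → ℂ} (hψ : IsTest Set.univ ψ) (v k : Plane) :
    ift (hψ.fderiv_apply v) k = -(Complex.I * (2 * Real.pi * inner ℝ k v : ℝ)) * ift hψ k := by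
  have h : (hψ.fderiv_apply v).compact.toSchwartzMap (hψ.fderiv_apply v).smooth =
      ∂_{v} (hψ.compact.toSchwartzMap hψ.smooth) := by
    ext y
    rw [SchwartzMap.lineDerivOp_apply_eq_fderiv]
    rfl
  have ht : (inner ℝ · v : Plane → ℝ).HasTemperateGrowth := by fun_prop
  rw [ift, h, SchwartzMap.fourierInv_lineDerivOp_eq, smul_apply,
    SchwartzMap.smulLeftCLM_apply_apply ht, ift]
  simp only [smul_eq_mul, Complex.real_smul]
  push_cast
  ring

/-- The inverse Fourier transforms of test functions separate functions. -/
lemma ae_eq_zero_of_forall_integral_ift {G : Plane → ℂ}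
    (hG : ∀ (ψ : Plane → ℂ) (hψ : IsTest Set.univ ψ), Integrable (fun k => ift hψ k * G k))
    (h : ∀ (ψ : Plane → ℂ) (hψ : IsTest Set.univ ψ), ∫ k, ift hψ k * G k = 0) :
    ∀ᵐ k, G k = 0 := by
  have hchar : ∀ v : Plane, ContDiff ℝ (⊤ : ℕ∞) fun y : Plane =>
      Complex.exp (((2 * Real.pi * inner ℝ y v : ℝ) : ℂ) * Complex.I) := fun v =>
    Complex.contDiff_exp.comp ((Complex.ofRealCLM.contDiff.comp
      (contDiff_const.mul (contDiff_id.inner ℝ contDiff_const))).mul contDiff_const)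
  -- translating the test function gives all Fourier coefficients of the product
  have step : ∀ (ψ : Plane → ℂ) (hψ : IsTest Set.univ ψ), ∀ᵐ k, ift hψ k * G k = 0 := by
    intro ψ hψ
    set f : Plane → ℂ := fun k => ift hψ k * G k with hf
    have hfi : Integrable f := hG ψ hψ
    have hF : 𝓕 f = 0 := by
      funext t
      have ht : IsTest Set.univ fun y => ψ (y + t) :=
        ⟨hψ.smooth.comp (contDiff_id.add contDiff_const),
          hψ.compact.comp_homeomorph (Homeomorph.addRight t), Set.subset_univ _⟩
      have h1 : ∀ k, ift ht k =
          Complex.exp (((-2 * Real.pi * inner ℝ k t : ℝ) : ℂ) * Complex.I) * ift hψ k := by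
        intro k
        rw [ift_apply, ift_apply, ← integral_const_mul]
        rw [← integral_sub_right_eq_self _ t]
        congr 1
        funext y
        rw [sub_add_cancel, ← mul_assoc, ← Complex.exp_add, inner_sub_left, real_inner_comm t k]
        congr 2
        push_cast
        ring
      have h2 := h _ ht
      simp only [h1, mul_assoc] at h2
      rw [Real.fourier_eq']
      simpa [hf, smul_eq_mul, neg_mul, mul_assoc] using h2
    refine ae_eq_zero_of_integral_contDiff_smul_eq_zero hfi.locallyIntegrable fun g g1 g2 => ?_
    have hg : IsTest Set.univ fun y => (g y : ℂ) := IsTest.ofReal g1 g2 (Set.subset_univ _)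
    have h3 := VectorFourier.integral_fourierIntegral_smul_eq_flip (μ := volume) (ν := volume)
      (L := innerₗ Plane) (e := Real.fourierChar) (f := f) (g := ift hg) Real.continuous_fourierChar
      continuous_inner hfi (ift hg).integrable
    have h4 : ∀ y, VectorFourier.fourierIntegral Real.fourierChar volume (innerₗ Plane) f y = 0 :=
      fun y => congrFun hF y
    have h5 : ∀ y, VectorFourier.fourierIntegral Real.fourierChar volume (innerₗ Plane).flip
        (ift hg) y = g y := by
      intro y
      rw [flip_innerₗ]
      change 𝓕 (ift hg : Plane → ℂ) y = _
      rw [← SchwartzMap.fourier_coe, ift, FourierTransform.fourier_fourierInv_eq]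
      rfl
    simp only [h4, h5, zero_smul, integral_zero] at h3
    rw [h3]
    congr 1
    funext y
    rw [Complex.real_smul, smul_eq_mul, mul_comm]
  -- every frequency is seen by some test function
  have hex : ∃ ψ : Plane → ℂ, IsTest Set.univ ψ ∧ ∫ y, ψ y = 1 := by
    let φ : ContDiffBump (0 : Plane) := ⟨1, 2, one_pos, one_lt_two⟩
    refine ⟨fun t => (φ.normed volume t : ℝ), IsTest.ofReal φ.contDiff_normed
      φ.hasCompactSupport_normed (Set.subset_univ _), ?_⟩
    rw [integral_complex_ofReal, φ.integral_normed, Complex.ofReal_one]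
  obtain ⟨ψ₀, hψ₀, h1⟩ := hex
  rw [ae_iff]
  refine measure_null_of_locally_null _ fun k₀ _ => ?_
  have hθ := hψ₀.smooth_mul (hchar (-k₀))
  have hne : ift hθ k₀ ≠ 0 := by
    rw [ift_apply]
    simp only [← mul_assoc, ← Complex.exp_add]
    simp [h1, inner_neg_right]
  have hopen : {k | ift hθ k ≠ 0} ∈ 𝓝 k₀ :=
    (isOpen_ne_fun (ift hθ).continuous continuous_const).mem_nhds hne
  refine ⟨{k | ¬G k = 0} ∩ {k | ift hθ k ≠ 0}, inter_mem_nhdsWithin _ hopen, ?_⟩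
  refine measure_mono_null ?_ (ae_iff.1 (step _ hθ))
  rintro k ⟨hk1, hk2⟩
  exact mul_ne_zero hk2 hk1

open scoped FourierTransform SchwartzMap LineDeriv

/-! ### Functions on slabs as functions on the plane with values in a Hilbert space -/

/-- Square integrable profiles in `x`. -/
abbrev Profile (I : Set ℝ) := Lp ℂ 2 ((volume : Measure ℝ).restrict I)

lemma eLpNorm_two_rpow {α E : Type*} [MeasurableSpace α] [NormedAddCommGroup E] {ν : Measure α}
    (f : α → E) : eLpNorm f 2 ν ^ (2 : ℝ) = ∫⁻ x, ‖f x‖ₑ ^ (2 : ℝ) ∂ν := by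
  simpa using eLpNorm_nnreal_pow_eq_lintegral (f := f) (μ := ν) (p := 2) (by norm_num)

lemma memLp_two_iff {α E : Type*} [MeasurableSpace α] [NormedAddCommGroup E] {ν : Measure α}
    {f : α → E} (hf : AEStronglyMeasurable f ν) :
    MemLp f 2 ν ↔ ∫⁻ x, ‖f x‖ₑ ^ (2 : ℝ) ∂ν < ⊤ := by
  rw [← eLpNorm_two_rpow, ENNReal.rpow_lt_top_iff_of_pos two_pos]
  exact ⟨fun h => h.2, fun h => ⟨hf, h⟩⟩

/-- An orthonormal set in a separable Hilbert space is countable. -/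
lemma countable_of_orthonormal {F : Type*} [NormedAddCommGroup F] [InnerProductSpace ℂ F]
    [TopologicalSpace.SeparableSpace F] {w : Set F}
    (h : Orthonormal ℂ (fun x : w => (x : F))) : Countable w := by
  refine Pairwise.countable_of_isOpen_disjoint (s := fun x : w => Metric.ball (x : F) (1 / 2))
    (fun x y hxy => ?_) (fun _ => Metric.isOpen_ball)
    fun x => ⟨x, Metric.mem_ball_self (by norm_num)⟩
  refine Metric.ball_disjoint_ball ?_
  have h1 : ‖(x : F) - y‖ ^ 2 = 2 := by
    have h2 : inner ℂ (x : F) (y : F) = 0 := h.2 hxy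
    have h3 : ‖(x : F)‖ = 1 := h.1 x
    have h4 : ‖(y : F)‖ = 1 := h.1 y
    rw [@norm_sub_sq ℂ, h2, h3, h4]
    norm_num
  rw [dist_eq_norm]
  nlinarith [norm_nonneg ((x : F) - y)]

instance (I : Set ℝ) : SecondCountableTopology (Profile I) :=
  haveI : Fact ((2 : ENNReal) ≠ ⊤) := ⟨by simp⟩
  inferInstance

open Classical in
/-- The slices of a function on a slab. They are square integrable for almost every `y`; the others
are replaced by zero. -/
def slice (I : Set ℝ) (u : Space → ℂ) (y : Plane) : Profile I :=
  if h : MemLp (fun x => u (x, y)) 2 (volume.restrict I) then h.toLp _ else 0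

section

variable {I : Set ℝ} {u : Space → ℂ} (hu : MemLp u 2 (volume.restrict {p : Space | p.1 ∈ I}))

include hu

lemma lintegral_slab_sq : ∫⁻ p in {p : Space | p.1 ∈ I}, ‖u p‖ₑ ^ (2 : ℝ) =
    ∫⁻ y : Plane, ∫⁻ x in I, ‖u (x, y)‖ₑ ^ (2 : ℝ) := by
  rw [restrict_fst_mem] at hu ⊢
  exact lintegral_prod_symm _ (hu.1.enorm.pow_const _)

lemma ae_memLp_slice : ∀ᵐ y : Plane, MemLp (fun x => u (x, y)) 2 (volume.restrict I) := by
  have h1 := (memLp_two_iff hu.1).1 hu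
  rw [lintegral_slab_sq hu] at h1
  have h2 := hu.1
  rw [restrict_fst_mem] at h2
  have h3 : AEMeasurable (fun y : Plane => ∫⁻ x in I, ‖u (x, y)‖ₑ ^ (2 : ℝ)) volume := by
    have := (h2.prod_swap.enorm.pow_const (2 : ℝ)).lintegral_prod_right'
    exact this
  filter_upwards [h2.prodMk_right, ae_lt_top' h3 h1.ne] with y hy1 hy2
  exact (memLp_two_iff hy1).2 hy2

lemma ae_slice_eq : ∀ᵐ y : Plane, slice I u y =ᵐ[volume.restrict I] fun x => u (x, y) := by
  filter_upwards [ae_memLp_slice hu] with y hy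
  rw [slice, dif_pos hy]
  exact hy.coeFn_toLp

lemma ae_enorm_slice : ∀ᵐ y : Plane,
    ‖slice I u y‖ₑ ^ (2 : ℝ) = ∫⁻ x in I, ‖u (x, y)‖ₑ ^ (2 : ℝ) := by
  filter_upwards [ae_slice_eq hu] with y hy
  rw [Lp.enorm_def, eLpNorm_two_rpow]
  exact lintegral_congr_ae (hy.mono fun x hx => by simp only [hx])

lemma aestronglyMeasurable_slice : AEStronglyMeasurable (slice I u) volume := by
  obtain ⟨w, b, hb⟩ := exists_hilbertBasis ℂ (Profile I)
  have hw : Countable w := countable_of_orthonormal (hb ▸ b.orthonormal)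
  refine aestronglyMeasurable_of_tendsto_ae (atTop : Filter (Finset w))
    (f := fun s y => ∑ i ∈ s, (∫ x in I, (starRingEnd ℂ) ((b i : Profile I) x) * u (x, y)) • b i)
    (fun s => ?_) ?_
  · have hmeas : ∀ i, AEStronglyMeasurable
        (fun y : Plane => ∫ x in I, (starRingEnd ℂ) ((b i : Profile I) x) * u (x, y)) volume := by
      intro i
      have h1 : AEStronglyMeasurable
          (fun p : Space => (starRingEnd ℂ) ((b i : Profile I) p.1) * u p)
          ((volume.restrict I).prod volume) := by
        rw [← restrict_fst_mem]
        refine AEStronglyMeasurable.mul ?_ hu.1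
        rw [restrict_fst_mem]
        exact (Complex.continuous_conj.comp_aestronglyMeasurable
          (Lp.aestronglyMeasurable _)).comp_fst
      exact h1.prod_swap.integral_prod_right'
    exact Finset.aestronglyMeasurable_fun_sum _ fun i _ => (hmeas i).smul_const _
  · filter_upwards [ae_slice_eq hu] with y hy
    have h1 := b.hasSum_repr (slice I u y)
    refine h1.congr fun s => ?_
    refine Finset.sum_congr rfl fun i _ => ?_
    change b.repr (slice I u y) i • b i = _
    rw [b.repr_apply_apply, L2.inner_def]
    congr 1
    refine integral_congr_ae (hy.mono fun x hx => ?_)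
    simp only [RCLike.inner_apply', hx]

lemma lintegral_slice : ∫⁻ y, ‖slice I u y‖ₑ ^ (2 : ℝ) =
    ∫⁻ p in {p : Space | p.1 ∈ I}, ‖u p‖ₑ ^ (2 : ℝ) := by
  rw [lintegral_slab_sq hu]
  exact lintegral_congr_ae (ae_enorm_slice hu)

lemma memLp_slice : MemLp (slice I u) 2 volume := by
  rw [memLp_two_iff (aestronglyMeasurable_slice hu), lintegral_slice hu]
  exact (memLp_two_iff hu.1).1 hu

/-- The partial Fourier transform in the tangential variables. -/
def ft : Lp (Profile I) 2 (volume : Measure Plane) := 𝓕 ((memLp_slice hu).toLp (slice I u))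

/-- Plancherel's theorem. -/
lemma lintegral_ft : ∫⁻ k, ‖ft hu k‖ₑ ^ (2 : ℝ) =
    ∫⁻ p in {p : Space | p.1 ∈ I}, ‖u p‖ₑ ^ (2 : ℝ) := by
  rw [← lintegral_slice hu, ← eLpNorm_two_rpow, ← eLpNorm_two_rpow, ← Lp.enorm_def, ft,
    ← eLpNorm_congr_ae (memLp_slice hu).coeFn_toLp, ← Lp.enorm_def]
  congr 1
  rw [← ofReal_norm, ← ofReal_norm, Lp.norm_fourier_eq]

end

/-- The bilinear pairing of profiles. -/
def pair {I : Set ℝ} (χ : Profile I) : Profile I →L[ℂ] ℂ := innerSL ℂ (star χ)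

lemma pair_apply {I : Set ℝ} (χ f : Profile I) : pair χ f = ∫ x in I, χ x * f x := by
  rw [pair, innerSL_apply_apply, L2.inner_def]
  refine integral_congr_ae ?_
  filter_upwards [Lp.coeFn_star χ] with x hx
  simp [hx, mul_comm]

/-- The pairing of a function on a slab with a product of functions of `x` and of `(y, z)`, on the
Fourier side. -/
lemma integral_slab_eq_integral_ft {I : Set ℝ} {u : Space → ℂ}
    (hu : MemLp u 2 (volume.restrict {p : Space | p.1 ∈ I})) (χ : Profile I) {ψ : Plane → ℂ}
    (hψ : IsTest Set.univ ψ) :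
    ∫ p in {p : Space | p.1 ∈ I}, χ p.1 * ψ p.2 * u p = ∫ k, ift hψ k * pair χ (ft hu k) := by
  set s : 𝓢(Plane, ℂ) := hψ.compact.toSchwartzMap hψ.smooth with hs
  set U : Lp (Profile I) 2 (volume : Measure Plane) := (memLp_slice hu).toLp (slice I u) with hU
  have hdual : ∫ y, s y • U y = ∫ k, ift hψ k • ft hu k := by
    have h1 := Lp.fourier_toTemperedDistribution_eq U
    have h2 := congrArg (fun T => T (ift hψ)) h1
    simp only [TemperedDistribution.fourier_apply, Lp.toTemperedDistribution_apply] at h2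
    rw [ift, FourierTransform.fourier_fourierInv_eq] at h2
    exact h2
  have i1 : Integrable (fun y => s y • U y) := by
    have := MemLp.integrable_mul (p := 2) (q := 2) ((s.memLp 2 volume).norm) ((Lp.memLp U).norm)
    refine (integrable_norm_iff ?_).1 (by simp only [norm_smul]; exact this)
    exact s.continuous.aestronglyMeasurable.smul (Lp.aestronglyMeasurable U)
  have i2 : Integrable (fun k => ift hψ k • ft hu k) := by
    have := MemLp.integrable_mul (p := 2) (q := 2) (((ift hψ).memLp 2 volume).norm)
      ((Lp.memLp (ft hu)).norm)
    refine (integrable_norm_iff ?_).1 (by simp only [norm_smul]; exact this)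
    exact (ift hψ).continuous.aestronglyMeasurable.smul (Lp.aestronglyMeasurable (ft hu))
  have h3 := congrArg (pair χ) hdual
  rw [← (pair χ).integral_comp_comm i1, ← (pair χ).integral_comp_comm i2] at h3
  simp only [map_smul, smul_eq_mul] at h3
  rw [← h3]
  have hint : Integrable (fun p : Space => χ p.1 * ψ p.2 * u p)
      ((volume.restrict I).prod volume) := by
    have hm : MemLp (fun p : Space => χ p.1 * ψ p.2) 2 ((volume.restrict I).prod volume) := by
      refine (memLp_two_iff ?_).2 ?_
      · exact (Lp.aestronglyMeasurable χ).comp_fst.mul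
          hψ.continuous.aestronglyMeasurable.comp_snd
      · simp only [enorm_mul, ENNReal.mul_rpow_of_nonneg _ _ (zero_le_two (α := ℝ))]
        rw [lintegral_prod_mul ((Lp.aestronglyMeasurable χ).enorm.pow_const _)
          (hψ.continuous.aestronglyMeasurable.enorm.pow_const _)]
        exact ENNReal.mul_lt_top ((memLp_two_iff (Lp.aestronglyMeasurable χ)).1 (Lp.memLp χ))
          ((memLp_two_iff hψ.continuous.aestronglyMeasurable).1
            (hψ.continuous.memLp_of_hasCompactSupport hψ.compact))
    rw [restrict_fst_mem] at hu
    exact hm.integrable_mul hu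
  rw [restrict_fst_mem, integral_prod_symm _ hint]
  refine integral_congr_ae ?_
  filter_upwards [ae_slice_eq hu, (memLp_slice hu).coeFn_toLp] with y hy1 hy2
  rw [hU, hy2, pair_apply, ← integral_const_mul]
  refine integral_congr_ae (hy1.mono fun x hx => ?_)
  simp only [hx, hs]
  change χ x * ψ y * u (x, y) = ψ y * (χ x * u (x, y))
  ring

/-! ### The Maxwell system on almost every frequency -/

lemma pair_comm {I : Set ℝ} (χ f : Profile I) : pair χ f = pair f χ := by
  rw [pair_apply, pair_apply]
  simp only [mul_comm]

lemma pair_toLp {I : Set ℝ} {χ : ℝ → ℂ} (hχ : MemLp χ 2 (volume.restrict I)) (f : Profile I) :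
    pair (hχ.toLp χ) f = ∫ x in I, f x * χ x := by
  rw [pair_apply]
  refine integral_congr_ae (hχ.coeFn_toLp.mono fun x hx => ?_)
  simp only [hx, mul_comm]

lemma IsTest.memLp {I : Set ℝ} {η : ℝ → ℂ} (hη : IsTest I η) : MemLp η 2 (volume.restrict I) :=
  hη.continuous.memLp_of_hasCompactSupport hη.compact

/-- A test function as a square integrable profile. -/
def IsTest.profile {I : Set ℝ} {η : ℝ → ℂ} (hη : IsTest I η) : Profile I := hη.memLp.toLp η

lemma pair_profile {I : Set ℝ} {η : ℝ → ℂ} (hη : IsTest I η) (f : Profile I) :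
    pair hη.profile f = ∫ x in I, f x * η x := pair_toLp hη.memLp f

lemma integral_slab_mul {I : Set ℝ} {u : Space → ℂ}
    (hu : MemLp u 2 (volume.restrict {p : Space | p.1 ∈ I})) {χ : ℝ → ℂ}
    (hχ : MemLp χ 2 (volume.restrict I)) {ψ : Plane → ℂ} (hψ : IsTest Set.univ ψ) :
    ∫ p in {p : Space | p.1 ∈ I}, χ p.1 * ψ p.2 * u p =
      ∫ k, ift hψ k * pair (hχ.toLp χ) (ft hu k) := by
  rw [← integral_slab_eq_integral_ft, restrict_fst_mem]
  refine integral_congr_ae ?_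
  filter_upwards [Measure.quasiMeasurePreserving_fst.ae_eq_comp hχ.coeFn_toLp] with p hp
  simp only [Function.comp] at hp
  rw [hp]

lemma integrable_ift_mul {I : Set ℝ} {u : Space → ℂ}
    (hu : MemLp u 2 (volume.restrict {p : Space | p.1 ∈ I})) (χ : Profile I) {ψ : Plane → ℂ}
    (hψ : IsTest Set.univ ψ) : Integrable (fun k => ift hψ k * pair χ (ft hu k)) :=
  ((ift hψ).memLp 2 volume).integrable_mul ((pair χ).comp_memLp' (Lp.memLp (ft hu)))

/-- The weak derivative as a relation between square integrable profiles. -/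
def weakDeriv (I : Set ℝ) : Submodule ℂ (Profile I × Profile I) where
  carrier := {w | ∀ (η : ℝ → ℂ) (hη : IsTest I η),
    pair hη.deriv.profile w.1 + pair hη.profile w.2 = 0}
  add_mem' := by
    intro v w hv hw η hη
    simp only [Prod.fst_add, Prod.snd_add, map_add]
    linear_combination hv η hη + hw η hη
  zero_mem' := by
    intro η hη
    simp
  smul_mem' := by
    intro c v hv η hη
    simp only [Prod.smul_fst, Prod.smul_snd, map_smul, smul_eq_mul]
    linear_combination c * hv η hη

lemma mem_weakDeriv {I : Set ℝ} {f g : Profile I} :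
    (f, g) ∈ weakDeriv I ↔ HasWeakDeriv I f g := by
  refine forall₂_congr fun η hη => ?_
  rw [pair_profile, pair_profile, add_eq_zero_iff_eq_neg]

lemma weakDeriv_zero {I : Set ℝ} (hI : IsOpen I) {v : Profile I} (h : (0, v) ∈ weakDeriv I) :
    v = 0 := by
  have h1 : ∀ᵐ x, x ∈ I → v x = 0 := by
    refine hI.ae_eq_zero_of_integral_contDiff_smul_eq_zero ?_ fun g g1 g2 g3 => ?_
    · exact locallyIntegrableOn_of_locallyIntegrable_restrict
        ((Lp.memLp v).locallyIntegrable (by norm_num))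
    · have hη : IsTest I fun x => (g x : ℂ) := IsTest.ofReal g1 g2 g3
      have h2 := h _ hη
      simp only [map_zero, zero_add] at h2
      rw [pair_profile, hη.setIntegral_mul] at h2
      rw [← h2]
      congr 1
      funext x
      rw [Complex.real_smul, mul_comm]
  refine Lp.ext ?_
  filter_upwards [(ae_restrict_iff' hI.measurableSet).2 h1, Lp.coeFn_zero ℂ 2 (volume.restrict I)]
    with x hx hx0
  rw [hx, hx0]
  rfl

/-- Countably many test functions suffice for the weak derivative, so that it may be verified for
each of them on almost every frequency. -/
lemma ae_mem_weakDeriv {I : Set ℝ} {f g : Plane → Profile I}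
    (h : ∀ (η : ℝ → ℂ) (hη : IsTest I η),
      ∀ᵐ k, pair hη.deriv.profile (f k) + pair hη.profile (g k) = 0) :
    ∀ᵐ k, (f k, g k) ∈ weakDeriv I := by
  let T : Set (Profile I × Profile I) :=
    {w | ∃ (η : ℝ → ℂ) (hη : IsTest I η), w = (hη.deriv.profile, hη.profile)}
  have hsep : TopologicalSpace.IsSeparable T := TopologicalSpace.IsSeparable.of_separableSpace T
  obtain ⟨t, htT, htc, htd⟩ := hsep.exists_countable_dense_subset
  have h1 : ∀ᵐ k, ∀ w ∈ t, pair w.1 (f k) + pair w.2 (g k) = 0 := by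
    refine (ae_ball_iff htc).2 fun w hw => ?_
    obtain ⟨η, hη, hw'⟩ := htT hw
    rw [hw']
    exact h η hη
  filter_upwards [h1] with k hk η hη
  have hcont : Continuous fun w : Profile I × Profile I => pair (f k) w.1 + pair (g k) w.2 :=
    ((pair (f k)).continuous.comp continuous_fst).add ((pair (g k)).continuous.comp continuous_snd)
  have hclosed : IsClosed {w : Profile I × Profile I | pair (f k) w.1 + pair (g k) w.2 = 0} :=
    isClosed_eq hcont continuous_const
  have hsub : t ⊆ {w : Profile I × Profile I | pair (f k) w.1 + pair (g k) w.2 = 0} := by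
    intro w hw
    have := hk w hw
    rw [pair_comm, pair_comm w.2] at this
    exact this
  have hT : (hη.deriv.profile, hη.profile) ∈ T := ⟨η, hη, rfl⟩
  have h2 := closure_minimal hsub hclosed (htd hT)
  rw [pair_comm, pair_comm hη.profile]
  exact h2

/-- The wave vector of the frequency variable of the Fourier transform. -/
def wave (k : Plane) : Plane := (2 * Real.pi) • k

lemma integral_slab_profile {I : Set ℝ} {u : Space → ℂ}
    (hu : MemLp u 2 (volume.restrict {p : Space | p.1 ∈ I})) {η : ℝ → ℂ}
    (hη : IsTest I η) {ψ : Plane → ℂ} (hψ : IsTest Set.univ ψ) :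
    ∫ k, ift hψ k * pair hη.profile (ft hu k) =
      ∫ p in {p : Space | p.1 ∈ I}, η p.1 * ψ p.2 * u p :=
  (integral_slab_mul hu hη.memLp hψ).symm

lemma ift_fderiv_single {ψ : Plane → ℂ} (hψ : IsTest Set.univ ψ) (k : Plane) (j : Fin 2) :
    ift (hψ.fderiv_apply (EuclideanSpace.single j 1)) k = -tang (wave k) j * ift hψ k := by
  rw [ift_fderiv hψ, EuclideanSpace.inner_single_right]
  simp [tang, wave]

section

variable {I : Set ℝ} {F F' : Space → CVec} {c : ℂ}

/-- The weak form of the equation `curl F = c F'` for separated test fields. -/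
lemma HasWeakCurl.tensor (h : HasWeakCurl {p : Space | p.1 ∈ I} F fun p => c • F' p) {η : ℝ → ℂ}
    (hη : IsTest I η) {ψ : Plane → ℂ} (hψ : IsTest Set.univ ψ) (v : CVec) :
    ∫ p in {p : Space | p.1 ∈ I}, F p ⬝ᵥ ((deriv η p.1 * ψ p.2) • (ex ⨯₃ v) +
      η p.1 • (gradT ψ p.2 ⨯₃ v)) =
    c * ∫ p in {p : Space | p.1 ∈ I}, η p.1 * ψ p.2 * (F' p ⬝ᵥ v) := by
  have h1 := h _ (isTestField_tensor hη hψ v)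
  simp only [curl_tensor hη hψ] at h1
  rw [h1, ← integral_const_mul]
  congr 1
  funext p
  simp only [smul_dotProduct, dotProduct_smul, smul_eq_mul]
  ring

lemma integrable_tensor {u : Space → ℂ} (hu : MemLp u 2 (volume.restrict {p : Space | p.1 ∈ I}))
    {η : ℝ → ℂ} (hη : IsTest I η) {ψ : Plane → ℂ} (hψ : IsTest Set.univ ψ) :
    Integrable (fun p => η p.1 * ψ p.2 * u p) (volume.restrict {p : Space | p.1 ∈ I}) :=
  MemLp.integrable_mul (p := 2) (q := 2)
    ((hη.tensor hψ).continuous.memLp_of_hasCompactSupport (hη.tensor hψ).compact) hu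

lemma integral_add_mul_add_mul {A B C : Plane → ℂ} (hA : Integrable A) (hB : Integrable B)
    (hC : Integrable C) (b c : ℂ) :
    Integrable (fun k => A k + b * B k + c * C k) ∧
      ∫ k, A k + b * B k + c * C k = (∫ k, A k) + b * (∫ k, B k) + c * ∫ k, C k := by
  have h1 : Integrable (fun k => A k + b * B k) := hA.add (hB.const_mul b)
  have h2 : Integrable (fun k => c * C k) := hC.const_mul c
  refine ⟨h1.add h2, ?_⟩
  rw [integral_add h1 h2, integral_add hA (hB.const_mul b), integral_const_mul, integral_const_mul]

/-- The equation `curl F = c F'` on almost every frequency. -/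
lemma HasWeakCurl.ae_ft (hI : IsOpen I)
    (hF : ∀ i, MemLp (fun p => F p i) 2 (volume.restrict {p : Space | p.1 ∈ I}))
    (hF' : ∀ i, MemLp (fun p => F' p i) 2 (volume.restrict {p : Space | p.1 ∈ I}))
    (h : HasWeakCurl {p : Space | p.1 ∈ I} F fun p => c • F' p) : ∀ᵐ k,
      tang (wave k) 0 • ft (hF 2) k - tang (wave k) 1 • ft (hF 1) k = c • ft (hF' 0) k ∧
      (ft (hF 2) k, tang (wave k) 1 • ft (hF 0) k - c • ft (hF' 1) k) ∈ weakDeriv I ∧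
      (ft (hF 1) k, tang (wave k) 0 • ft (hF 0) k + c • ft (hF' 2) k) ∈ weakDeriv I := by
  -- the transforms of the terms of the weak form
  have t0 : ∀ {η : ℝ → ℂ} (hη : IsTest I η) {ψ : Plane → ℂ} (hψ : IsTest Set.univ ψ) (i j),
      ∫ k, ift hψ k * (tang (wave k) j * pair hη.profile (ft (hF i) k)) =
      -∫ p in {p : Space | p.1 ∈ I},
        η p.1 * fderiv ℝ ψ p.2 (EuclideanSpace.single j 1) * F p i := by
    intro η hη ψ hψ i j
    rw [← integral_slab_profile (hF i) hη (hψ.fderiv_apply (EuclideanSpace.single j 1)),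
      ← integral_neg]
    congr 1
    funext k
    rw [ift_fderiv_single hψ]
    ring
  have i0 : ∀ {η : ℝ → ℂ} (hη : IsTest I η) {ψ : Plane → ℂ} (hψ : IsTest Set.univ ψ) (i j),
      Integrable fun k => ift hψ k * (tang (wave k) j * pair hη.profile (ft (hF i) k)) := by
    intro η hη ψ hψ i j
    refine (integrable_ift_mul (hF i) hη.profile
      (hψ.fderiv_apply (EuclideanSpace.single j 1))).neg.congr (.of_forall fun k => ?_)
    simp only [Pi.neg_apply]
    rw [ift_fderiv_single hψ]
    ring
  have hx : ∀ᵐ k, ((0 : Profile I), tang (wave k) 0 • ft (hF 2) k - tang (wave k) 1 • ft (hF 1) k -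
      c • ft (hF' 0) k) ∈ weakDeriv I := by
    refine ae_mem_weakDeriv fun η hη => ?_
    have e : ∀ (ψ : Plane → ℂ) (hψ : IsTest Set.univ ψ), (fun k => ift hψ k *
        (pair hη.deriv.profile 0 + pair hη.profile (tang (wave k) 0 • ft (hF 2) k -
          tang (wave k) 1 • ft (hF 1) k - c • ft (hF' 0) k))) = fun k =>
        ift hψ k * (tang (wave k) 0 * pair hη.profile (ft (hF 2) k)) +
        -1 * (ift hψ k * (tang (wave k) 1 * pair hη.profile (ft (hF 1) k))) +
        -c * (ift hψ k * pair hη.profile (ft (hF' 0) k)) := by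
      intro ψ hψ
      funext k
      simp only [map_zero, zero_add, map_sub, map_smul, smul_eq_mul]
      ring
    have key := fun {ψ : Plane → ℂ} (hψ : IsTest Set.univ ψ) => integral_add_mul_add_mul
      (i0 hη hψ 2 0) (i0 hη hψ 1 1) (integrable_ift_mul (hF' 0) hη.profile hψ) (-1) (-c)
    refine ae_eq_zero_of_forall_integral_ift (fun ψ hψ => ?_) (fun ψ hψ => ?_)
    · rw [e ψ hψ]
      exact (key hψ).1
    · have h1 := h.tensor hη hψ ![1, 0, 0]
      have h2 : ∀ p : Space, F p ⬝ᵥ ((deriv η p.1 * ψ p.2) • (ex ⨯₃ ![1, 0, 0]) +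
          η p.1 • (gradT ψ p.2 ⨯₃ ![1, 0, 0])) =
          η p.1 * fderiv ℝ ψ p.2 (EuclideanSpace.single 1 1) * F p 1 -
          η p.1 * fderiv ℝ ψ p.2 (EuclideanSpace.single 0 1) * F p 2 := by
        intro p
        simp [gradT, ex, crossProduct, dotProduct, Fin.sum_univ_three]
        ring
      have h3 : ∀ p : Space, F' p ⬝ᵥ ![1, 0, 0] = F' p 0 := by
        intro p
        simp [dotProduct, Fin.sum_univ_three]
      simp only [h2, h3] at h1
      rw [integral_sub (integrable_tensor (hF 1) hη (hψ.fderiv_apply _))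
        (integrable_tensor (hF 2) hη (hψ.fderiv_apply _))] at h1
      rw [e ψ hψ, (key hψ).2,
        t0 hη hψ, t0 hη hψ, integral_slab_profile (hF' 0) hη hψ]
      linear_combination h1
  have hy : ∀ᵐ k, (ft (hF 2) k, tang (wave k) 1 • ft (hF 0) k - c • ft (hF' 1) k) ∈
      weakDeriv I := by
    refine ae_mem_weakDeriv fun η hη => ?_
    have e : ∀ (ψ : Plane → ℂ) (hψ : IsTest Set.univ ψ), (fun k => ift hψ k *
        (pair hη.deriv.profile (ft (hF 2) k) + pair hη.profile
          (tang (wave k) 1 • ft (hF 0) k - c • ft (hF' 1) k))) = fun k =>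
        ift hψ k * pair hη.deriv.profile (ft (hF 2) k) +
        1 * (ift hψ k * (tang (wave k) 1 * pair hη.profile (ft (hF 0) k))) +
        -c * (ift hψ k * pair hη.profile (ft (hF' 1) k)) := by
      intro ψ hψ
      funext k
      simp only [map_sub, map_smul, smul_eq_mul]
      ring
    have key := fun {ψ : Plane → ℂ} (hψ : IsTest Set.univ ψ) => integral_add_mul_add_mul
      (integrable_ift_mul (hF 2) hη.deriv.profile hψ) (i0 hη hψ 0 1)
      (integrable_ift_mul (hF' 1) hη.profile hψ) 1 (-c)
    refine ae_eq_zero_of_forall_integral_ift (fun ψ hψ => ?_) (fun ψ hψ => ?_)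
    · rw [e ψ hψ]
      exact (key hψ).1
    · have h1 := h.tensor hη hψ ![0, 1, 0]
      have h2 : ∀ p : Space, F p ⬝ᵥ ((deriv η p.1 * ψ p.2) • (ex ⨯₃ ![0, 1, 0]) +
          η p.1 • (gradT ψ p.2 ⨯₃ ![0, 1, 0])) =
          deriv η p.1 * ψ p.2 * F p 2 -
          η p.1 * fderiv ℝ ψ p.2 (EuclideanSpace.single 1 1) * F p 0 := by
        intro p
        simp [gradT, ex, crossProduct, dotProduct, Fin.sum_univ_three]
        ring
      have h3 : ∀ p : Space, F' p ⬝ᵥ ![0, 1, 0] = F' p 1 := by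
        intro p
        simp [dotProduct, Fin.sum_univ_three]
      simp only [h2, h3] at h1
      rw [integral_sub (integrable_tensor (hF 2) hη.deriv hψ)
        (integrable_tensor (hF 0) hη (hψ.fderiv_apply _))] at h1
      rw [e ψ hψ, (key hψ).2,
        t0 hη hψ, integral_slab_profile (hF' 1) hη hψ,
        integral_slab_profile (hF 2) hη.deriv hψ]
      linear_combination h1
  have hz : ∀ᵐ k, (ft (hF 1) k, tang (wave k) 0 • ft (hF 0) k + c • ft (hF' 2) k) ∈
      weakDeriv I := by
    refine ae_mem_weakDeriv fun η hη => ?_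
    have e : ∀ (ψ : Plane → ℂ) (hψ : IsTest Set.univ ψ), (fun k => ift hψ k *
        (pair hη.deriv.profile (ft (hF 1) k) + pair hη.profile
          (tang (wave k) 0 • ft (hF 0) k + c • ft (hF' 2) k))) = fun k =>
        ift hψ k * pair hη.deriv.profile (ft (hF 1) k) +
        1 * (ift hψ k * (tang (wave k) 0 * pair hη.profile (ft (hF 0) k))) +
        c * (ift hψ k * pair hη.profile (ft (hF' 2) k)) := by
      intro ψ hψ
      funext k
      simp only [map_add, map_smul, smul_eq_mul]
      ring
    have key := fun {ψ : Plane → ℂ} (hψ : IsTest Set.univ ψ) => integral_add_mul_add_mul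
      (integrable_ift_mul (hF 1) hη.deriv.profile hψ) (i0 hη hψ 0 0)
      (integrable_ift_mul (hF' 2) hη.profile hψ) 1 c
    refine ae_eq_zero_of_forall_integral_ift (fun ψ hψ => ?_) (fun ψ hψ => ?_)
    · rw [e ψ hψ]
      exact (key hψ).1
    · have h1 := h.tensor hη hψ ![0, 0, 1]
      have h2 : ∀ p : Space, F p ⬝ᵥ ((deriv η p.1 * ψ p.2) • (ex ⨯₃ ![0, 0, 1]) +
          η p.1 • (gradT ψ p.2 ⨯₃ ![0, 0, 1])) =
          η p.1 * fderiv ℝ ψ p.2 (EuclideanSpace.single 0 1) * F p 0 -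
          deriv η p.1 * ψ p.2 * F p 1 := by
        intro p
        simp [gradT, ex, crossProduct, dotProduct, Fin.sum_univ_three]
        ring
      have h3 : ∀ p : Space, F' p ⬝ᵥ ![0, 0, 1] = F' p 2 := by
        intro p
        simp [dotProduct, Fin.sum_univ_three]
      simp only [h2, h3] at h1
      rw [integral_sub (integrable_tensor (hF 0) hη (hψ.fderiv_apply _))
        (integrable_tensor (hF 1) hη.deriv hψ)] at h1
      rw [e ψ hψ, (key hψ).2,
        t0 hη hψ, integral_slab_profile (hF' 2) hη hψ,
        integral_slab_profile (hF 1) hη.deriv hψ]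
      linear_combination -h1
  filter_upwards [hx, hy, hz] with k h1 h2 h3
  exact ⟨sub_eq_zero.1 (weakDeriv_zero hI h1), h2, h3⟩

end

/-! ### Exponential profiles -/

/-- The exponential profile with rate `m` and value `1` at `a`. -/
def expAt (m : ℂ) (a x : ℝ) : ℂ := Complex.exp (m * (x - a : ℝ))

lemma expAt_self (m : ℂ) (a : ℝ) : expAt m a a = 1 := by simp [expAt]

lemma continuous_expAt (m : ℂ) (a : ℝ) : Continuous (expAt m a) := by
  unfold expAt
  fun_prop

lemma norm_expAt (m : ℂ) (a x : ℝ) : ‖expAt m a x‖ = Real.exp (m.re * (x - a)) := by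
  rw [expAt, Complex.norm_exp, Complex.re_mul_ofReal]

lemma norm_expAt_le {s a x : ℝ} {m : ℂ} (hm : 0 < m.re) (hx : s * (x - a) ≤ 0) :
    ‖expAt (s * m) a x‖ ≤ 1 := by
  rw [norm_expAt, Real.exp_le_one_iff, Complex.re_ofReal_mul]
  nlinarith

lemma hasDerivAt_expAt (m : ℂ) (a x : ℝ) : HasDerivAt (expAt m a) (m * expAt m a x) x := by
  have h1 : HasDerivAt (fun x : ℝ => ((x - a : ℝ) : ℂ)) 1 x := by
    simpa using ((hasDerivAt_id x).sub_const a).ofReal_comp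
  have h2 := (h1.const_mul m).cexp
  rw [mul_one, mul_comm] at h2
  exact h2

lemma hasWeakDeriv_expAt (I : Set ℝ) (m : ℂ) (a : ℝ) :
    HasWeakDeriv I (expAt m a) fun x => m * expAt m a x := by
  intro η hη
  rw [hη.deriv.setIntegral_mul, hη.setIntegral_mul]
  have hint : ∀ {f g : ℝ → ℂ}, Continuous f → IsTest I g → Integrable fun x => f x * g x :=
    fun hf hg => (hf.mul hg.continuous).integrable_of_hasCompactSupport hg.compact.mul_left
  exact integral_mul_deriv_eq_deriv_mul_of_integrable (fun x _ => hasDerivAt_expAt m a x)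
    (fun x _ => hη.hasDerivAt x) (hint (continuous_expAt m a) hη.deriv)
    (hint ((continuous_expAt m a).const_mul m) hη) (hint (continuous_expAt m a) hη)

/-- The eigenfunctions of the weak derivative are exponential functions. -/
lemma exists_eq_expAt_of_mem_weakDeriv {I : Set ℝ} (hI : IsOpen I) (hI' : I.OrdConnected) {m : ℂ}
    {w : Profile I} (h : (w, m • w) ∈ weakDeriv I) (a : ℝ) :
    ∃ C : ℂ, ∀ᵐ x ∂volume.restrict I, w x = C * expAt m a x := by
  rw [mem_weakDeriv] at h
  have h1 : HasWeakDeriv I w fun x => m * w x := by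
    intro η hη
    rw [h η hη]
    congr 1
    refine integral_congr_ae ((Lp.coeFn_smul m w).mono fun x hx => ?_)
    simp only [hx, Pi.smul_apply, smul_eq_mul]
  obtain ⟨C, hC⟩ := h1.exists_eq_exp hI hI' (locallyIntegrableOn_of_locallyIntegrable_restrict
    ((Lp.memLp w).locallyIntegrable (by norm_num)))
  refine ⟨C * Complex.exp (m * a), ?_⟩
  filter_upwards [(ae_restrict_iff' hI.measurableSet).2 hC] with x hx
  rw [hx, expAt, mul_assoc, ← Complex.exp_add]
  congr 2
  push_cast
  ring

/-- An exponential function is not square integrable where it does not decay. -/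
lemma eq_zero_of_mem_weakDeriv {I K : Set ℝ} (hI : IsOpen I) (hI' : I.OrdConnected) {m : ℂ}
    {w : Profile I} (h : (w, m • w) ∈ weakDeriv I) (hK : MeasurableSet K) (hKI : K ⊆ I)
    (hKtop : volume K = ⊤) {a : ℝ} (hm : ∀ x ∈ K, 0 ≤ m.re * (x - a)) : w = 0 := by
  obtain ⟨C, hC⟩ := exists_eq_expAt_of_mem_weakDeriv hI hI' h a
  have hC0 : C = 0 := by
    have h1 : MemLp (fun x => C * expAt m a x) 2 (volume.restrict K) :=
      ((memLp_congr_ae hC).1 (Lp.memLp w)).mono_measure (Measure.restrict_mono hKI le_rfl)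
    have h2 : MemLp (fun _ : ℝ => C) 2 (volume.restrict K) := by
      refine h1.mono aestronglyMeasurable_const ?_
      filter_upwards [ae_restrict_mem hK] with x hx
      rw [norm_mul, norm_expAt]
      exact le_mul_of_one_le_right (norm_nonneg _) (Real.one_le_exp (hm x hx))
    refine ((memLp_const_iff (by norm_num) (by norm_num)).1 h2).resolve_right ?_
    rw [Measure.restrict_apply_univ, hKtop]
    exact lt_irrefl _
  refine Lp.ext ?_
  filter_upwards [hC, Lp.coeFn_zero ℂ 2 (volume.restrict I)] with x hx hx0
  rw [hx, hx0, hC0, zero_mul]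
  rfl

/-- `I` is the half-line with boundary point `a` on which `s (x - a) < 0`, where `s = ±1` is the
outward unit normal. -/
def IsHalfLine (I : Set ℝ) (a s : ℝ) : Prop :=
  s = 1 ∧ I = Set.Iio a ∨ s = -1 ∧ I = Set.Ioi a

namespace IsHalfLine

variable {I : Set ℝ} {a s : ℝ}

lemma isOpen (h : IsHalfLine I a s) : IsOpen I := by
  obtain ⟨-, rfl⟩ | ⟨-, rfl⟩ := h
  exacts [isOpen_Iio, isOpen_Ioi]

lemma ordConnected (h : IsHalfLine I a s) : I.OrdConnected := by
  obtain ⟨-, rfl⟩ | ⟨-, rfl⟩ := h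
  exacts [Set.ordConnected_Iio, Set.ordConnected_Ioi]

lemma volume_eq (h : IsHalfLine I a s) : volume I = ⊤ := by
  obtain ⟨-, rfl⟩ | ⟨-, rfl⟩ := h
  exacts [Real.volume_Iio, Real.volume_Ioi]

lemma sq_eq (h : IsHalfLine I a s) : s * s = 1 := by
  obtain ⟨rfl, -⟩ | ⟨rfl, -⟩ := h <;> norm_num

lemma mul_sub_neg (h : IsHalfLine I a s) {x : ℝ} (hx : x ∈ I) : s * (x - a) < 0 := by
  obtain ⟨rfl, rfl⟩ | ⟨rfl, rfl⟩ := h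
  · linarith [Set.mem_Iio.1 hx]
  · linarith [Set.mem_Ioi.1 hx]

/-- The square of the `L²` norm of a decaying exponential function on a half-line. -/
lemma lintegral_expAt (h : IsHalfLine I a s) {m : ℂ} (hm : 0 < m.re) :
    ∫⁻ x in I, ‖expAt (s * m) a x‖ₑ ^ (2 : ℝ) = ENNReal.ofReal (1 / (2 * m.re)) := by
  have e : ∀ x, ‖expAt (s * m) a x‖ₑ ^ (2 : ℝ) =
      ENNReal.ofReal (Real.exp (-(2 * s * m.re * a)) * Real.exp (2 * s * m.re * x)) := by
    intro x
    rw [← ofReal_norm, norm_expAt, ENNReal.ofReal_rpow_of_nonneg (Real.exp_pos _).le two_pos.le,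
      ← Real.exp_mul, ← Real.exp_add, Complex.re_ofReal_mul]
    congr 2
    ring
  simp only [e]
  obtain ⟨rfl, rfl⟩ | ⟨rfl, rfl⟩ := h
  · have hp : 0 < 2 * 1 * m.re := by linarith
    rw [restrict_Iio_eq_restrict_Iic, ← ofReal_integral_eq_lintegral_ofReal
      ((integrableOn_exp_mul_Iic hp a).const_mul _) (.of_forall fun x => by positivity),
      integral_const_mul, integral_exp_mul_Iic hp, mul_div_assoc', ← Real.exp_add]
    simp
  · have hp : 2 * -1 * m.re < 0 := by linarith
    rw [← ofReal_integral_eq_lintegral_ofReal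
      ((integrableOn_exp_mul_Ioi hp a).const_mul _) (.of_forall fun x => by positivity),
      integral_const_mul, integral_exp_mul_Ioi hp, mul_div_assoc', mul_neg, ← Real.exp_add]
    simp [neg_div_neg_eq]

lemma memLp_expAt (h : IsHalfLine I a s) {m : ℂ} (hm : 0 < m.re) :
    MemLp (expAt (s * m) a) 2 (volume.restrict I) := by
  rw [memLp_two_iff (continuous_expAt _ _).aestronglyMeasurable, h.lintegral_expAt hm]
  exact ENNReal.ofReal_lt_top

/-- The decaying exponential function on a half-line as a profile. -/
def expProfile (h : IsHalfLine I a s) {m : ℂ} (hm : 0 < m.re) : Profile I :=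
  (h.memLp_expAt hm).toLp _

lemma norm_expProfile_sq (h : IsHalfLine I a s) {m : ℂ} (hm : 0 < m.re) :
    ‖h.expProfile hm‖ ^ 2 = 1 / (2 * m.re) := by
  have h1 : ‖h.expProfile hm‖ₑ ^ (2 : ℝ) = ENNReal.ofReal (1 / (2 * m.re)) := by
    rw [expProfile, Lp.enorm_toLp, eLpNorm_two_rpow, h.lintegral_expAt hm]
  rw [← ofReal_norm, ENNReal.ofReal_rpow_of_nonneg (norm_nonneg _) two_pos.le] at h1
  have h2 := (ENNReal.ofReal_eq_ofReal_iff (by positivity) (by positivity)).1 h1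
  rw [← h2, Real.rpow_two]

lemma expProfile_ne_zero (h : IsHalfLine I a s) {m : ℂ} (hm : 0 < m.re) :
    h.expProfile hm ≠ 0 := by
  intro h0
  have h1 := h.norm_expProfile_sq hm
  rw [h0, norm_zero] at h1
  have : 0 < 1 / (2 * m.re) := by positivity
  linarith

lemma expProfile_mem_weakDeriv (h : IsHalfLine I a s) {m : ℂ} (hm : 0 < m.re) :
    (h.expProfile hm, ((s * m : ℂ)) • h.expProfile hm) ∈ weakDeriv I := by
  rw [mem_weakDeriv]
  have h1 := (h.memLp_expAt hm).coeFn_toLp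
  intro η hη
  have h2 := hasWeakDeriv_expAt I (s * m) a η hη
  convert h2 using 1
  · exact integral_congr_ae (h1.mono fun x hx => by simp only [expProfile, hx])
  · congr 1
    refine integral_congr_ae ?_
    filter_upwards [h1, Lp.coeFn_smul (s * m : ℂ) (h.expProfile hm)] with x hx hx'
    rw [hx', Pi.smul_apply, expProfile, hx, smul_eq_mul]

lemma exists_eq_smul_expProfile (h : IsHalfLine I a s) {m : ℂ} (hm : 0 < m.re) (w : Profile I)
    (hw : (w, (s * m : ℂ) • w) ∈ weakDeriv I) : ∃ C : ℂ, w = C • h.expProfile hm := by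
  obtain ⟨C, hC⟩ := exists_eq_expAt_of_mem_weakDeriv h.isOpen h.ordConnected hw a
  refine ⟨C, Lp.ext ?_⟩
  filter_upwards [hC, Lp.coeFn_smul C (h.expProfile hm), (h.memLp_expAt hm).coeFn_toLp]
    with x h1 h2 h3
  rw [h1, h2, Pi.smul_apply, expProfile, h3, smul_eq_mul]

lemma eq_zero_of_growing (h : IsHalfLine I a s) {m : ℂ} (hm : 0 < m.re) (w : Profile I)
    (hw : (w, -(s * m : ℂ) • w) ∈ weakDeriv I) : w = 0 := by
  refine eq_zero_of_mem_weakDeriv h.isOpen h.ordConnected hw h.isOpen.measurableSet subset_rfl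
    h.volume_eq (a := a) fun x hx => ?_
  rw [Complex.neg_re, Complex.re_ofReal_mul]
  have := h.mul_sub_neg hx
  nlinarith

end IsHalfLine

/-! ### Solutions of the homogeneous system on almost every frequency -/

section

variable {I : Set ℝ} {U : Space → EH}

lemma lintegral_sum_add {α : Type*} [MeasurableSpace α] {ν : Measure α} {f g : Fin 3 → α → ENNReal}
    (hf : ∀ i, AEMeasurable (f i) ν) (hg : ∀ i, AEMeasurable (g i) ν) :
    ∫⁻ x, ∑ i, (f i x + g i x) ∂ν = ∑ i, ((∫⁻ x, f i x ∂ν) + ∫⁻ x, g i x ∂ν) := by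
  have h : ∀ i, AEMeasurable (fun x => f i x + g i x) ν := fun i => (hf i).add (hg i)
  rw [lintegral_finsetSum' _ fun i _ => h i]
  exact Finset.sum_congr rfl fun i _ => lintegral_add_left' (hf i) _

lemma memLp_fst_apply {ν : Measure Space} (hU : MemLp U 2 ν) (i : Fin 3) :
    MemLp (fun p => (U p).1 i) 2 ν :=
  memLp_pi_iff.1 (memLp_prod_iff_fst_snd.1 hU).1 i

lemma memLp_snd_apply {ν : Measure Space} (hU : MemLp U 2 ν) (i : Fin 3) :
    MemLp (fun p => (U p).2 i) 2 ν :=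
  memLp_pi_iff.1 (memLp_prod_iff_fst_snd.1 hU).2 i

variable (hU : MemLp U 2 (volume.restrict {p : Space | p.1 ∈ I}))

/-- The tangential Fourier transform of the electric field. -/
def ftE (k : Plane) (i : Fin 3) : Profile I := ft (memLp_fst_apply hU i) k

/-- The tangential Fourier transform of the magnetic field. -/
def ftH (k : Plane) (i : Fin 3) : Profile I := ft (memLp_snd_apply hU i) k

lemma IsWeakMaxwell.ae_modeSystem {P : Params} (hI : IsOpen I)
    (h : IsWeakMaxwell P {p : Space | p.1 ∈ I} (fun _ => 0) U) :
    ∀ᵐ k, ModeSystem (weakDeriv I) P.adm P.imp (tang (wave k) 0) (tang (wave k) 1)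
      (ftE hU k) (ftH hU k) := by
  rw [isWeakMaxwell_iff] at h
  simp only [zero_add, zero_sub, ← neg_smul] at h
  filter_upwards [h.1.ae_ft hI (memLp_snd_apply hU) (memLp_fst_apply hU),
    h.2.ae_ft hI (memLp_fst_apply hU) (memLp_snd_apply hU)] with k hk1 hk2
  refine ⟨hk1.1, hk1.2.1, hk1.2.2, ?_, ?_, ?_⟩
  · exact hk2.1.trans (neg_smul _ _)
  · exact ModeSystem.mem_congr hk2.2.1 (by rw [neg_smul, sub_neg_eq_add]; rfl)
  · exact ModeSystem.mem_congr hk2.2.2 (by rw [neg_smul, ← sub_eq_add_neg]; rfl)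

/-- On almost every frequency, a square integrable solution on a half-space decays exponentially
away from the boundary. -/
lemma IsWeakMaxwell.exists_amplitude {P : Params} (hP : P.Pos) {a s : ℝ} (hI : IsHalfLine I a s)
    (h : IsWeakMaxwell P {p : Space | p.1 ∈ I} (fun _ => 0) U) :
    ∃ c : Plane → EH, ∀ᵐ k,
      IsAmplitude P.adm P.imp (s * P.lam (wave k)) (tang (wave k) 0) (tang (wave k) 1)
        (c k).1 (c k).2 ∧
      (∀ i, ftE hU k i = (c k).1 i • hI.expProfile (Params.lam_re_pos hP (wave k))) ∧
      ∀ i, ftH hU k i = (c k).2 i • hI.expProfile (Params.lam_re_pos hP (wave k)) := by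
  suffices h1 : ∀ᵐ k, ∃ c : EH,
      IsAmplitude P.adm P.imp (s * P.lam (wave k)) (tang (wave k) 0) (tang (wave k) 1) c.1 c.2 ∧
      (∀ i, ftE hU k i = c.1 i • hI.expProfile (Params.lam_re_pos hP (wave k))) ∧
      ∀ i, ftH hU k i = c.2 i • hI.expProfile (Params.lam_re_pos hP (wave k)) from h1.choice
  filter_upwards [h.ae_modeSystem hU hI.isOpen] with k sys
  have hm := Params.lam_re_pos hP (wave k)
  have hm2 : ((s : ℂ) * P.lam (wave k)) ^ 2 =
      P.adm * P.imp - tang (wave k) 0 ^ 2 - tang (wave k) 1 ^ 2 := by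
    rw [← lam_sq_eq hP, mul_pow, sq (s : ℂ), ← Complex.ofReal_mul, hI.sq_eq, Complex.ofReal_one,
      one_mul]
  obtain ⟨c, d, hc, hd⟩ := sys.exists_amplitude hP.adm_ne hP.imp_ne hm2
    (hI.exists_eq_smul_expProfile hm) (hI.eq_zero_of_growing hm)
  refine ⟨(c, d), ?_, hc, hd⟩
  refine ModeSystem.isAmplitude (hI.expProfile_ne_zero hm) (hI.expProfile_mem_weakDeriv hm)
    (fun v hv => weakDeriv_zero hI.isOpen hv) ?_
  rw [funext hc, funext hd] at sys
  exact sys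

/-- The square of the norm of the Fourier transform of a field at a frequency. -/
def modeEnergy (k : Plane) : ℝ := ∑ i, (‖ftE hU k i‖ ^ 2 + ‖ftH hU k i‖ ^ 2)

lemma modeEnergy_nonneg (k : Plane) : 0 ≤ modeEnergy hU k :=
  Finset.sum_nonneg fun _ _ => by positivity

lemma ofReal_modeEnergy (k : Plane) : ENNReal.ofReal (modeEnergy hU k) =
    ∑ i, (‖ftE hU k i‖ₑ ^ (2 : ℝ) + ‖ftH hU k i‖ₑ ^ (2 : ℝ)) := by
  have e : ∀ f : Profile I, ENNReal.ofReal (‖f‖ ^ 2) = ‖f‖ₑ ^ (2 : ℝ) := fun f => by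
    rw [← Real.rpow_two, ← ENNReal.ofReal_rpow_of_nonneg (norm_nonneg _) two_pos.le, ofReal_norm]
  rw [modeEnergy, ENNReal.ofReal_sum_of_nonneg fun _ _ => by positivity]
  refine Finset.sum_congr rfl fun i _ => ?_
  rw [ENNReal.ofReal_add (by positivity) (by positivity), e, e]

lemma aemeasurable_enorm_sq (f : Lp (Profile I) 2 (volume : Measure Plane)) :
    AEMeasurable fun k => ‖f k‖ₑ ^ (2 : ℝ) :=
  (Lp.aestronglyMeasurable f).enorm.pow_const _

lemma aemeasurable_modeEnergy : AEMeasurable fun k => ENNReal.ofReal (modeEnergy hU k) := by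
  simp only [ofReal_modeEnergy]
  exact Finset.aemeasurable_fun_sum _ fun i _ => (aemeasurable_enorm_sq _).add (aemeasurable_enorm_sq _)

lemma lintegral_modeEnergy : ∫⁻ k, ENNReal.ofReal (modeEnergy hU k) =
    ∑ i, ((∫⁻ p in {p : Space | p.1 ∈ I}, ‖(U p).1 i‖ₑ ^ (2 : ℝ)) +
      ∫⁻ p in {p : Space | p.1 ∈ I}, ‖(U p).2 i‖ₑ ^ (2 : ℝ)) := by
  simp only [ofReal_modeEnergy]
  refine (lintegral_sum_add (fun i => aemeasurable_enorm_sq (ft (memLp_fst_apply hU i)))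
    fun i => aemeasurable_enorm_sq (ft (memLp_snd_apply hU i))).trans ?_
  exact Finset.sum_congr rfl fun i _ => congrArg₂ _ (lintegral_ft _) (lintegral_ft _)

lemma lintegral_modeEnergy_lt_top : ∫⁻ k, ENNReal.ofReal (modeEnergy hU k) < ⊤ := by
  rw [lintegral_modeEnergy]
  refine ENNReal.sum_lt_top.2 fun i _ => ENNReal.add_lt_top.2 ⟨?_, ?_⟩
  · exact (memLp_two_iff (memLp_fst_apply hU i).1).1 (memLp_fst_apply hU i)
  · exact (memLp_two_iff (memLp_snd_apply hU i).1).1 (memLp_snd_apply hU i)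

/-- The norm of a field is controlled by its modes. -/
lemma eLpNorm_sq_le : eLpNorm U 2 (volume.restrict {p : Space | p.1 ∈ I}) ^ (2 : ℝ) ≤
    ∫⁻ k, ENNReal.ofReal (modeEnergy hU k) := by
  have hm : ∀ {f : Space → ℂ}, MemLp f 2 (volume.restrict {p : Space | p.1 ∈ I}) →
      AEMeasurable (fun p => ‖f p‖ₑ ^ (2 : ℝ)) (volume.restrict {p : Space | p.1 ∈ I}) :=
    fun hf => hf.1.enorm.pow_const _
  have h1 := fun i => hm (memLp_fst_apply hU i)
  have h2 := fun i => hm (memLp_snd_apply hU i)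
  rw [lintegral_modeEnergy, eLpNorm_two_rpow]
  calc _ ≤ ∫⁻ p in {p : Space | p.1 ∈ I},
        ∑ i, (‖(U p).1 i‖ₑ ^ (2 : ℝ) + ‖(U p).2 i‖ₑ ^ (2 : ℝ)) := by
        refine lintegral_mono fun p => ?_
        have hbound : ∀ i : Fin 3, ‖(U p).1 i‖ₑ ^ (2 : ℝ) + ‖(U p).2 i‖ₑ ^ (2 : ℝ) ≤
            ∑ i, (‖(U p).1 i‖ₑ ^ (2 : ℝ) + ‖(U p).2 i‖ₑ ^ (2 : ℝ)) := fun i =>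
          Finset.single_le_sum (f := fun i => ‖(U p).1 i‖ₑ ^ (2 : ℝ) + ‖(U p).2 i‖ₑ ^ (2 : ℝ))
            (fun _ _ => zero_le) (Finset.mem_univ i)
        have hsup : ∀ v : CVec, ∃ i, ‖v‖ₑ = ‖v i‖ₑ := fun v => by
          obtain ⟨i, -, hi⟩ := Finset.exists_mem_eq_sup Finset.univ Finset.univ_nonempty
            fun i => ‖v i‖₊
          refine ⟨i, ?_⟩
          rw [enorm_eq_nnnorm, enorm_eq_nnnorm, Pi.nnnorm_def, hi]
        have hmax : ‖U p‖ₑ = ‖(U p).1‖ₑ ∨ ‖U p‖ₑ = ‖(U p).2‖ₑ := by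
          simp only [enorm_eq_nnnorm, Prod.nnnorm_def]
          rcases max_choice ‖(U p).1‖₊ ‖(U p).2‖₊ with h | h <;> simp only [h, true_or, or_true]
        rcases hmax with h | h
        · obtain ⟨i, hi⟩ := hsup (U p).1
          rw [h, hi]
          exact le_self_add.trans (hbound i)
        · obtain ⟨i, hi⟩ := hsup (U p).2
          rw [h, hi]
          exact le_add_self.trans (hbound i)
    _ = _ := lintegral_sum_add h1 h2

lemma eLpNorm_eq_zero_of_modeEnergy (h : ∀ᵐ k, modeEnergy hU k = 0) :
    U =ᵐ[volume.restrict {p : Space | p.1 ∈ I}] 0 := by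
  have h1 := eLpNorm_sq_le hU
  rw [lintegral_congr_ae (g := fun _ => 0) (h.mono fun k hk => by simp [hk]), lintegral_zero,
    nonpos_iff_eq_zero, ENNReal.rpow_eq_zero_iff_of_pos two_pos] at h1
  exact (eLpNorm_eq_zero_iff hU.1 (by norm_num)).1 h1

end

/-- The only square integrable solution of the homogeneous system on the whole space is zero. -/
lemma IsWeakMaxwell.ae_eq_zero {P : Params} (hP : P.Pos) {U : Space → EH} (hU : MemLp U 2 volume)
    (h : IsWeakMaxwell P Set.univ (fun _ => 0) U) : U =ᵐ[volume] 0 := by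
  have huniv : {p : Space | p.1 ∈ (Set.univ : Set ℝ)} = Set.univ := by
    ext
    simp
  have hU' : MemLp U 2 (volume.restrict {p : Space | p.1 ∈ (Set.univ : Set ℝ)}) := by
    rwa [huniv, Measure.restrict_univ]
  have h' : IsWeakMaxwell P {p : Space | p.1 ∈ (Set.univ : Set ℝ)} (fun _ => 0) U := by
    rwa [huniv]
  have h1 : ∀ᵐ k, modeEnergy hU' k = 0 := by
    filter_upwards [h'.ae_modeSystem hU' isOpen_univ] with k sys
    have hm := Params.lam_re_pos hP (wave k)
    have hright : ∀ w : Profile Set.univ, (w, P.lam (wave k) • w) ∈ weakDeriv Set.univ → w = 0 := by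
      intro w hw
      refine eq_zero_of_mem_weakDeriv isOpen_univ Set.ordConnected_univ hw
        (measurableSet_Ioi (a := (0 : ℝ))) (Set.subset_univ _) Real.volume_Ioi (a := 0)
        fun x hx => ?_
      rw [sub_zero]
      exact mul_nonneg hm.le (le_of_lt hx)
    have hleft : ∀ w : Profile Set.univ, (w, -P.lam (wave k) • w) ∈ weakDeriv Set.univ → w = 0 := by
      intro w hw
      refine eq_zero_of_mem_weakDeriv isOpen_univ Set.ordConnected_univ hw
        (measurableSet_Iio (a := (0 : ℝ))) (Set.subset_univ _) Real.volume_Iio (a := 0)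
        fun x hx => ?_
      rw [sub_zero, Complex.neg_re]
      exact mul_nonneg_of_nonpos_of_nonpos (neg_nonpos.2 hm.le) (le_of_lt hx)
    obtain ⟨c, d, hc, hd⟩ := sys.exists_amplitude hP.adm_ne hP.imp_ne (lam_sq_eq hP (wave k))
      (ε := 0) (fun w hw => ⟨0, by rw [hright w hw, smul_zero]⟩) hleft
    simp [modeEnergy, hc, hd]
  have h2 := eLpNorm_eq_zero_of_modeEnergy hU' h1
  rwa [huniv, Measure.restrict_univ] at h2

/-! ### Traces on the Fourier side -/

/-- Averages over shrinking intervals that touch or contain `b` converge to the value at `b`. -/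
lemma tendsto_interval_average {f : ℝ → ℂ} (hf : Continuous f) (b : ℝ) {θ : ℝ} (h0 : 0 ≤ θ)
    (h1 : θ ≤ 1) :
    Tendsto (fun t : ℝ => (t⁻¹ : ℂ) * ∫ x in Set.Ioo (b - θ * t) (b - θ * t + t), f x)
      (𝓝[>] 0) (𝓝 (f b)) := by
  rw [Metric.tendsto_nhds]
  intro ε hε
  obtain ⟨δ, hδ, hfδ⟩ := Metric.continuous_iff.1 hf b (ε / 2) (half_pos hε)
  filter_upwards [Ioo_mem_nhdsGT hδ] with t ht
  have hint : IntegrableOn f (Set.Ioo (b - θ * t) (b - θ * t + t)) :=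
    (hf.integrableOn_Icc (a := b - θ * t) (b := b - θ * t + t)).mono_set Set.Ioo_subset_Icc_self
  have hvol : volume.real (Set.Ioo (b - θ * t) (b - θ * t + t)) = t := by
    rw [Real.volume_real_Ioo_of_le (by linarith [ht.1])]
    ring
  have h2 : ‖∫ x in Set.Ioo (b - θ * t) (b - θ * t + t), (f x - f b)‖ ≤ ε / 2 * t := by
    have h3 := norm_setIntegral_le_of_norm_le_const (μ := volume)
      (s := Set.Ioo (b - θ * t) (b - θ * t + t)) (f := fun x => f x - f b) (C := ε / 2)
      measure_Ioo_lt_top fun x hx => ?_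
    · rwa [hvol] at h3
    · rw [← dist_eq_norm]
      refine (hfδ x ?_).le
      rw [Real.dist_eq, abs_lt]
      constructor <;> nlinarith [hx.1, hx.2, ht.1, ht.2]
  rw [integral_sub hint (integrableOn_const measure_Ioo_lt_top.ne), setIntegral_const, hvol] at h2
  have ht0 : (t : ℂ) ≠ 0 := Complex.ofReal_ne_zero.2 ht.1.ne'
  have h4 : (t⁻¹ : ℂ) * (∫ x in Set.Ioo (b - θ * t) (b - θ * t + t), f x) - f b =
      (t⁻¹ : ℂ) * ((∫ x in Set.Ioo (b - θ * t) (b - θ * t + t), f x) - t • f b) := by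
    rw [Complex.real_smul, mul_sub, inv_mul_cancel_left₀ ht0]
  rw [dist_eq_norm, h4, norm_mul, norm_inv, Complex.norm_real, Real.norm_of_nonneg ht.1.le]
  calc t⁻¹ * _ ≤ t⁻¹ * (ε / 2 * t) := mul_le_mul_of_nonneg_left h2 (inv_nonneg.2 ht.1.le)
    _ = ε / 2 := by field_simp [ht.1.ne']
    _ < ε := half_lt_self hε

/-- Multiplication by the frequency is controlled by the derivatives of the test function. -/
lemma norm_wave_mul_ift_le {ψ : Plane → ℂ} (hψ : IsTest Set.univ ψ) (k : Plane) :
    ‖wave k‖ * ‖ift hψ k‖ ≤ ‖ift (hψ.fderiv_apply (EuclideanSpace.single 0 1)) k‖ +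
      ‖ift (hψ.fderiv_apply (EuclideanSpace.single 1 1)) k‖ := by
  rw [ift_fderiv_single hψ, ift_fderiv_single hψ, norm_mul, norm_mul, ← add_mul]
  refine mul_le_mul_of_nonneg_right ?_ (norm_nonneg _)
  have h : ∀ i, ‖-tang (wave k) i‖ = |wave k i| := fun i => by simp [tang]
  rw [h, h]
  refine abs_le_of_sq_le_sq' ?_ (by positivity) |>.2
  rw [norm_sq_plane, ← sq_abs (wave k 0), ← sq_abs (wave k 1)]
  nlinarith [abs_nonneg (wave k 0), abs_nonneg (wave k 1)]

section

variable {P : Params} (hP : P.Pos) {I : Set ℝ} {a s : ℝ} (hI : IsHalfLine I a s)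

/-- The traces of a decaying mode need one half of a derivative more than the mode itself. -/
lemma exists_norm_amplitude_le : ∃ C : ℝ, ∀ (k : Plane) (c : ℂ),
    ‖c‖ ≤ C * (1 + ‖wave k‖) * ‖c • hI.expProfile (Params.lam_re_pos hP (wave k))‖ := by
  obtain ⟨C, hC, h⟩ := Params.norm_lam_le hP
  refine ⟨1 + 2 * C, fun k c => ?_⟩
  have hm := Params.lam_re_pos hP (wave k)
  set e := ‖hI.expProfile hm‖
  have he : e ^ 2 * (2 * (P.lam (wave k)).re) = 1 := by
    rw [hI.norm_expProfile_sq hm, one_div_mul_cancel (by positivity)]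
  have he0 : 0 ≤ e := norm_nonneg _
  have h1 : (P.lam (wave k)).re ≤ C * (1 + ‖wave k‖) := (Complex.re_le_norm _).trans (h _)
  have h2 : 1 ≤ (1 + 2 * C) * (1 + ‖wave k‖) * e := by
    have h3 : 1 ≤ (1 + 2 * (P.lam (wave k)).re) * e := by
      refine (one_le_sq_iff₀ (by positivity)).1 ?_
      nlinarith [mul_nonneg (sq_nonneg e) (sq_nonneg (2 * (P.lam (wave k)).re)), sq_nonneg e,
        sq_nonneg (e * (1 - 2 * (P.lam (wave k)).re))]
    refine h3.trans (mul_le_mul_of_nonneg_right ?_ he0)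
    nlinarith [norm_nonneg (wave k)]
  rw [norm_smul]
  calc ‖c‖ = ‖c‖ * 1 := (mul_one _).symm
    _ ≤ ‖c‖ * ((1 + 2 * C) * (1 + ‖wave k‖) * e) := mul_le_mul_of_nonneg_left h2 (norm_nonneg _)
    _ = _ := by ring

/-- The trace of a decaying field on the plane `x = b` is computed frequency by frequency. -/
lemma tendsto_average_ft {u : Space → ℂ} (hu : MemLp u 2 (volume.restrict {p : Space | p.1 ∈ I}))
    {c : Plane → ℂ}
    (hc : ∀ᵐ k, ft hu k = c k • hI.expProfile (Params.lam_re_pos hP (wave k)))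
    {b θ : ℝ} (h0 : 0 ≤ θ) (h1 : θ ≤ 1) (hba : s * (b - a) ≤ 0)
    (hb : ∀ᶠ t in 𝓝[>] (0 : ℝ), Set.Ioo (b - θ * t) (b - θ * t + t) ⊆ I)
    {ψ : Plane → ℂ} (hψ : IsTest Set.univ ψ) :
    Integrable (fun k => ift hψ k * (c k * expAt (s * P.lam (wave k)) a b)) ∧
    Tendsto (fun t : ℝ => t⁻¹ • ∫ p in slab (b - θ * t) (b - θ * t + t), ψ p.2 * u p) (𝓝[>] 0)
      (𝓝 (∫ k, ift hψ k * (c k * expAt (s * P.lam (wave k)) a b))) := by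
  -- the averages are pairings with `t⁻¹` times the indicator function of a short interval
  set J : ℝ → Set ℝ := fun t => Set.Ioo (b - θ * t) (b - θ * t + t) with hJ
  set χ : ℝ → ℝ → ℂ := fun t => (J t).indicator fun _ => (t⁻¹ : ℂ) with hχ
  have hχL : ∀ t, MemLp (χ t) 2 (volume.restrict I) := fun t =>
    memLp_indicator_const 2 measurableSet_Ioo _
      (.inr ((Measure.restrict_apply_le _ _).trans_lt measure_Ioo_lt_top).ne)
  set F : ℝ → Plane → ℂ := fun t k => ift hψ k * pair ((hχL t).toLp (χ t)) (ft hu k) with hF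
  have hslab : ∀ᶠ t in 𝓝[>] (0 : ℝ), ∫ k, F t k =
      t⁻¹ • ∫ p in slab (b - θ * t) (b - θ * t + t), ψ p.2 * u p := by
    filter_upwards [hb] with t ht
    have hsub : slab (b - θ * t) (b - θ * t + t) ⊆ {p : Space | p.1 ∈ I} := fun p hp => ht hp
    rw [← integral_slab_mul hu (hχL t) hψ]
    have e1 : (fun p : Space => χ t p.1 * ψ p.2 * u p) =
        (slab (b - θ * t) (b - θ * t + t)).indicator fun p => (t⁻¹ : ℂ) * (ψ p.2 * u p) := by
      funext p
      by_cases hp : p ∈ slab (b - θ * t) (b - θ * t + t)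
      · rw [Set.indicator_of_mem hp, hχ]
        simp only
        rw [Set.indicator_of_mem (show p.1 ∈ J t from hp), mul_assoc]
      · rw [Set.indicator_of_notMem hp, hχ]
        simp only
        rw [Set.indicator_of_notMem (show p.1 ∉ J t from hp), zero_mul, zero_mul]
    rw [e1, setIntegral_indicator (measurableSet_slab _ _), integral_const_mul,
      Set.inter_eq_right.2 hsub, Complex.real_smul, Complex.ofReal_inv]
  have hpair : ∀ᵐ k, ∀ t, J t ⊆ I → pair ((hχL t).toLp (χ t)) (ft hu k) =
      c k * ((t⁻¹ : ℂ) * ∫ x in J t, expAt (s * P.lam (wave k)) a x) := by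
    filter_upwards [hc] with k hk t ht
    have hm := Params.lam_re_pos hP (wave k)
    rw [hk, map_smul, smul_eq_mul, pair_toLp]
    congr 1
    have e2 : ∫ x in I, hI.expProfile hm x * χ t x =
        ∫ x in I, (J t).indicator (fun x => (t⁻¹ : ℂ) * expAt (s * P.lam (wave k)) a x) x := by
      refine integral_congr_ae ((hI.memLp_expAt hm).coeFn_toLp.mono fun x hx => ?_)
      simp only [IsHalfLine.expProfile, hx, hχ]
      by_cases hxJ : x ∈ J t
      · rw [Set.indicator_of_mem hxJ, Set.indicator_of_mem hxJ, mul_comm]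
      · rw [Set.indicator_of_notMem hxJ, Set.indicator_of_notMem hxJ, mul_zero]
    rw [e2, setIntegral_indicator measurableSet_Ioo, integral_const_mul, Set.inter_eq_right.2 ht]
  have hlim : ∀ᵐ k, Tendsto (fun t => F t k) (𝓝[>] 0)
      (𝓝 (ift hψ k * (c k * expAt (s * P.lam (wave k)) a b))) := by
    filter_upwards [hpair] with k hk
    refine ((tendsto_interval_average (continuous_expAt (s * P.lam (wave k)) a) b h0 h1).const_mul
      (c k)).const_mul (ift hψ k) |>.congr' ?_
    filter_upwards [hb] with t ht
    rw [hF]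
    simp only
    rw [hk t ht]
  obtain ⟨C, hC⟩ := exists_norm_amplitude_le hP hI
  set B : Plane → ℝ := fun k => |C| * (‖ift hψ k‖ +
    (‖ift (hψ.fderiv_apply (EuclideanSpace.single 0 1)) k‖ +
      ‖ift (hψ.fderiv_apply (EuclideanSpace.single 1 1)) k‖)) * ‖ft hu k‖ with hB
  have hBint : Integrable B := by
    have hS : ∀ {ψ : Plane → ℂ} (hψ : IsTest Set.univ ψ), MemLp (fun k => ‖ift hψ k‖) 2 volume :=
      fun hψ => ((ift hψ).memLp 2 volume).norm
    exact (((hS hψ).add ((hS (hψ.fderiv_apply _)).add (hS (hψ.fderiv_apply _)))).const_mul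
      |C|).integrable_mul (Lp.memLp (ft hu)).norm
  have hcB : ∀ᵐ k, ‖ift hψ k‖ * ‖c k‖ ≤ B k := by
    filter_upwards [hc] with k hk
    have h3 := hC k (c k)
    rw [← hk] at h3
    have h4 := norm_wave_mul_ift_le hψ k
    calc ‖ift hψ k‖ * ‖c k‖ ≤ ‖ift hψ k‖ * (|C| * (1 + ‖wave k‖) * ‖ft hu k‖) := by
          refine mul_le_mul_of_nonneg_left (h3.trans ?_) (norm_nonneg _)
          gcongr
          exact le_abs_self C
      _ = |C| * (‖ift hψ k‖ + ‖wave k‖ * ‖ift hψ k‖) * ‖ft hu k‖ := by ring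
      _ ≤ B k := by
          exact mul_le_mul_of_nonneg_right (mul_le_mul_of_nonneg_left (by linarith)
            (abs_nonneg _)) (norm_nonneg _)
  have hbound : ∀ᶠ t in 𝓝[>] (0 : ℝ), ∀ᵐ k, ‖F t k‖ ≤ B k := by
    filter_upwards [hb, self_mem_nhdsWithin] with t ht ht0
    filter_upwards [hpair, hcB] with k hk hk2
    have hm := Params.lam_re_pos hP (wave k)
    have h5 := norm_setIntegral_le_of_norm_le_const (μ := volume) (s := J t)
      (f := expAt (s * P.lam (wave k)) a) (C := 1) measure_Ioo_lt_top
      fun x hx => norm_expAt_le hm (hI.mul_sub_neg (ht hx)).le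
    rw [Real.volume_real_Ioo_of_le (by linarith [Set.mem_Ioi.1 ht0]), add_sub_cancel_left,
      one_mul] at h5
    have h6 : ‖(t⁻¹ : ℂ) * ∫ x in J t, expAt (s * P.lam (wave k)) a x‖ ≤ 1 := by
      rw [norm_mul, norm_inv, Complex.norm_real, Real.norm_of_nonneg (le_of_lt ht0)]
      exact (inv_mul_le_one₀ ht0).2 h5
    rw [hF]
    simp only
    rw [hk t ht, norm_mul, norm_mul]
    exact (mul_le_mul_of_nonneg_left (mul_le_of_le_one_right (norm_nonneg _) h6)
      (norm_nonneg _)).trans hk2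
  have hmeas : ∀ t, AEStronglyMeasurable (F t) volume := fun t =>
    (integrable_ift_mul hu _ hψ).aestronglyMeasurable
  have hT := tendsto_integral_filter_of_dominated_convergence B (.of_forall hmeas) hbound hBint hlim
  refine ⟨?_, hT.congr' hslab⟩
  refine hBint.mono' (aestronglyMeasurable_of_tendsto_ae _ hmeas hlim) ?_
  filter_upwards [hcB] with k hk
  rw [norm_mul, norm_mul]
  exact (mul_le_mul_of_nonneg_left (mul_le_of_le_one_right (norm_nonneg _)
    (norm_expAt_le (Params.lam_re_pos hP (wave k)) hba)) (norm_nonneg _)).trans hk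

/-- The impedance trace of a decaying field on the plane `x = b` is computed frequency by frequency.
-/
lemma tendsto_impedance_average {U : Space → EH}
    (hU : MemLp U 2 (volume.restrict {p : Space | p.1 ∈ I})) {c : Plane → EH}
    (hE : ∀ᵐ k, ∀ i, ftE hU k i = (c k).1 i • hI.expProfile (Params.lam_re_pos hP (wave k)))
    (hH : ∀ᵐ k, ∀ i, ftH hU k i = (c k).2 i • hI.expProfile (Params.lam_re_pos hP (wave k)))
    {b θ : ℝ} (h0 : 0 ≤ θ) (h1 : θ ≤ 1) (hba : s * (b - a) ≤ 0)
    (hb : ∀ᶠ t in 𝓝[>] (0 : ℝ), Set.Ioo (b - θ * t) (b - θ * t + t) ⊆ I)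
    {ψ : Plane → ℂ} (hψ : IsTest Set.univ ψ) (n : CVec) (i : Fin 3) :
    Integrable (fun k => ift hψ k * impedance P n (expAt (s * P.lam (wave k)) a b • c k) i) ∧
    Tendsto (fun t : ℝ => t⁻¹ • ∫ p in slab (b - θ * t) (b - θ * t + t),
        ψ p.2 * impedance P n (U p) i) (𝓝[>] 0)
      (𝓝 (∫ k, ift hψ k * impedance P n (expAt (s * P.lam (wave k)) a b • c k) i)) := by
  set α : Fin 3 → ℂ := fun j => impedance P n (Pi.single j 1, 0) i with hα
  set β : Fin 3 → ℂ := fun j => impedance P n (0, Pi.single j 1) i with hβ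
  have himp : ∀ v : EH, impedance P n v i = ∑ j, (α j * v.1 j + β j * v.2 j) := by
    intro v
    have hv : v = ∑ j, (v.1 j • ((Pi.single j 1, 0) : EH) + v.2 j • ((0, Pi.single j 1) : EH)) := by
      refine Prod.ext (funext fun l => ?_) (funext fun l => ?_) <;>
        fin_cases l <;> simp [Fin.sum_univ_three]
    conv_lhs => rw [hv]
    rw [map_sum, Finset.sum_apply]
    refine Finset.sum_congr rfl fun j _ => ?_
    rw [map_add, map_smul, map_smul, Pi.add_apply, Pi.smul_apply, Pi.smul_apply, smul_eq_mul,
      smul_eq_mul, mul_comm, mul_comm (v.2 j)]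
  have tE := fun j => tendsto_average_ft hP hI (memLp_fst_apply hU j)
    (hE.mono fun k hk => hk j) h0 h1 hba hb hψ
  have tH := fun j => tendsto_average_ft hP hI (memLp_snd_apply hU j)
    (hH.mono fun k hk => hk j) h0 h1 hba hb hψ
  have e : (fun k => ift hψ k * impedance P n (expAt (s * P.lam (wave k)) a b • c k) i) =
      fun k => ∑ j, (α j * (ift hψ k * ((c k).1 j * expAt (s * P.lam (wave k)) a b)) +
        β j * (ift hψ k * ((c k).2 j * expAt (s * P.lam (wave k)) a b))) := by
    funext k
    rw [himp, Finset.mul_sum]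
    refine Finset.sum_congr rfl fun j _ => ?_
    simp only [Prod.smul_fst, Prod.smul_snd, Pi.smul_apply, smul_eq_mul]
    ring
  have hint : ∀ j, Integrable fun k =>
      α j * (ift hψ k * ((c k).1 j * expAt (s * P.lam (wave k)) a b)) +
        β j * (ift hψ k * ((c k).2 j * expAt (s * P.lam (wave k)) a b)) := fun j =>
    ((tE j).1.const_mul _).add ((tH j).1.const_mul _)
  rw [e]
  refine ⟨integrable_finsetSum _ fun j _ => hint j, ?_⟩
  rw [integral_finsetSum _ fun j _ => hint j]
  have hlim := tendsto_finsetSum Finset.univ fun j _ =>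
    ((tE j).2.const_mul (α j)).add ((tH j).2.const_mul (β j))
  have e2 : ∀ j, (∫ k, α j * (ift hψ k * ((c k).1 j * expAt (s * P.lam (wave k)) a b)) +
        β j * (ift hψ k * ((c k).2 j * expAt (s * P.lam (wave k)) a b))) =
      α j * (∫ k, ift hψ k * ((c k).1 j * expAt (s * P.lam (wave k)) a b)) +
        β j * ∫ k, ift hψ k * ((c k).2 j * expAt (s * P.lam (wave k)) a b) := fun j => by
    rw [integral_add ((tE j).1.const_mul _) ((tH j).1.const_mul _), integral_const_mul,
      integral_const_mul]
  simp only [e2]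
  refine hlim.congr' ?_
  filter_upwards [hb] with t ht
  have hsub : slab (b - θ * t) (b - θ * t + t) ⊆ {p : Space | p.1 ∈ I} := fun p hp => ht hp
  have iE := fun j => hψ.integrable_slab (memLp_fst_apply hU j) hsub
  have iH := fun j => hψ.integrable_slab (memLp_snd_apply hU j) hsub
  have e3 : (fun p : Space => ψ p.2 * impedance P n (U p) i) =
      fun p => ∑ j, (α j * (ψ p.2 * (U p).1 j) + β j * (ψ p.2 * (U p).2 j)) := by
    funext p
    rw [himp, Finset.mul_sum]
    exact Finset.sum_congr rfl fun j _ => by ring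
  have hint' : ∀ j, Integrable (fun p : Space => α j * (ψ p.2 * (U p).1 j) +
      β j * (ψ p.2 * (U p).2 j)) (volume.restrict (slab (b - θ * t) (b - θ * t + t))) := fun j =>
    ((iE j).const_mul _).add ((iH j).const_mul _)
  rw [e3, integral_finsetSum _ fun j _ => hint' j, Finset.smul_sum]
  refine Finset.sum_congr rfl fun j _ => ?_
  rw [integral_add ((iE j).const_mul _) ((iH j).const_mul _), integral_const_mul,
    integral_const_mul, smul_add, mul_smul_comm, mul_smul_comm]

end

/-- A transmission condition between decaying fields holds on almost every frequency. -/
lemma TracesAgree.ae_eq {P : Params} (hP : P.Pos) {L b : ℝ} (hb0 : 0 ≤ b) (hbL : b ≤ L) {n : CVec}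
    {U V : Space → EH} (hI : IsHalfLine (Set.Iio L) L 1) (hI' : IsHalfLine (Set.Ioi 0) 0 (-1))
    (hU : MemLp U 2 (volume.restrict {p : Space | p.1 ∈ Set.Iio L}))
    (hV : MemLp V 2 (volume.restrict {p : Space | p.1 ∈ Set.Ioi (0 : ℝ)}))
    (h : TracesAgree P n b U V) {c d : Plane → EH}
    (hUE : ∀ᵐ k, ∀ i, ftE hU k i = (c k).1 i • hI.expProfile (Params.lam_re_pos hP (wave k)))
    (hUH : ∀ᵐ k, ∀ i, ftH hU k i = (c k).2 i • hI.expProfile (Params.lam_re_pos hP (wave k)))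
    (hVE : ∀ᵐ k, ∀ i, ftE hV k i = (d k).1 i • hI'.expProfile (Params.lam_re_pos hP (wave k)))
    (hVH : ∀ᵐ k, ∀ i, ftH hV k i = (d k).2 i • hI'.expProfile (Params.lam_re_pos hP (wave k))) :
    ∀ᵐ k, impedance P n (expAt ((1 : ℝ) * P.lam (wave k)) L b • c k) =
      impedance P n (expAt ((-1 : ℝ) * P.lam (wave k)) 0 b • d k) := by
  have hU' : ∀ᶠ t in 𝓝[>] (0 : ℝ), Set.Ioo (b - 1 * t) (b - 1 * t + t) ⊆ Set.Iio L :=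
    .of_forall fun t x hx => Set.mem_Iio.2 (by linarith [hx.2])
  have hV' : ∀ᶠ t in 𝓝[>] (0 : ℝ), Set.Ioo (b - 0 * t) (b - 0 * t + t) ⊆ Set.Ioi 0 :=
    .of_forall fun t x hx => Set.mem_Ioi.2 (by linarith [hx.1])
  have tU := fun {ψ : Plane → ℂ} (hψ : IsTest Set.univ ψ) i =>
    tendsto_impedance_average hP hI hU hUE hUH zero_le_one le_rfl (by linarith) hU' hψ n i
  have tV := fun {ψ : Plane → ℂ} (hψ : IsTest Set.univ ψ) i =>
    tendsto_impedance_average hP hI' hV hVE hVH le_rfl zero_le_one (by linarith) hV' hψ n i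
  have h1 := (tracesAgree_iff (S := {p : Space | p.1 ∈ Set.Iio L})
    (T := {p : Space | p.1 ∈ Set.Ioi (0 : ℝ)}) hU
    (fun p hp => lt_of_lt_of_le (show p.1 < b from hp) hbL) hV
    (fun p hp => lt_of_le_of_lt hb0 (show b < p.1 from hp))).1 h
  have key : ∀ i, ∀ᵐ k, impedance P n (expAt ((1 : ℝ) * P.lam (wave k)) L b • c k) i -
      impedance P n (expAt ((-1 : ℝ) * P.lam (wave k)) 0 b • d k) i = 0 := by
    intro i
    refine ae_eq_zero_of_forall_integral_ift (fun ψ hψ => ?_) fun ψ hψ => ?_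
    · simp only [mul_sub]
      exact (tU hψ i).1.sub (tV hψ i).1
    · simp only [mul_sub]
      rw [integral_sub (tU hψ i).1 (tV hψ i).1]
      refine tendsto_nhds_unique ((tU hψ i).2.sub (tV hψ i).2) ((h1 i ψ hψ).congr fun t => ?_)
      rw [slabGap, one_mul, zero_mul, sub_zero, sub_add_cancel]
  filter_upwards [ae_all_iff.2 key] with k hk
  exact funext fun i => sub_eq_zero.1 (hk i)

/-! ### Contraction of the error on almost every frequency -/

lemma ampSq_smul (z : ℂ) (c d : Fin 3 → ℂ) : ampSq (z • c) (z • d) = ‖z‖ ^ 2 * ampSq c d := by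
  simp only [ampSq, Pi.smul_apply, smul_eq_mul, norm_mul, mul_pow, Finset.mul_sum, mul_add]

lemma IsAmplitude.smul {a b m p q : ℂ} {c d : Fin 3 → ℂ} (h : IsAmplitude a b m p q c d) (z : ℂ) :
    IsAmplitude a b m p q (z • c) (z • d) := by
  obtain ⟨⟨h1, h2, h3⟩, h4, h5, h6⟩ := h
  simp only [IsAmplitude, Pi.smul_apply, smul_eq_mul]
  refine ⟨⟨?_, ?_, ?_⟩, ?_, ?_, ?_⟩
  · linear_combination z * h1
  · linear_combination z * h2
  · linear_combination z * h3
  · linear_combination z * h4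
  · linear_combination z * h5
  · linear_combination z * h6

/-- The amplitude of the field with incoming data from a field that decays in the opposite
direction: the normal components, which carry the two polarizations, are multiplied by the
reflection coefficients. -/
lemma ampSq_le_of_impedance {P : Params} (hP : P.Pos) {k : Plane} (hk : k ≠ 0) {s : ℝ} {c d : EH}
    (hc : IsAmplitude P.adm P.imp (s * P.lam k) (tang k 0) (tang k 1) c.1 c.2)
    (hd : IsAmplitude P.adm P.imp ((-s : ℝ) * P.lam k) (tang k 0) (tang k 1) d.1 d.2)
    (h : s = 1 ∧ impedance P ex c = impedance P ex d ∨
      s = -1 ∧ impedance P (-ex) c = impedance P (-ex) d) :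
    ampSq c.1 c.2 ≤ ‖P.rTE k‖ ^ 2 * ampSq d.1 d.2 := by
  have hZ : (P.Z : ℂ) ≠ 0 := Complex.ofReal_ne_zero.2 hP.Z.ne'
  have hs : s * s = 1 := by
    obtain ⟨rfl, -⟩ | ⟨rfl, -⟩ := h <;> norm_num
  have hs1 : ‖s‖ = 1 := by
    obtain ⟨rfl, -⟩ | ⟨rfl, -⟩ := h <;> norm_num
  have hsC : (s : ℂ) * s = 1 := by rw [← Complex.ofReal_mul, hs, Complex.ofReal_one]
  obtain ⟨h1, h2⟩ : c.1 1 * (s / P.Z) - c.2 2 = d.1 1 * (s / P.Z) - d.2 2 ∧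
      c.1 2 * (s / P.Z) + c.2 1 = d.1 2 * (s / P.Z) + d.2 1 := by
    obtain ⟨rfl, h⟩ | ⟨rfl, h⟩ := h
    · rw [impedance_ex, impedance_ex] at h
      have e1 := congrFun h 1
      have e2 := congrFun h 2
      simp only [Matrix.cons_val] at e1 e2
      push_cast
      exact ⟨by linear_combination e2, by linear_combination -e1⟩
    · rw [impedance_neg_ex, impedance_neg_ex] at h
      have e1 := congrFun h 1
      have e2 := congrFun h 2
      simp only [Matrix.cons_val] at e1 e2
      push_cast
      exact ⟨by linear_combination e2, by linear_combination -e1⟩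
  have l1 := hc.longitudinal hP.adm_ne (s / P.Z)
  have l2 := hd.longitudinal hP.adm_ne (s / P.Z)
  have t1 := hc.transverse hP.imp_ne (s / P.Z)
  have t2 := hd.transverse hP.imp_ne (s / P.Z)
  rw [h1, h2] at l1 t1
  have e1 : c.1 0 = P.rTM k * d.1 0 := by
    rw [Params.rTM, div_mul_eq_mul_div, eq_div_iff (Params.adm_add_lam_ne hP k)]
    have h3 := l1.symm.trans l2
    push_cast at h3
    field_simp at h3
    linear_combination -h3 - (P.lam k * c.1 0 + P.lam k * d.1 0) * hsC
  have e2 : c.2 0 = P.rTE k * d.2 0 := by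
    rw [Params.rTE, div_mul_eq_mul_div, eq_div_iff (Params.imp_add_lam_ne hP k)]
    have h3 := t1.symm.trans t2
    push_cast at h3
    linear_combination -s * h3 - (P.imp / P.Z * (c.2 0 - d.2 0) + P.lam k * (c.2 0 + d.2 0)) * hsC
  refine IsAmplitude.ampSq_le (m := (-s : ℝ) * P.lam k) (m' := s * P.lam k) (x := k 0) (y := k 1)
    hd hc hP.adm_ne hP.imp_ne ?_ ?_ ?_ ?_
  · rw [norm_mul, norm_mul, Complex.norm_real, Complex.norm_real, norm_neg]
  · rw [← norm_sq_plane]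
    exact pow_pos (norm_pos_iff.2 hk) 2
  · rw [e1, norm_mul]
    exact mul_le_mul_of_nonneg_right (Params.norm_rTM_le hP k) (norm_nonneg _)
  · rw [e2, norm_mul]

/-- The norm of a decaying mode on a half-line in terms of its amplitude at the boundary. -/
lemma two_re_lam_mul_modeEnergy {P : Params} (hP : P.Pos) {I : Set ℝ} {a s : ℝ}
    (hI : IsHalfLine I a s) {U : Space → EH}
    (hU : MemLp U 2 (volume.restrict {p : Space | p.1 ∈ I})) {k : Plane} {c : EH}
    (hE : ∀ i, ftE hU k i = c.1 i • hI.expProfile (Params.lam_re_pos hP (wave k)))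
    (hH : ∀ i, ftH hU k i = c.2 i • hI.expProfile (Params.lam_re_pos hP (wave k))) :
    2 * (P.lam (wave k)).re * modeEnergy hU k = ampSq c.1 c.2 := by
  have hm := Params.lam_re_pos hP (wave k)
  simp only [modeEnergy, hE, hH, norm_smul, mul_pow, hI.norm_expProfile_sq hm, ← add_mul,
    ← Finset.sum_mul, ampSq]
  field_simp

section

variable {P : Params} (hP : P.Pos) {L : ℝ} (hL : 0 ≤ L) {U V : Space → EH}
  (hU : MemLp U 2 (volume.restrict {p : Space | p.1 ∈ Set.Iio L}))
  (hV : MemLp V 2 (volume.restrict {p : Space | p.1 ∈ Set.Ioi (0 : ℝ)}))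
  (mU : IsWeakMaxwell P {p : Space | p.1 ∈ Set.Iio L} (fun _ => 0) U)
  (mV : IsWeakMaxwell P {p : Space | p.1 ∈ Set.Ioi (0 : ℝ)} (fun _ => 0) V)

include hP hL mU mV

lemma TracesAgree.ae_modeEnergy_le_left (h : TracesAgree P ex L U V) :
    ∀ᵐ k, modeEnergy hU k ≤ ‖P.rTE (wave k)‖ ^ 2 * modeEnergy hV k := by
  have hI : IsHalfLine (Set.Iio L) L 1 := .inl ⟨rfl, rfl⟩
  have hI' : IsHalfLine (Set.Ioi 0) 0 (-1) := .inr ⟨rfl, rfl⟩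
  obtain ⟨c, hc⟩ := mU.exists_amplitude hU hP hI
  obtain ⟨d, hd⟩ := mV.exists_amplitude hV hP hI'
  have hne : ∀ᵐ k : Plane, k ≠ 0 := Measure.ae_ne volume 0
  filter_upwards [hc, hd, hne, h.ae_eq hP hL le_rfl hI hI' hU hV (hc.mono fun k h => h.2.1)
    (hc.mono fun k h => h.2.2) (hd.mono fun k h => h.2.1) (hd.mono fun k h => h.2.2)]
    with k hk1 hk2 hk0 hk3
  have hm := Params.lam_re_pos hP (wave k)
  have hw : wave k ≠ 0 := smul_ne_zero (by positivity) hk0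
  rw [expAt_self, one_smul] at hk3
  have h4 := ampSq_le_of_impedance hP hw hk1.1
    (hk2.1.smul (expAt ((-1 : ℝ) * P.lam (wave k)) 0 L)) (.inl ⟨rfl, hk3⟩)
  rw [Prod.smul_fst, Prod.smul_snd, ampSq_smul,
    ← two_re_lam_mul_modeEnergy hP hI hU hk1.2.1 hk1.2.2,
    ← two_re_lam_mul_modeEnergy hP hI' hV hk2.2.1 hk2.2.2] at h4
  have h5 : ‖expAt ((-1 : ℝ) * P.lam (wave k)) 0 L‖ ^ 2 ≤ 1 :=
    pow_le_one₀ (norm_nonneg _) (norm_expAt_le hm (by linarith))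
  have h6 : 0 ≤ 2 * (P.lam (wave k)).re * modeEnergy hV k :=
    mul_nonneg (mul_pos two_pos hm).le (modeEnergy_nonneg hV k)
  have h7 := h4.trans (mul_le_mul_of_nonneg_left (mul_le_of_le_one_left h6 h5)
    (sq_nonneg ‖P.rTE (wave k)‖))
  rw [mul_left_comm] at h7
  exact le_of_mul_le_mul_left h7 (mul_pos two_pos hm)

lemma TracesAgree.ae_modeEnergy_le_right (h : TracesAgree P (-ex) 0 U V) :
    ∀ᵐ k, modeEnergy hV k ≤ ‖P.rTE (wave k)‖ ^ 2 * modeEnergy hU k := by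
  have hI : IsHalfLine (Set.Iio L) L 1 := .inl ⟨rfl, rfl⟩
  have hI' : IsHalfLine (Set.Ioi 0) 0 (-1) := .inr ⟨rfl, rfl⟩
  obtain ⟨c, hc⟩ := mU.exists_amplitude hU hP hI
  obtain ⟨d, hd⟩ := mV.exists_amplitude hV hP hI'
  have hne : ∀ᵐ k : Plane, k ≠ 0 := Measure.ae_ne volume 0
  filter_upwards [hc, hd, hne, h.ae_eq hP le_rfl hL hI hI' hU hV (hc.mono fun k h => h.2.1)
    (hc.mono fun k h => h.2.2) (hd.mono fun k h => h.2.1) (hd.mono fun k h => h.2.2)]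
    with k hk1 hk2 hk0 hk3
  have hm := Params.lam_re_pos hP (wave k)
  have hw : wave k ≠ 0 := smul_ne_zero (by positivity) hk0
  rw [expAt_self, one_smul] at hk3
  have hk1' : IsAmplitude P.adm P.imp ((-(-1 : ℝ) : ℝ) * P.lam (wave k)) (tang (wave k) 0)
      (tang (wave k) 1) (expAt ((1 : ℝ) * P.lam (wave k)) L 0 • c k).1
      (expAt ((1 : ℝ) * P.lam (wave k)) L 0 • c k).2 := by
    rw [neg_neg]
    exact hk1.1.smul _
  have h4 := ampSq_le_of_impedance hP hw hk2.1 hk1' (.inr ⟨rfl, hk3.symm⟩)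
  rw [Prod.smul_fst, Prod.smul_snd, ampSq_smul,
    ← two_re_lam_mul_modeEnergy hP hI hU hk1.2.1 hk1.2.2,
    ← two_re_lam_mul_modeEnergy hP hI' hV hk2.2.1 hk2.2.2] at h4
  have h5 : ‖expAt ((1 : ℝ) * P.lam (wave k)) L 0‖ ^ 2 ≤ 1 :=
    pow_le_one₀ (norm_nonneg _) (norm_expAt_le hm (by linarith))
  have h6 : 0 ≤ 2 * (P.lam (wave k)).re * modeEnergy hU k :=
    mul_nonneg (mul_pos two_pos hm).le (modeEnergy_nonneg hU k)
  have h7 := h4.trans (mul_le_mul_of_nonneg_left (mul_le_of_le_one_left h6 h5)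
    (sq_nonneg ‖P.rTE (wave k)‖))
  rw [mul_left_comm] at h7
  exact le_of_mul_le_mul_left h7 (mul_pos two_pos hm)

end

/-! ### Differences of iterates -/

lemma IsWeakMaxwell.sub {P : Params} {S : Set Space} {J K : Space → CVec} {U V : Space → EH}
    (hJ : MemLp J 2 (volume.restrict S)) (hK : MemLp K 2 (volume.restrict S))
    (hU : MemLp U 2 (volume.restrict S)) (hV : MemLp V 2 (volume.restrict S))
    (h : IsWeakMaxwell P S J U) (h' : IsWeakMaxwell P S K V) :
    IsWeakMaxwell P S (fun p => J p - K p) (fun p => U p - V p) := by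
  rw [isWeakMaxwell_iff] at h h' ⊢
  obtain ⟨hU1, hU2⟩ := memLp_prod_iff_fst_snd.1 hU
  obtain ⟨hV1, hV2⟩ := memLp_prod_iff_fst_snd.1 hV
  simp only [zero_sub] at h h' ⊢
  constructor
  · have h1 := HasWeakCurl.add hU2 hV2.neg (hJ.add (hU1.const_smul P.adm))
      (hK.add (hV1.const_smul P.adm)).neg h.1 h'.1.neg
    refine Eq.mp (congrArg₂ (HasWeakCurl S) (funext fun p => ?_) (funext fun p => ?_)) h1
    · exact (sub_eq_add_neg _ _).symm
    · simp only [Pi.add_apply, Pi.neg_apply, Pi.smul_apply, Prod.fst_sub]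
      module
  · have h1 := HasWeakCurl.add hU1 hV1.neg (hU2.const_smul P.imp).neg
      ((hV2.const_smul P.imp).neg).neg h.2 h'.2.neg
    refine Eq.mp (congrArg₂ (HasWeakCurl S) (funext fun p => ?_) (funext fun p => ?_)) h1
    · exact (sub_eq_add_neg _ _).symm
    · simp only [Pi.neg_apply, Pi.smul_apply, Prod.snd_sub]
      module

lemma TracesAgree.sub {P : Params} {n : CVec} {a : ℝ} {U U' V V' : Space → EH} {S T : Set Space}
    (hU : MemLp U 2 (volume.restrict S)) (hU' : MemLp U' 2 (volume.restrict S))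
    (hS : {p | p.1 < a} ⊆ S) (hV : MemLp V 2 (volume.restrict T))
    (hV' : MemLp V' 2 (volume.restrict T)) (hT : {p | a < p.1} ⊆ T)
    (h : TracesAgree P n a U V) (h' : TracesAgree P n a U' V') :
    TracesAgree P n a (fun p => U p - U' p) (fun p => V p - V' p) := by
  rw [tracesAgree_iff hU hS hV hT] at h
  rw [tracesAgree_iff hU' hS hV' hT] at h'
  refine (tracesAgree_iff (U := fun p => U p - U' p) (V := fun p => V p - V' p) (hU.sub hU') hS
    (hV.sub hV') hT).2 fun i ψ hψ => ?_
  have h1 := (h i ψ hψ).sub (h' i ψ hψ)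
  rw [sub_zero] at h1
  refine h1.congr fun t => ?_
  have hSt : slab (a - t) a ⊆ S := fun p hp => hS hp.2
  have hTt : slab a (a + t) ⊆ T := fun p hp => hT hp.1
  simp only [slabGap, map_sub, Pi.sub_apply, mul_sub]
  rw [integral_sub (hψ.integrable_slab (memLp_impedance hU i) hSt)
    (hψ.integrable_slab (memLp_impedance hU' i) hSt),
    integral_sub (hψ.integrable_slab (memLp_impedance hV i) hTt)
    (hψ.integrable_slab (memLp_impedance hV' i) hTt), smul_sub, smul_sub]
  ring

lemma IsSchwarz.sub {P : Params} {L : ℝ} (hL : 0 ≤ L) {J : Space → CVec} (hJ : MemLp J 2 volume)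
    {U₁ U₂ V₁ V₂ : ℕ → Space → EH} (hU : IsSchwarz P L J U₁ U₂) (hV : IsSchwarz P L J V₁ V₂) :
    IsSchwarz P L (fun _ => 0) (fun n p => U₁ n p - V₁ n p) (fun n p => U₂ n p - V₂ n p) where
  memLp₁ n := (hU.memLp₁ n).sub (hV.memLp₁ n)
  memLp₂ n := (hU.memLp₂ n).sub (hV.memLp₂ n)
  maxwell₁ n := by
    have h := (hU.maxwell₁ n).sub (hJ.restrict _) (hJ.restrict _) (hU.memLp₁ _) (hV.memLp₁ _)
      (hV.maxwell₁ n)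
    simpa only [sub_self] using h
  maxwell₂ n := by
    have h := (hU.maxwell₂ n).sub (hJ.restrict _) (hJ.restrict _) (hU.memLp₂ _) (hV.memLp₂ _)
      (hV.maxwell₂ n)
    simpa only [sub_self] using h
  transmission₁ n := (hU.transmission₁ n).sub (hU.memLp₁ _) (hV.memLp₁ _) (fun _ hp => hp)
    (hU.memLp₂ _) (hV.memLp₂ _) (fun _ hp => lt_of_le_of_lt hL hp) (hV.transmission₁ n)
  transmission₂ n := (hU.transmission₂ n).sub (hU.memLp₁ _) (hV.memLp₁ _)
    (fun _ hp => lt_of_lt_of_le hp hL) (hU.memLp₂ _) (hV.memLp₂ _) (fun _ hp => hp)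
    (hV.transmission₂ n)

/-- The solution on the whole space is a fixed point of the algorithm. -/
lemma IsWeakMaxwell.isSchwarz_const {P : Params} (hP : P.Pos) (L : ℝ) {J : Space → CVec}
    (hJ : MemLp J 2 volume) {U : Space → EH} (hU : MemLp U 2 volume)
    (h : IsWeakMaxwell P Set.univ J U) : IsSchwarz P L J (fun _ => U) fun _ => U where
  memLp₁ _ := hU.restrict _
  memLp₂ _ := hU.restrict _
  maxwell₁ _ := ⟨h.1.mono (Set.subset_univ _), h.2.mono (Set.subset_univ _)⟩
  maxwell₂ _ := ⟨h.1.mono (Set.subset_univ _), h.2.mono (Set.subset_univ _)⟩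
  transmission₁ _ := (h.tracesAgree_self hP hJ hU L).1
  transmission₂ _ := (h.tracesAgree_self hP hJ hU 0).2

lemma IsSchwarz.shift {P : Params} {L : ℝ} {J : Space → CVec} {U₁ U₂ : ℕ → Space → EH}
    (h : IsSchwarz P L J U₁ U₂) : IsSchwarz P L J (fun n => U₁ (n + 1)) fun n => U₂ (n + 1) where
  memLp₁ _ := h.memLp₁ _
  memLp₂ _ := h.memLp₂ _
  maxwell₁ _ := h.maxwell₁ _
  maxwell₂ _ := h.maxwell₂ _
  transmission₁ _ := h.transmission₁ _
  transmission₂ _ := h.transmission₂ _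

section

variable {P : Params} (hP : P.Pos) {L : ℝ} (hL : 0 ≤ L) {D₁ D₂ : ℕ → Space → EH}
  (h : IsSchwarz P L (fun _ => 0) D₁ D₂)
  (m₁ : IsWeakMaxwell P (Ω₁ L) (fun _ => 0) (D₁ 0)) (m₂ : IsWeakMaxwell P Ω₂ (fun _ => 0) (D₂ 0))

/-- The energy of the pair of iterates `n` on a frequency. -/
def errorEnergy (n : ℕ) (k : Plane) : ℝ :=
  modeEnergy (I := Set.Iio L) (h.memLp₁ n) k + modeEnergy (I := Set.Ioi 0) (h.memLp₂ n) k

lemma errorEnergy_nonneg (n : ℕ) (k : Plane) : 0 ≤ errorEnergy h n k :=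
  add_nonneg (modeEnergy_nonneg _ k) (modeEnergy_nonneg _ k)

include hP hL h m₁ m₂

lemma ae_errorEnergy_le :
    ∀ᵐ k, ∀ n, errorEnergy h n k ≤ (‖P.rTE (wave k)‖ ^ 2) ^ n * errorEnergy h 0 k := by
  have m₁' : ∀ n, IsWeakMaxwell P (Ω₁ L) (fun _ => 0) (D₁ n) := fun n => by
    cases n with
    | zero => exact m₁
    | succ n => exact h.maxwell₁ n
  have m₂' : ∀ n, IsWeakMaxwell P Ω₂ (fun _ => 0) (D₂ n) := fun n => by
    cases n with
    | zero => exact m₂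
    | succ n => exact h.maxwell₂ n
  have s₁ := ae_all_iff.2 fun n => (h.transmission₁ n).ae_modeEnergy_le_left hP hL
    (h.memLp₁ (n + 1)) (h.memLp₂ n) (m₁' (n + 1)) (m₂' n)
  have s₂ := ae_all_iff.2 fun n => (h.transmission₂ n).ae_modeEnergy_le_right hP hL
    (h.memLp₁ n) (h.memLp₂ (n + 1)) (m₁' n) (m₂' (n + 1))
  filter_upwards [s₁, s₂] with k h1 h2 n
  induction n with
  | zero => simp
  | succ n ih =>
    calc errorEnergy h (n + 1) k ≤ ‖P.rTE (wave k)‖ ^ 2 * errorEnergy h n k := by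
          have := add_le_add (h1 n) (h2 n)
          unfold errorEnergy
          linarith
      _ ≤ ‖P.rTE (wave k)‖ ^ 2 * ((‖P.rTE (wave k)‖ ^ 2) ^ n * errorEnergy h 0 k) :=
          mul_le_mul_of_nonneg_left ih (sq_nonneg _)
      _ = _ := by ring

/-- Each frequency contracts geometrically, so that the norms tend to zero by dominated
convergence, although not at a uniform rate. -/
lemma tendsto_eLpNorm_zero :
    Tendsto (fun n => eLpNorm (D₁ n) 2 (volume.restrict (Ω₁ L))) atTop (𝓝 0) ∧
      Tendsto (fun n => eLpNorm (D₂ n) 2 (volume.restrict Ω₂)) atTop (𝓝 0) := by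
  have hle := ae_errorEnergy_le hP hL h m₁ m₂
  have hr : ∀ k, ‖P.rTE k‖ ^ 2 < 1 := fun k =>
    pow_lt_one₀ (norm_nonneg _) (Params.norm_rTE_lt_one hP k) two_ne_zero
  have hsplit : ∀ n k, ENNReal.ofReal (errorEnergy h n k) =
      ENNReal.ofReal (modeEnergy (I := Set.Iio L) (h.memLp₁ n) k) +
        ENNReal.ofReal (modeEnergy (I := Set.Ioi 0) (h.memLp₂ n) k) := fun n k =>
    ENNReal.ofReal_add (modeEnergy_nonneg _ k) (modeEnergy_nonneg _ k)
  have hint : ∀ n, ∫⁻ k, ENNReal.ofReal (errorEnergy h n k) =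
      (∫⁻ k, ENNReal.ofReal (modeEnergy (I := Set.Iio L) (h.memLp₁ n) k)) +
        ∫⁻ k, ENNReal.ofReal (modeEnergy (I := Set.Ioi 0) (h.memLp₂ n) k) := fun n => by
    simp only [hsplit]
    exact lintegral_add_left' (aemeasurable_modeEnergy _) _
  have hlim : Tendsto (fun n => ∫⁻ k, ENNReal.ofReal (errorEnergy h n k)) atTop (𝓝 0) := by
    have h1 := tendsto_lintegral_of_dominated_convergence' (μ := (volume : Measure Plane))
      (F := fun n k => ENNReal.ofReal (errorEnergy h n k)) (f := fun _ => 0)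
      (fun k => ENNReal.ofReal (errorEnergy h 0 k)) (fun n => ?_) (fun n => ?_) ?_ ?_
    · simpa using h1
    · simp only [hsplit]
      exact (aemeasurable_modeEnergy _).add (aemeasurable_modeEnergy _)
    · filter_upwards [hle] with k hk
      refine ENNReal.ofReal_le_ofReal ((hk n).trans ?_)
      exact mul_le_of_le_one_left (errorEnergy_nonneg h 0 k)
        (pow_le_one₀ (sq_nonneg _) (hr _).le)
    · rw [hint]
      exact (ENNReal.add_lt_top.2 ⟨lintegral_modeEnergy_lt_top _,
        lintegral_modeEnergy_lt_top _⟩).ne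
    · filter_upwards [hle] with k hk
      rw [← ENNReal.ofReal_zero]
      refine ENNReal.tendsto_ofReal ?_
      have h2 := (tendsto_pow_atTop_nhds_zero_of_lt_one (sq_nonneg ‖P.rTE (wave k)‖)
        (hr (wave k))).mul_const (errorEnergy h 0 k)
      rw [zero_mul] at h2
      exact squeeze_zero (fun n => errorEnergy_nonneg h n k) hk h2
  have key : ∀ {a : ℕ → ENNReal},
      (∀ n, a n ^ (2 : ℝ) ≤ ∫⁻ k, ENNReal.ofReal (errorEnergy h n k)) →
      Tendsto a atTop (𝓝 0) := by
    intro a ha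
    have h1 := tendsto_of_tendsto_of_tendsto_of_le_of_le tendsto_const_nhds hlim
      (fun n => zero_le) ha
    have h2 := (ENNReal.continuous_rpow_const (y := (2 : ℝ)⁻¹)).tendsto 0 |>.comp h1
    rw [ENNReal.zero_rpow_of_pos (by norm_num)] at h2
    refine h2.congr fun n => ?_
    simp only [Function.comp]
    rw [← ENNReal.rpow_mul, mul_inv_cancel₀ two_ne_zero, ENNReal.rpow_one]
  refine ⟨key fun n => ?_, key fun n => ?_⟩
  · exact (eLpNorm_sq_le (I := Set.Iio L) (h.memLp₁ n)).trans (by rw [hint]; exact le_self_add)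
  · exact (eLpNorm_sq_le (I := Set.Ioi 0) (h.memLp₂ n)).trans (by rw [hint]; exact le_add_self)

lemma ae_eq_zero_of_initial (h0 : ∀ᵐ k, errorEnergy h 0 k = 0) (n : ℕ) :
    D₁ n =ᵐ[volume.restrict (Ω₁ L)] 0 ∧ D₂ n =ᵐ[volume.restrict Ω₂] 0 := by
  have h1 : ∀ᵐ k, errorEnergy h n k = 0 := by
    filter_upwards [ae_errorEnergy_le hP hL h m₁ m₂, h0] with k hk hk0
    have := hk n
    rw [hk0, mul_zero] at this
    exact le_antisymm this (errorEnergy_nonneg h n k)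
  constructor
  · refine eLpNorm_eq_zero_of_modeEnergy (I := Set.Iio L) (h.memLp₁ n) (h1.mono fun k hk => ?_)
    exact ((add_eq_zero_iff_of_nonneg (modeEnergy_nonneg _ k) (modeEnergy_nonneg _ k)).1 hk).1
  · refine eLpNorm_eq_zero_of_modeEnergy (I := Set.Ioi 0) (h.memLp₂ n) (h1.mono fun k hk => ?_)
    exact ((add_eq_zero_iff_of_nonneg (modeEnergy_nonneg _ k) (modeEnergy_nonneg _ k)).1 hk).2

end

lemma ae_modeEnergy_eq_zero {I : Set ℝ} {U : Space → EH}
    (hU : MemLp U 2 (volume.restrict {p : Space | p.1 ∈ I})) (h : ∀ p, U p = 0) :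
    ∀ᵐ k, modeEnergy hU k = 0 := by
  have h1 := lintegral_modeEnergy hU
  simp only [h, Prod.fst_zero, Prod.snd_zero, Pi.zero_apply, enorm_zero,
    ENNReal.zero_rpow_of_pos two_pos, lintegral_zero, add_zero, Finset.sum_const_zero] at h1
  filter_upwards [(lintegral_eq_zero_iff' (aemeasurable_modeEnergy hU)).1 h1] with k hk
  exact le_antisymm (ENNReal.ofReal_eq_zero.1 hk) (modeEnergy_nonneg hU k)

lemma isWeakMaxwell_zero {P : Params} {S : Set Space} {U : Space → EH} (h : ∀ p, U p = 0) :
    IsWeakMaxwell P S (fun _ => 0) U := by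
  constructor <;> intro φ _ <;> simp [h]

/-- The iterates are determined by the guess. -/
theorem IsSchwarz.ae_eq {P : Params} (hP : P.Pos) {L : ℝ} (hL : 0 ≤ L) {J : Space → CVec}
    (hJ : MemLp J 2 volume) {U₁ U₂ V₁ V₂ : ℕ → Space → EH} (hU : IsSchwarz P L J U₁ U₂)
    (hV : IsSchwarz P L J V₁ V₂) (h₁ : U₁ 0 = V₁ 0) (h₂ : U₂ 0 = V₂ 0) (n : ℕ) :
    U₁ n =ᵐ[volume.restrict (Ω₁ L)] V₁ n ∧ U₂ n =ᵐ[volume.restrict Ω₂] V₂ n := by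
  have hD := hU.sub hL hJ hV
  have z₁ : ∀ p, U₁ 0 p - V₁ 0 p = 0 := fun p => by rw [h₁, sub_self]
  have z₂ : ∀ p, U₂ 0 p - V₂ 0 p = 0 := fun p => by rw [h₂, sub_self]
  have h0 : ∀ᵐ k, errorEnergy hD 0 k = 0 := by
    filter_upwards [ae_modeEnergy_eq_zero (I := Set.Iio L) (hD.memLp₁ 0) z₁,
      ae_modeEnergy_eq_zero (I := Set.Ioi 0) (hD.memLp₂ 0) z₂] with k h1 h2
    rw [errorEnergy, h1, h2, add_zero]
  obtain ⟨h3, h4⟩ := ae_eq_zero_of_initial hP hL hD (isWeakMaxwell_zero z₁)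
    (isWeakMaxwell_zero z₂) h0 n
  exact ⟨h3.mono fun p hp => sub_eq_zero.1 hp, h4.mono fun p hp => sub_eq_zero.1 hp⟩

/-- The iterates converge to the solution on the whole space. -/
theorem IsSchwarz.tendsto {P : Params} (hP : P.Pos) {L : ℝ} (hL : 0 ≤ L) {J : Space → CVec}
    (hJ : MemLp J 2 volume) {U : Space → EH} (hU : MemLp U 2 volume)
    (hM : IsWeakMaxwell P Set.univ J U) {U₁ U₂ : ℕ → Space → EH} (h : IsSchwarz P L J U₁ U₂) :
    Tendsto (fun n => eLpNorm (U₁ n - U) 2 (volume.restrict (Ω₁ L))) atTop (𝓝 0) ∧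
      Tendsto (fun n => eLpNorm (U₂ n - U) 2 (volume.restrict Ω₂)) atTop (𝓝 0) := by
  have hD := h.sub hL hJ (hM.isSchwarz_const hP L hJ hU)
  -- only the errors from the first iterate on solve the homogeneous system
  obtain ⟨h1, h2⟩ := tendsto_eLpNorm_zero hP hL hD.shift (hD.maxwell₁ 0) (hD.maxwell₂ 0)
  exact ⟨(tendsto_add_atTop_iff_nat 1).1 h1, (tendsto_add_atTop_iff_nat 1).1 h2⟩

/-- The solution on the whole space is unique. -/
theorem IsWeakMaxwell.ae_eq {P : Params} (hP : P.Pos) {J : Space → CVec} (hJ : MemLp J 2 volume)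
    {U V : Space → EH} (hU : MemLp U 2 volume) (hV : MemLp V 2 volume)
    (h : IsWeakMaxwell P Set.univ J U) (h' : IsWeakMaxwell P Set.univ J V) : V =ᵐ[volume] U := by
  have h1 := h'.sub (hJ.restrict _) (hJ.restrict _) (hV.restrict _) (hU.restrict _) h
  simp only [sub_self] at h1
  exact (h1.ae_eq_zero hP (hV.sub hU)).mono fun p hp => sub_eq_zero.1 hp

end MaxwellSchwarz

end

theorem theorem3p1 (P : Params) (L : ℝ) (hω : 0 < P.ω) (hε : 0 < P.ε) (hμ : 0 < P.μ)
    (hσ : 0 < P.σ) (hL : 0 ≤ L) :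
    (∀ J : Space → CVec, MemLp J 2 volume →
      -- the problem on the whole space has exactly one square integrable solution
      ∃ U : Space → EH, (MemLp U 2 volume ∧ IsWeakMaxwell P Set.univ J U) ∧
        (∀ V : Space → EH, MemLp V 2 volume → IsWeakMaxwell P Set.univ J V → V =ᵐ[volume] U) ∧
        -- from any square integrable guess, the iterates converge to it
        (∀ U₁ U₂ : ℕ → Space → EH, IsSchwarz P L J U₁ U₂ →
          Tendsto (fun n => eLpNorm (U₁ n - U) 2 (volume.restrict (Ω₁ L))) atTop (𝓝 0) ∧
          Tendsto (fun n => eLpNorm (U₂ n - U) 2 (volume.restrict Ω₂)) atTop (𝓝 0)) ∧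
        -- the iterates are determined by the guess
        (∀ U₁ U₂ V₁ V₂ : ℕ → Space → EH, IsSchwarz P L J U₁ U₂ → IsSchwarz P L J V₁ V₂ →
          U₁ 0 = V₁ 0 → U₂ 0 = V₂ 0 → ∀ n,
            U₁ n =ᵐ[volume.restrict (Ω₁ L)] V₁ n ∧ U₂ n =ᵐ[volume.restrict Ω₂] V₂ n) ∧
        -- the iterates exist as soon as the guess has tangential traces on the interfaces
        (∀ G₁ G₂ : Space → EH, MemLp G₁ 2 (volume.restrict (Ω₁ L)) →
          MemLp G₂ 2 (volume.restrict Ω₂) →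
          (∃ δ > 0, HasSqIntegrableCurl (slab (-δ) 0) G₁ ∧
            HasSqIntegrableCurl (slab L (L + δ)) G₂) →
          ∃ U₁ U₂ : ℕ → Space → EH, U₁ 0 = G₁ ∧ U₂ 0 = G₂ ∧ IsSchwarz P L J U₁ U₂)) ∧
    (∀ k : Plane, IsModeConvergenceFactor P L k (P.rho L k)) := by
  have hP : P.Pos := ⟨hω, hε, hμ, hσ⟩
  refine ⟨fun J hJ => ?_, isModeConvergenceFactor_rho hP hL⟩
  obtain ⟨U, hU, hM⟩ := exists_wholeSpace hP hJ
  exact ⟨U, ⟨hU, hM⟩, fun V hV hMV => hM.ae_eq hP hJ hU hV hMV,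
    fun U₁ U₂ h => h.tendsto hP hL hJ hU hM,
    fun U₁ U₂ V₁ V₂ h h' h₁ h₂ => h.ae_eq hP hL hJ h' h₁ h₂,
    fun G₁ G₂ hG₁ hG₂ ⟨δ, hδ, hc₁, hc₂⟩ => exists_isSchwarz hP hL hJ hG₁ hG₂ hδ hc₁ hc₂⟩
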